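/- **The surface.** Let $0<s<1$. In the plane let $R^+=[0,s]\times[0,1]$ and $R^-=[-s,0]\times[s,1+s]$; they share exactly the segment $\{0\}\times[s,1]$. Let $X_s$ be the quotient of the octagon $R^+\cup R^-$ by the identifications (A) $(s,y)\sim(0,sy)$ and (C) $(-s,s+y)\sim(0,1+sy)$ for $0\le y\le1$; (B) $(x,0)\sim(x,1)$ for $0\le x\le s$; (D) $(x,s)\sim(x,1+s)$ for $-s\le x\le0$. This is a closed surface of genus 2; let $Z$ be the image of the vertices (a single point). The identifications are direct homotheties, so $X_s\setminus Z$ has an atlas whose transition maps are of the form $z\mapsto az+b$ with $a>0$, and slopes $m\in\mathbb{RP}^1=\mathbb R\cup\{\infty\}$ are well defined on $X_s\setminus Z$. **Trajectories.** A linear trajectory of slope $m$ is a continuous curve $\tau:I\to X_s$ on a nondegenerate interval $I$ that maps the interior of $I$ into $X_s\setminus Z$ and there, in local coordinates, moves along straight lines of slope $m$ with locally constant speed. It is oriented forward if it moves to the right (upward if $m=\infty$) and backward otherwise. It is maximal if $I$ cannot be enlarged; critical if $I$ contains an endpoint mapped into $Z$; a saddle connection if $I=[a,b]$ is compact and both endpoints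 are mapped into $Z$. A cycle is the image of a maximal trajectory that is not a saddle connection and whose image is homeomorphic to a circle. A lamination is a nowhere dense, relatively closed subset of $X_s\setminus Z$ that is a union of images in $X_s\setminus Z$ of maximal trajectories (leaves) of one slope. A trajectory $\tau$ on $I$ is eventually in $V$ if for some $t_0\in I$ we have $\tau(t)\in V$ for all $t\in I$ with $t>t_0$ (no condition if $I$ has a last point, that is, if a maximal trajectory runs into $Z$). It is asymptotic to a closed set $K\subset X_s$ if it is eventually in every open set containing $K$ and for every $t_0\in I$ every point of $K$ lies in the closure of $\{\tau(t): t\in I,\ t>t_0\}$. **Attractors.** A forward attractor for slope $m$ is a relatively closed set $\Sigma\subset X_s\setminus Z$ such that (1) every maximal forward trajectory of slope $m$ starting in $\Sigma$ remains in $\Sigma$ as long as it does not meet $Z$; (2) there is an open set $U\supset\Sigma$ such that, for every open $V\subset X_s$ containing the closure $\overline\Sigma$ of $\Sigma$ in $X_s$, every maximal forward trajectory of slope $m$ starting in $U$ is eventually in $V$; (3) $\Sigma$ is the closure in $X_s\setminus Z$ of the image of a forward trajectory $\tau(t)$, $t\ge0$, of slope $m$. The largest open $U$ as in (2) is the basin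 of $\Sigma$. Backward attractors (repellers) and their basins are defined in the same way with backward trajectories. An attracting (repelling) cycle or lamination in direction $m$ is a cycle or lamination of slope $m$ that is a forward (backward) attractor for slope $m$. A Cantor set is a nonempty, compact, totally disconnected metrizable space without isolated points. Measure-zero sets and Hausdorff dimension in $\mathbb{RP}^1$ are taken in the affine coordinates $m$ and $1/m$. **Theorem.** For every $0<s<1$ there are sets $U_s,C_s,C'_s\subset\mathbb{RP}^1$ with the following properties. (i) $U_s$ is open and of full measure, and for every $m\in U_s$ there are an attracting cycle $\Sigma^+$ and a repelling cycle $\Sigma^-$ in direction $m$, each of whose basins is dense in $X_s$. (ii) $C_s=\mathbb{RP}^1\setminus U_s$ is a Cantor set of Hausdorff dimension $0$. (iii) $C'_s$ is countable, and it is the set of all $m\in C_s$ for which there is a saddle connection $\tau_m$ of slope $m$ such that all maximal non-critical forward trajectories of slope $m$ are asymptotic to the image of $\tau_m$. (iv) For every $m\in C_s\setminus C'_s$ other than the vertical direction $m=\infty$, there are an attracting lamination $\Sigma^+$ and a repelling lamination $\Sigma^-$ in direction $m$ with the following properties. Every leaf of $\Sigma^+$ meets the side $\{s\}\times[0,1]$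 of $R^+$, and the intersection of $\overline{\Sigma^+}$ with this side is a Cantor set of Hausdorff dimension $0$ (in the parameter $y\in[0,1]$); the same holds for $\Sigma^-$ and the side $\{-s\}\times[s,1+s]$ of $R^-$. The basin of $\Sigma^+$ is the complement of $\Sigma^-$ in $X_s\setminus Z$. -/

import Mathlib

open Set Filter Topology MeasureTheory

namespace HomothetySurface

/-! ### The surface `X_s`

In the plane put `R⁺ = [0,s] × [0,1]` and `R⁻ = [-s,0] × [s,1+s]`.  They meet exactly in the segment
`E = {0} × [s,1]`, the top part of the left side of `R⁺` and the bottom part of the right side of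
`R⁻`, so that their union is an eight-sided polygon.  Its sides are glued in pairs. -/

/-- The octagon `R⁺ ∪ R⁻`. -/
def polygon (s : ℝ) : Set (ℝ × ℝ) :=
  (Icc 0 s ×ˢ Icc 0 1) ∪ (Icc (-s) 0 ×ˢ Icc s (1 + s))

/-- The side pairings: `A` (right side of `R⁺` with the lower part of its left side, a homothety
of ratio `s`), `B` (bottom and top of `R⁺`, a translation), `C` (left side of `R⁻` with the upper
part of its right side, a homothety of ratio `s`), `D` (bottom and top of `R⁻`, a translation). -/
inductive Glue (s : ℝ) : polygon s → polygon s → Prop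
  | edgeA (p q : polygon s) (y : ℝ) (hy : y ∈ Icc (0 : ℝ) 1)
      (hp : (p : ℝ × ℝ) = (s, y)) (hq : (q : ℝ × ℝ) = (0, s * y)) : Glue s p q
  | edgeB (p q : polygon s) (x : ℝ) (hx : x ∈ Icc 0 s)
      (hp : (p : ℝ × ℝ) = (x, 0)) (hq : (q : ℝ × ℝ) = (x, 1)) : Glue s p q
  | edgeC (p q : polygon s) (y : ℝ) (hy : y ∈ Icc (0 : ℝ) 1)
      (hp : (p : ℝ × ℝ) = (-s, s + y)) (hq : (q : ℝ × ℝ) = (0, 1 + s * y)) : Glue s p q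
  | edgeD (p q : polygon s) (x : ℝ) (hx : x ∈ Icc (-s) 0)
      (hp : (p : ℝ × ℝ) = (x, s)) (hq : (q : ℝ × ℝ) = (x, 1 + s)) : Glue s p q

/-- The surface `X_s`: the quotient of the octagon by the equivalence relation generated by the
side pairings. -/
def Surface (s : ℝ) : Type := Quot (Glue s)

/-- `X_s` carries the quotient topology. -/
instance (s : ℝ) : TopologicalSpace (Surface s) :=
  inferInstanceAs (TopologicalSpace (Quot (Glue s)))

/-- `Rep s z q`: the planar point `z` lies in the octagon, and `q` is its image in `X_s`. -/
def Rep (s : ℝ) (z : ℝ × ℝ) (q : Surface s) : Prop :=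
  ∃ h : z ∈ polygon s, (Quot.mk (Glue s) ⟨z, h⟩ : Surface s) = q

/-- The eight vertices of the octagon. -/
def vertices (s : ℝ) : Set (ℝ × ℝ) :=
  {(0, 0), (s, 0), (s, 1), (0, 1), (0, s), (-s, s), (-s, 1 + s), (0, 1 + s)}

/-- The singular set `Z` of `X_s`: the image of the vertices. -/
def singularSet (s : ℝ) : Set (Surface s) := {q | ∃ v ∈ vertices s, Rep s v q}

/-! ### The homothety structure on `X_s \ Z`

For the interior of the octagon and for each pair of sides there is a local parametrization: an
open set of the plane, and a map of it into the octagon which is the identity on one side of the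
edge and is the gluing homothety on the other side.  Followed by the quotient map these are the
inverses of charts of an atlas of `X_s \ Z` with direct homotheties as transition maps. -/

/-- The labels of the five local parametrizations. -/
inductive ChartIndex
  | interior | A | B | C | D

/-- The open planar domain of a local parametrization. -/
def chartDomain (s : ℝ) : ChartIndex → Set (ℝ × ℝ)
  | .interior => _root_.interior (polygon s)
  | .A => Ioo (s / 2) (s + 1 / 2) ×ˢ Ioo 0 1
  | .B => Ioo 0 s ×ˢ Ioo (1 / 2) (3 / 2)
  | .C => Ioo (-s - 1 / 2) (-s / 2) ×ˢ Ioo s (1 + s)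
  | .D => Ioo (-s) 0 ×ˢ Ioo (s + 1 / 2) (s + 3 / 2)

/-- The point of the octagon that represents a point of the domain of a local parametrization. -/
noncomputable def chartFold (s : ℝ) : ChartIndex → ℝ × ℝ → ℝ × ℝ
  | .interior => fun z => z
  | .A => fun z => if z.1 ≤ s then z else (s * (z.1 - s), s * z.2)
  | .B => fun z => if z.2 ≤ 1 then z else (z.1, z.2 - 1)
  | .C => fun z => if -s ≤ z.1 then z else (s * (z.1 + s), 1 + s * (z.2 - s))
  | .D => fun z => if z.2 ≤ 1 + s then z else (z.1, z.2 - 1)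

/-! ### Directions

The space of slopes is `ℝP¹ = ℝ ∪ {∞}`, the one-point compactification of `ℝ`. -/

/-- A vector of slope `m`, pointing forward: to the right, or upward if `m = ∞`. -/
def dirVec (m : OnePoint ℝ) : ℝ × ℝ := m.elim (0, 1) (fun a => (1, a))

/-- The affine chart `u ↦ 1/u` of `ℝP¹` around `∞`; the other affine chart is `ℝ ⊆ ℝP¹`. -/
noncomputable def chartAtInfinity (u : ℝ) : OnePoint ℝ :=
  if u = 0 then OnePoint.infty else ((u⁻¹ : ℝ) : OnePoint ℝ)

/-- A set of directions has full measure if its complement is Lebesgue null in both affine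
charts of `ℝP¹`. -/
def FullMeasure (U : Set (OnePoint ℝ)) : Prop :=
  volume {a : ℝ | (a : OnePoint ℝ) ∉ U} = 0 ∧ volume {u : ℝ | chartAtInfinity u ∉ U} = 0

/-- The Hausdorff dimension of a set of directions, computed in the two affine charts. -/
noncomputable def dirDimH (S : Set (OnePoint ℝ)) : ENNReal :=
  max (dimH {a : ℝ | (a : OnePoint ℝ) ∈ S}) (dimH {u : ℝ | chartAtInfinity u ∈ S})

/-- A Cantor set (in a metrizable space): nonempty, compact, without isolated points, totally
disconnected. -/
def IsCantorSet {α : Type*} [TopologicalSpace α] (K : Set α) : Prop :=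
  K.Nonempty ∧ IsCompact K ∧ Preperfect K ∧ IsTotallyDisconnected K

/-! ### Linear trajectories -/

/-- At time `t` the curve `τ` moves in a local coordinate along a straight line, with constant
velocity a positive multiple of `d`. -/
def StraightAt (s : ℝ) (d : ℝ × ℝ) (τ : ℝ → Surface s) (t : ℝ) : Prop :=
  ∃ (c : ChartIndex) (z : ℝ × ℝ) (v : ℝ), 0 < v ∧
    ∀ᶠ u in 𝓝 t, z + (v * (u - t)) • d ∈ chartDomain s c ∧
      Rep s (chartFold s c (z + (v * (u - t)) • d)) (τ u)

/-- `τ`, restricted to the interval `I`, is a linear trajectory with (oriented) direction `d`, of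
locally constant speed.  The values of `τ` outside `I` are irrelevant. -/
structure IsTrajectory (s : ℝ) (d : ℝ × ℝ) (I : Set ℝ) (τ : ℝ → Surface s) : Prop where
  interval : I.OrdConnected
  nondegenerate : (interior I).Nonempty
  continuous : ContinuousOn τ I
  regular : ∀ t ∈ interior I, τ t ∉ singularSet s
  straight : ∀ t ∈ interior I, StraightAt s d τ t

/-- A linear trajectory whose domain cannot be extended to a larger interval. -/
structure IsMaxTrajectory (s : ℝ) (d : ℝ × ℝ) (I : Set ℝ) (τ : ℝ → Surface s) : Prop
    extends IsTrajectory s d I τ where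
  maximal : ∀ (J : Set ℝ) (σ : ℝ → Surface s),
    IsTrajectory s d J σ → I ⊆ J → EqOn σ τ I → J = I

/-- A trajectory is critical if its domain includes an endpoint that is mapped into `Z`. -/
def IsCritical (s : ℝ) (I : Set ℝ) (τ : ℝ → Surface s) : Prop :=
  ∃ t ∈ I \ interior I, τ t ∈ singularSet s

/-- A saddle connection: a trajectory with compact domain `[a,b]`, both ends of which lie
in `Z`. -/
def IsSaddleConnection (s : ℝ) (d : ℝ × ℝ) (I : Set ℝ) (τ : ℝ → Surface s) : Prop :=
  IsTrajectory s d I τ ∧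
    ∃ a b : ℝ, a < b ∧ I = Icc a b ∧ τ a ∈ singularSet s ∧ τ b ∈ singularSet s

/-- The curve `τ` on `I` is eventually always in `V`, that is, from some time of `I` on.
(If `I` has a last point, there is nothing to check.) -/
def EventuallyIn {s : ℝ} (I : Set ℝ) (τ : ℝ → Surface s) (V : Set (Surface s)) : Prop :=
  ∃ t₀ ∈ I, ∀ t ∈ I, t₀ < t → τ t ∈ V

/-- The curve `τ` on `I` is asymptotic to `K`: it is eventually in every neighbourhood of `K`, and
it accumulates at every point of `K`. -/
def IsAsymptoticTo {s : ℝ} (I : Set ℝ) (τ : ℝ → Surface s) (K : Set (Surface s)) : Prop :=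
  (∀ V, IsOpen V → K ⊆ V → EventuallyIn I τ V) ∧
    ∀ t₀ ∈ I, K ⊆ closure (τ '' (I ∩ Ioi t₀))

/-- A (linear) cycle with direction `d`: the image of a closed trajectory, that is, of a maximal
trajectory which is not a saddle connection and whose image is homeomorphic to a circle. -/
def IsCycle (s : ℝ) (d : ℝ × ℝ) (L : Set (Surface s)) : Prop :=
  ∃ (I : Set ℝ) (τ : ℝ → Surface s), IsMaxTrajectory s d I τ ∧ ¬ IsSaddleConnection s d I τ ∧
    τ '' I = L ∧ Nonempty (L ≃ₜ Circle)

/-- A (linear) lamination with direction `d`: a nowhere dense, relatively closed subset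
of `X_s \ Z` which is a union of images (in `X_s \ Z`) of maximal trajectories, its leaves. -/
structure IsLamination (s : ℝ) (d : ℝ × ℝ) (L : Set (Surface s)) : Prop where
  regular : Disjoint L (singularSet s)
  closed : closure L \ singularSet s = L
  nowhereDense : IsNowhereDense L
  leaves : ∃ F : Set (Set (Surface s)), L = ⋃₀ F ∧
    ∀ l ∈ F, ∃ (I : Set ℝ) (τ : ℝ → Surface s),
      IsMaxTrajectory s d I τ ∧ l = τ '' I \ singularSet s

/-! ### Attractors -/

/-- Every trajectory in direction `d` that starts in `U` is eventually always in any given open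
set `V` that contains the closure of `L` in `X_s`. -/
def Attracts (s : ℝ) (d : ℝ × ℝ) (U L : Set (Surface s)) : Prop :=
  ∀ V, IsOpen V → closure L ⊆ V → ∀ (I : Set ℝ) (τ : ℝ → Surface s),
    IsMaxTrajectory s d I τ → 0 ∈ I → τ 0 ∈ U → EventuallyIn I τ V

/-- `L` is an attractor for the trajectories in direction `d`.  For `d = dirVec m` it is a forward
attractor for the slope `m`, for `d = -dirVec m` a backward attractor, that is, a repeller. -/
structure IsAttractor (s : ℝ) (d : ℝ × ℝ) (L : Set (Surface s)) : Prop where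
  regular : Disjoint L (singularSet s)
  closed : closure L \ singularSet s = L
  invariant : ∀ (I : Set ℝ) (τ : ℝ → Surface s), IsMaxTrajectory s d I τ → 0 ∈ I → τ 0 ∈ L →
    ∀ t ∈ I, 0 ≤ t → τ t ∈ L ∪ singularSet s
  attracts : ∃ U, IsOpen U ∧ L ⊆ U ∧ Attracts s d U L
  generated : ∃ (I : Set ℝ) (τ : ℝ → Surface s), IsMaxTrajectory s d I τ ∧ 0 ∈ I ∧
    (I ∩ Ioi 0).Nonempty ∧ L = closure (τ '' (I ∩ Ici 0)) \ singularSet s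

/-- The basin of attraction of `L`: the largest open set containing `L` that is attracted
to `L`. -/
def basin (s : ℝ) (d : ℝ × ℝ) (L : Set (Surface s)) : Set (Surface s) :=
  ⋃₀ {U | IsOpen U ∧ L ⊆ U ∧ Attracts s d U L}

/-! ### Cross-sections -/

/-- The right side `A` of `R⁺`, parametrized upward by `[0,1]`. -/
def sideA (s : ℝ) (y : ℝ) : ℝ × ℝ := (s, y)

/-- The left side `C` of `R⁻`, parametrized upward by `[0,1]`. -/
def sideC (s : ℝ) (y : ℝ) : ℝ × ℝ := (-s, s + y)

/-- The intersection of the closure of `L` with a side of the octagon, as a set of parameters. -/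
def crossSection (s : ℝ) (side : ℝ → ℝ × ℝ) (L : Set (Surface s)) : Set ℝ :=
  {y | y ∈ Icc (0 : ℝ) 1 ∧ ∃ q ∈ closure L, Rep s (side y) q}

/-- The given side is met by every leaf of `L`, and the cross-section of `L` along this side is a
Cantor set of Hausdorff dimension `0`. -/
def HasCantorCrossSection (s : ℝ) (d : ℝ × ℝ) (side : ℝ → ℝ × ℝ) (L : Set (Surface s)) : Prop :=
  (∀ (I : Set ℝ) (τ : ℝ → Surface s), IsMaxTrajectory s d I τ → τ '' I \ singularSet s ⊆ L →
    ∃ t ∈ I, ∃ y ∈ Icc (0 : ℝ) 1, Rep s (side y) (τ t)) ∧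
  IsCantorSet (crossSection s side L) ∧ dimH (crossSection s side L) = 0

/-- All non-critical trajectories with slope `m` are asymptotic, in the forward direction, to one
saddle connection with slope `m`. -/
def HasAsymptoticSaddleConnection (s : ℝ) (m : OnePoint ℝ) : Prop :=
  ∃ (J : Set ℝ) (σ : ℝ → Surface s), IsSaddleConnection s (dirVec m) J σ ∧
    ∀ (I : Set ℝ) (τ : ℝ → Surface s), IsMaxTrajectory s (dirVec m) I τ → ¬ IsCritical s I τ →
      IsAsymptoticTo I τ (σ '' J)

end HomothetySurface

set_option linter.unusedSectionVars false

namespace HomothetySurface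

/-! ### Weighted sums of integer codes -/

/-! The side pairings `B` and `D` turn `R⁺` and `R⁻` into cylinders that share the edge `E = {0} ×
[s,1]`. Let the slope `m` be finite. A forward trajectory can leave `R⁺` only through the right
side, which is glued to the lower part of the left side of `R⁺` itself. It therefore stays in `R⁺`,
and the heights `s * y` at which it starts its successive crossings follow the contracted rotation
`y ↦ s * y + δ` mod 1 with `δ = s * m`. The rotation of the octagon by `π` exchanges `R⁺` and `R⁻`
and reverses directions, so `R⁻` carries the repeller, and only attractors have to be studied.

The lift `x ↦ s * x + (1 - s) * ⌊x⌋ + δ` of the contracted rotation is increasing of degree one. The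
explicit series `stair` solves the equation that makes it a conjugacy from the translation by `ρ` to
this lift. It does so for `δ` between `plateauLo s ρ` and `plateauHi s ρ`, up to a convention at the
upper end. These intervals are disjoint and increase with `ρ`, cover the line
(`exists_mem_plateau`), and are nondegenerate exactly for rational `ρ`. The integer parts along any
orbit agree with those along an orbit of the translation (`coding_dichotomy`), and equal integer
parts mean contraction by `s` at every step. So all orbits approach `circleAttractor`, the closure
of the image of `stair`. It is a periodic orbit avoiding the discontinuity if `δ` is inside a
rational interval, a finite orbit from the discontinuity back to it at an end of such an interval,
and a Cantor set through the discontinuity if `ρ` is irrational.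

`U_s` consists of the slopes inside the rational intervals. Its complement, like the attractors,
consists of values of series `∑ s ^ k * a k x` with monotone integer codes. The first `N` codes take
polynomially many values and fix the sum up to an exponentially small error, whence dimension zero
(`dimH_closure_image_codes`).

On the surface, `sheet` sweeps the attractor across `R⁺`. A trajectory that neither runs into `Z`
nor crosses `R⁺` stays in `R⁻` for ever. Read backwards, its heights are iterates of arbitrarily
high order of the contraction, so it lies in the rotated sheet. This determines the basins
(`attracts_sheet`, `basin_sheet`). The three kinds of attractors become a closed cycle
(`isCycle_sheet`), a saddle connection that attracts all non-critical trajectories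
(`hasAsymptoticSaddleConnection`), and a lamination (`isLamination_sheet`). In the last case the
orbit of the discontinuity never returns to it, which excludes saddle connections in the sheet and
makes the set in (iii) countable. -/

lemma summable_pow_mul_of_le {s : ℝ} (hs : s ∈ Ioo (0 : ℝ) 1) {a : ℕ → ℝ} {A B : ℝ}
    (h : ∀ k, |a k| ≤ A + B * k) : Summable fun k => s ^ k * a k := by
  have h1 : Summable fun k : ℕ => s ^ k * (A + B * k) := by
    have e1 := (summable_geometric_of_lt_one hs.1.le hs.2).mul_right A
    have e2 := (summable_pow_mul_geometric_of_norm_lt_one (R := ℝ) 1 (r := s)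
      (by rw [Real.norm_eq_abs, abs_of_pos hs.1]; exact hs.2)).mul_right B
    refine (e1.add e2).congr fun k => ?_
    simp only [pow_one]; ring
  refine Summable.of_norm_bounded h1 fun k => ?_
  rw [Real.norm_eq_abs, abs_mul, abs_of_pos (pow_pos hs.1 k)]
  exact mul_le_mul_of_nonneg_left (h k) (pow_pos hs.1 k).le

lemma abs_floor_sub_le (t ρ : ℝ) (k : ℕ) :
    |((⌊t - (k + 1) * ρ⌋ : ℤ) : ℝ)| ≤ (|t| + |ρ| + 1) + |ρ| * k := by
  have h1 := Int.floor_le (t - (k + 1) * ρ)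
  have h2 := Int.lt_floor_add_one (t - (k + 1) * ρ)
  have h3 : |t - (k + 1) * ρ| ≤ |t| + (k + 1) * |ρ| := by
    calc |t - (k + 1) * ρ| ≤ |t| + |(k + 1) * ρ| := abs_sub _ _
      _ = |t| + (k + 1) * |ρ| := by rw [abs_mul, abs_of_nonneg (by positivity : (0 : ℝ) ≤ k + 1)]
  rw [abs_le] at h3 ⊢
  constructor <;> nlinarith [h3.1, h3.2]

lemma summable_floor {s : ℝ} (hs : s ∈ Ioo (0 : ℝ) 1) (t ρ : ℝ) :
    Summable fun k : ℕ => s ^ k * ((⌊t - (k + 1) * ρ⌋ : ℤ) : ℝ) :=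
  summable_pow_mul_of_le hs (abs_floor_sub_le t ρ)

lemma summable_ceil {s : ℝ} (hs : s ∈ Ioo (0 : ℝ) 1) (t ρ : ℝ) :
    Summable fun k : ℕ => s ^ k * ((⌈t - (k + 1) * ρ⌉ : ℤ) : ℝ) := by
  have := (summable_floor hs (-t) (-ρ)).neg
  refine this.congr fun k => ?_
  have e : t - (k + 1) * ρ = -(-t - (k + 1) * (-ρ)) := by ring
  rw [e, Int.ceil_neg]; push_cast; ring

lemma tsum_geometric_succ {s : ℝ} (hs : s ∈ Ioo (0 : ℝ) 1) :
    (1 - s) * ∑' k : ℕ, s ^ k = 1 := by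
  rw [tsum_geometric_of_lt_one hs.1.le hs.2, mul_inv_cancel₀ (by linarith [hs.2])]

/-! ### The functional equation of a contracted rotation -/

/-- The staircase function that conjugates the rotation by `ρ` to the contracted rotation
`x ↦ s x + δ`. -/
noncomputable def stair (s ρ δ t : ℝ) : ℝ :=
  δ / (1 - s) + (1 - s) * ∑' k : ℕ, s ^ k * ((⌊t - (k + 1) * ρ⌋ : ℤ) : ℝ)

/-- The left-continuous version of `stair`. -/
noncomputable def stairL (s ρ δ t : ℝ) : ℝ :=
  δ / (1 - s) + (1 - s) * ∑' k : ℕ, s ^ k * (((⌈t - (k + 1) * ρ⌉ - 1 : ℤ)) : ℝ)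

/-- The lift of the contracted rotation. -/
noncomputable def lift (s δ x : ℝ) : ℝ := s * x + (1 - s) * ⌊x⌋ + δ

section
variable {s : ℝ} (hs : s ∈ Ioo (0 : ℝ) 1) {ρ δ : ℝ}
include hs

/-- Splitting off the term `k = 0` leaves `s` times the series at `t`. Once `stair` preserves
integer parts, this is the conjugacy equation with `lift`. -/
lemma stair_add (t : ℝ) :
    stair s ρ δ (t + ρ) = s * stair s ρ δ t + (1 - s) * ⌊t⌋ + δ := by
  have h1 : (1 - s) ≠ 0 := by linarith [hs.2]
  unfold stair
  rw [(summable_floor hs (t + ρ) ρ).tsum_eq_zero_add]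
  have e : ∀ k : ℕ, s ^ (k + 1) * ((⌊t + ρ - ((k + 1 : ℕ) + 1) * ρ⌋ : ℤ) : ℝ)
      = s * (s ^ k * ((⌊t - (k + 1) * ρ⌋ : ℤ) : ℝ)) := fun k => by
    rw [show t + ρ - ((k + 1 : ℕ) + 1) * ρ = t - (k + 1) * ρ by push_cast; ring]; ring
  rw [tsum_congr e, tsum_mul_left]
  simp only [pow_zero, one_mul, Nat.cast_zero, zero_add, add_sub_cancel_right]
  generalize (∑' k : ℕ, s ^ k * _ : ℝ) = T
  field_simp
  ring

lemma stairL_add (t : ℝ) :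
    stairL s ρ δ (t + ρ) = s * stairL s ρ δ t + (1 - s) * ((⌈t⌉ - 1 : ℤ) : ℝ) + δ := by
  have h1 : (1 - s) ≠ 0 := by linarith [hs.2]
  have hsum : ∀ t, Summable fun k : ℕ => s ^ k * (((⌈t - (k + 1) * ρ⌉ - 1 : ℤ)) : ℝ) := fun t => by
    refine ((summable_ceil hs t ρ).sub (summable_geometric_of_lt_one hs.1.le hs.2)).congr
      fun k => by push_cast; ring
  unfold stairL
  rw [(hsum (t + ρ)).tsum_eq_zero_add]
  have e : ∀ k : ℕ, s ^ (k + 1) * (((⌈t + ρ - ((k + 1 : ℕ) + 1) * ρ⌉ - 1 : ℤ)) : ℝ)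
      = s * (s ^ k * (((⌈t - (k + 1) * ρ⌉ - 1 : ℤ)) : ℝ)) := fun k => by
    rw [show t + ρ - ((k + 1 : ℕ) + 1) * ρ = t - (k + 1) * ρ by push_cast; ring]; ring
  rw [tsum_congr e, tsum_mul_left]
  simp only [pow_zero, one_mul, Nat.cast_zero, zero_add, add_sub_cancel_right]
  generalize (∑' k : ℕ, s ^ k * _ : ℝ) = T
  field_simp
  ring

lemma stair_add_int (t : ℝ) (n : ℤ) : stair s ρ δ (t + n) = stair s ρ δ t + n := by
  unfold stair
  have e : ∀ k : ℕ, s ^ k * ((⌊t + n - (k + 1) * ρ⌋ : ℤ) : ℝ)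
      = s ^ k * ((⌊t - (k + 1) * ρ⌋ : ℤ) : ℝ) + s ^ k * n := fun k => by
    rw [show t + n - (k + 1) * ρ = t - (k + 1) * ρ + n by ring, Int.floor_add_intCast]
    push_cast; ring
  rw [tsum_congr e, (summable_floor hs t ρ).tsum_add
    ((summable_geometric_of_lt_one hs.1.le hs.2).mul_right _), tsum_mul_right, mul_add,
    ← mul_assoc (1 - s), tsum_geometric_succ hs]
  ring

lemma stairL_add_int (t : ℝ) (n : ℤ) : stairL s ρ δ (t + n) = stairL s ρ δ t + n := by
  have hsum : ∀ t, Summable fun k : ℕ => s ^ k * (((⌈t - (k + 1) * ρ⌉ - 1 : ℤ)) : ℝ) := fun t => by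
    refine ((summable_ceil hs t ρ).sub (summable_geometric_of_lt_one hs.1.le hs.2)).congr
      fun k => by push_cast; ring
  unfold stairL
  have e : ∀ k : ℕ, s ^ k * (((⌈t + n - (k + 1) * ρ⌉ - 1 : ℤ)) : ℝ)
      = s ^ k * (((⌈t - (k + 1) * ρ⌉ - 1 : ℤ)) : ℝ) + s ^ k * n := fun k => by
    rw [show t + n - (k + 1) * ρ = t - (k + 1) * ρ + n by ring, Int.ceil_add_intCast]
    push_cast; ring
  rw [tsum_congr e, (hsum t).tsum_add
    ((summable_geometric_of_lt_one hs.1.le hs.2).mul_right _), tsum_mul_right, mul_add,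
    ← mul_assoc (1 - s), tsum_geometric_succ hs]
  ring

lemma stair_mono : Monotone (stair s ρ δ) := fun t t' h => by
  unfold stair
  have h1 : (0 : ℝ) ≤ 1 - s := by linarith [hs.2]
  gcongr with k
  · exact summable_floor hs t ρ
  · exact summable_floor hs t' ρ
  · exact (pow_pos hs.1 k).le

lemma lift_strictMono : StrictMono (lift s δ) := fun x y h => by
  unfold lift
  have h1 : (⌊x⌋ : ℝ) ≤ ⌊y⌋ := by exact_mod_cast Int.floor_mono h.le
  nlinarith [hs.1, hs.2]

/-- Points with equal integer parts are moved by the same affine branch of slope `s`, so each step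
multiplies their difference by `s`. -/
lemma iterate_sub_stair {x : ℕ → ℝ} (hx : ∀ n, x (n + 1) = lift s δ (x n)) {t : ℝ} {N : ℕ}
    (h : ∀ j < N, ⌊x j⌋ = ⌊t + j * ρ⌋) :
    x N - stair s ρ δ (t + N * ρ) = s ^ N * (x 0 - stair s ρ δ t) := by
  induction N with
  | zero => simp
  | succ n ih =>
    have := ih fun j hj => h j (by omega)
    rw [hx, show t + ((n + 1 : ℕ) : ℝ) * ρ = (t + n * ρ) + ρ by push_cast; ring, stair_add hs,
      lift, h n (by omega), pow_succ]
    linear_combination s * this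

lemma iterate_sub_stairL {x : ℕ → ℝ} (hx : ∀ n, x (n + 1) = lift s δ (x n)) {t : ℝ} {N : ℕ}
    (h : ∀ j < N, ⌊x j⌋ = ⌈t + j * ρ⌉ - 1) :
    x N - stairL s ρ δ (t + N * ρ) = s ^ N * (x 0 - stairL s ρ δ t) := by
  induction N with
  | zero => simp
  | succ n ih =>
    have := ih fun j hj => h j (by omega)
    rw [hx, show t + ((n + 1 : ℕ) : ℝ) * ρ = (t + n * ρ) + ρ by push_cast; ring, stairL_add hs,
      lift, h n (by omega), pow_succ]
    linear_combination s * this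

end

/-! ### Coding orbits of the contracted rotation by a rotation -/

/-- `ρ` is a rotation number for `δ`, in the right-continuous convention. -/
def Admissible (s ρ δ : ℝ) : Prop := (∀ t, ⌊stair s ρ δ t⌋ = ⌊t⌋) ∧ stairL s ρ δ 0 ≤ 0

section
variable {s : ℝ} (hs : s ∈ Ioo (0 : ℝ) 1) {ρ δ : ℝ} (ha : Admissible s ρ δ)
include hs ha

lemma lift_stair (t : ℝ) : lift s δ (stair s ρ δ t) = stair s ρ δ (t + ρ) := by
  rw [lift, ha.1, stair_add hs]

/-- The increasing map `lift` preserves the order between the orbit and all orbits of points `stair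
t`. With `t` the supremum of the parameters below `x 0`, the orbit is squeezed between the left and
the right limits of the coding at `t`. -/
lemma exists_coding {x : ℕ → ℝ} (hx : ∀ n, x (n + 1) = lift s δ (x n)) :
    ∃ t : ℝ, ∀ j : ℕ, ⌈t + j * ρ⌉ - 1 ≤ ⌊x j⌋ ∧ ⌊x j⌋ ≤ ⌊t + j * ρ⌋ := by
  set S : Set ℝ := {t | stair s ρ δ t ≤ x 0}
  have hne : S.Nonempty := by
    refine ⟨((⌊x 0 - stair s ρ δ 0⌋ : ℤ) : ℝ), ?_⟩
    have := stair_add_int hs (ρ := ρ) (δ := δ) 0 ⌊x 0 - stair s ρ δ 0⌋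
    rw [zero_add] at this
    change stair _ _ _ _ ≤ _
    rw [this]; linarith [Int.floor_le (x 0 - stair s ρ δ 0)]
  have hb : BddAbove S := by
    refine ⟨((⌊x 0 - stair s ρ δ 0⌋ + 1 : ℤ) : ℝ), fun t ht => ?_⟩
    by_contra! hc
    have h1 := stair_mono hs (ρ := ρ) (δ := δ) hc.le
    have := stair_add_int hs (ρ := ρ) (δ := δ) 0 (⌊x 0 - stair s ρ δ 0⌋ + 1)
    rw [zero_add] at this
    rw [this] at h1
    push_cast at h1
    have h2 : stair s ρ δ t ≤ x 0 := ht
    linarith [Int.lt_floor_add_one (x 0 - stair s ρ δ 0)]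
  have hlo : ∀ t < sSup S, ∀ j : ℕ, stair s ρ δ (t + j * ρ) ≤ x j := fun t ht j => by
    induction j with
    | zero =>
      obtain ⟨t', h1, h2⟩ := exists_lt_of_lt_csSup hne ht
      simpa using (stair_mono hs h2.le).trans h1
    | succ n ih =>
      rw [hx, show t + ((n + 1 : ℕ) : ℝ) * ρ = (t + n * ρ) + ρ by push_cast; ring,
        ← lift_stair hs ha]
      exact (lift_strictMono hs).monotone ih
  have hhi : ∀ t > sSup S, ∀ j : ℕ, x j ≤ stair s ρ δ (t + j * ρ) := fun t ht j => by
    induction j with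
    | zero =>
      by_contra! hc
      have : t ∈ S := by simpa [S] using hc.le
      exact absurd (le_csSup hb this) (not_le.2 ht)
    | succ n ih =>
      rw [hx, show t + ((n + 1 : ℕ) : ℝ) * ρ = (t + n * ρ) + ρ by push_cast; ring,
        ← lift_stair hs ha]
      exact (lift_strictMono hs).monotone ih
  refine ⟨sSup S, fun j => ⟨?_, ?_⟩⟩
  · set u := sSup S + j * ρ
    have hu : ((⌈u⌉ : ℤ) : ℝ) - 1 < u := by linarith [Int.ceil_lt_add_one u]
    set ε := u - ((⌈u⌉ : ℤ) - 1)
    have hε : 0 < ε := by simp only [ε]; linarith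
    have h1 := Int.floor_mono (hlo (sSup S - ε) (by linarith) j)
    rw [ha.1] at h1
    refine le_trans ?_ h1
    rw [Int.le_floor]
    push_cast; simp only [ε, u]; linarith
  · set u := sSup S + j * ρ
    have hu := Int.lt_floor_add_one u
    set ε := (((⌊u⌋ : ℤ) : ℝ) + 1 - u) / 2
    have hε : 0 < ε := by simp only [ε]; linarith
    have h1 := Int.floor_mono (hhi (sSup S + ε) (by linarith) j)
    rw [ha.1] at h1
    refine le_trans h1 ?_
    rw [← Int.lt_add_one_iff, Int.floor_lt]
    push_cast; simp only [ε, u] at *; linarith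

omit hs in
lemma le_stair_intCast (n : ℤ) : (n : ℝ) ≤ stair s ρ δ n := by
  have := Int.floor_le (stair s ρ δ n)
  rwa [ha.1, Int.floor_intCast] at this

/-- The coding of an orbit is given by one of the two floor functions. -/
lemma coding_dichotomy {x : ℕ → ℝ} (hx : ∀ n, x (n + 1) = lift s δ (x n)) :
    ∃ t : ℝ, (∀ j : ℕ, ⌊x j⌋ = ⌊t + j * ρ⌋) ∨ ∀ j : ℕ, ⌊x j⌋ = ⌈t + j * ρ⌉ - 1 := by
  obtain ⟨t, ht⟩ := exists_coding hs ha hx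
  refine ⟨t, ?_⟩
  have hgen : ∀ (r : ℝ), (∀ n : ℤ, r ≠ n) → ⌈r⌉ = ⌊r⌋ + 1 := fun r hr =>
    (Int.ceil_eq_iff.2 ⟨by push_cast; have := Int.floor_le r
                           have h2 := hr ⌊r⌋
                           have : (⌊r⌋ : ℝ) < r := lt_of_le_of_ne this (Ne.symm h2)
                           linarith, by push_cast; exact (Int.lt_floor_add_one r).le⟩)
  have hreg : ∀ j : ℕ, (∀ n : ℤ, t + j * ρ ≠ n) →
      ⌊x j⌋ = ⌊t + j * ρ⌋ ∧ ⌊x j⌋ = ⌈t + j * ρ⌉ - 1 := fun j hj => by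
    have := hgen _ hj
    have := ht j
    omega
  by_cases hamb : ∃ j : ℕ, ∃ n : ℤ, t + j * ρ = n
  swap
  · push Not at hamb
    exact Or.inl fun j => (hreg j (hamb j)).1
  classical
  obtain ⟨n, hn⟩ := Nat.find_spec hamb
  set i := Nat.find hamb
  have hmin : ∀ j < i, ∀ n : ℤ, t + j * ρ ≠ n := fun j hj n h => Nat.find_min hamb hj ⟨n, h⟩
  set x' : ℕ → ℝ := fun j => x (i + j)
  have hx' : ∀ n, x' (n + 1) = lift s δ (x' n) := fun n => hx (i + n)
  -- The two codings differ only when `t + j * ρ` is an integer. The side of `n` on which the orbit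
  -- lies at the first such time `i` persists at all later ones.
  by_cases hside : (n : ℝ) ≤ x i
  · left
    have key : ∀ j : ℕ, ⌊x' j⌋ = ⌊(n : ℝ) + j * ρ⌋ := by
      intro j
      induction j using Nat.strong_induction_on with
      | _ j ih =>
        have hj := ht (i + j)
        have e : t + ((i + j : ℕ) : ℝ) * ρ = n + j * ρ := by push_cast; linarith
        by_cases hq : ∃ k : ℤ, t + ((i + j : ℕ) : ℝ) * ρ = k
        · obtain ⟨k, hk⟩ := hq
          rw [e] at hj hk
          refine le_antisymm hj.2 ?_
          have h1 := iterate_sub_stair hs hx' ih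
          have h0 : x' 0 = x i := rfl
          have e2 : (n : ℝ) + j * ρ = n + ((k - n : ℤ) : ℝ) := by push_cast; linarith
          rw [h0] at h1
          rw [Int.le_floor, hk, Int.floor_intCast]
          rw [e2, stair_add_int hs] at h1
          -- Up to the integer `k - n`, the point `x' j` is the convex combination of `stair n` and
          -- `x i` with weights `1 - s ^ j` and `s ^ j`; both are at least `n`.
          have h2 := le_stair_intCast ha n
          have h3 : s ^ j ≤ 1 := pow_le_one₀ hs.1.le hs.2.le
          have h4 : 0 < s ^ j := pow_pos hs.1 j
          push_cast at h1
          nlinarith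
        · push Not at hq
          have := (hreg (i + j) hq).1
          rwa [e] at this
    intro j
    by_cases hj : j < i
    · exact (hreg j (hmin j hj)).1
    · obtain ⟨l, rfl⟩ := Nat.exists_eq_add_of_le (not_lt.1 hj)
      have := key l
      rw [show t + ((i + l : ℕ) : ℝ) * ρ = n + l * ρ by push_cast; linarith]
      exact this
  · right
    push Not at hside
    have key : ∀ j : ℕ, ⌊x' j⌋ = ⌈(n : ℝ) + j * ρ⌉ - 1 := by
      intro j
      induction j using Nat.strong_induction_on with
      | _ j ih =>
        have hj := ht (i + j)
        have e : t + ((i + j : ℕ) : ℝ) * ρ = n + j * ρ := by push_cast; linarith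
        by_cases hq : ∃ k : ℤ, t + ((i + j : ℕ) : ℝ) * ρ = k
        · obtain ⟨k, hk⟩ := hq
          rw [e] at hj hk
          refine le_antisymm ?_ hj.1
          have h1 := iterate_sub_stairL hs hx' ih
          have h0 : x' 0 = x i := rfl
          have e2 : (n : ℝ) + j * ρ = n + ((k - n : ℤ) : ℝ) := by push_cast; linarith
          rw [h0] at h1
          rw [hk, Int.ceil_intCast, Int.le_sub_one_iff, Int.floor_lt]
          rw [e2, stairL_add_int hs] at h1
          have h2 : stairL s ρ δ n ≤ n := by
            have := stairL_add_int hs (ρ := ρ) (δ := δ) 0 n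
            rw [zero_add] at this
            rw [this]; linarith [ha.2]
          have h3 : s ^ j ≤ 1 := pow_le_one₀ hs.1.le hs.2.le
          have h4 : 0 < s ^ j := pow_pos hs.1 j
          push_cast at h1
          nlinarith
        · push Not at hq
          have := (hreg (i + j) hq).2
          rwa [e] at this
    intro j
    by_cases hj : j < i
    · exact (hreg j (hmin j hj)).2
    · obtain ⟨l, rfl⟩ := Nat.exists_eq_add_of_le (not_lt.1 hj)
      have := key l
      rw [show t + ((i + l : ℕ) : ℝ) * ρ = n + l * ρ by push_cast; linarith]
      exact this

omit hs ha in
lemma eventually_floor_eq_ceil_sub_one (u : ℝ) : ∀ᶠ t in 𝓝[<] u, ⌊t⌋ = ⌈u⌉ - 1 := by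
  have h1 : Ioo ((⌈u⌉ : ℝ) - 1) u ∈ 𝓝[<] u :=
    Ioo_mem_nhdsLT (by linarith [Int.ceil_lt_add_one u])
  filter_upwards [h1] with t ht
  rw [Int.floor_eq_iff]
  push_cast
  exact ⟨ht.1.le, by linarith [ht.2, Int.le_ceil u]⟩

omit hs ha in
lemma tendsto_sub_const_nhdsLT (u c : ℝ) : Tendsto (fun t => t + c) (𝓝[<] u) (𝓝[<] (u + c)) := by
  refine tendsto_nhdsWithin_iff.2 ⟨?_, ?_⟩
  · exact ((continuous_id.add continuous_const).tendsto u).mono_left nhdsWithin_le_nhds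
  · filter_upwards [self_mem_nhdsWithin] with t ht
    exact add_lt_add_left ht c

/-- For finitely many times the left-continuous coding at `t` equals the right-continuous one at a
slightly smaller parameter, so `stair` alone suffices. -/
lemma exists_finite_coding {x : ℕ → ℝ} (hx : ∀ n, x (n + 1) = lift s δ (x n)) (N : ℕ) :
    ∃ t : ℝ, ∀ j ≤ N, ⌊x j⌋ = ⌊t + j * ρ⌋ := by
  obtain ⟨t, h | h⟩ := coding_dichotomy hs ha hx
  · exact ⟨t, fun j _ => h j⟩
  · have : ∀ᶠ t' in 𝓝[<] t, ∀ j ∈ Finset.range (N + 1), ⌊t' + j * ρ⌋ = ⌈t + j * ρ⌉ - 1 := by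
      rw [Filter.eventually_all_finset]
      intro j _
      exact (tendsto_sub_const_nhdsLT t (j * ρ)).eventually (eventually_floor_eq_ceil_sub_one _)
    obtain ⟨t', ht'⟩ := this.exists
    exact ⟨t', fun j hj => by rw [h, ht' j (by simp; omega)]⟩

end


/-! ### Limits and Hausdorff dimension for sums of integer codes -/

lemma tendsto_tsum_codes {s : ℝ} (hs : s ∈ Ioo (0 : ℝ) 1) {l : Filter ℝ} {a : ℕ → ℝ → ℤ}
    {b : ℕ → ℤ} {A B : ℝ} (hb : ∀ᶠ x in l, ∀ k, |(a k x : ℝ)| ≤ A + B * k)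
    (h : ∀ k, ∀ᶠ x in l, a k x = b k) :
    Tendsto (fun x => ∑' k : ℕ, s ^ k * (a k x : ℝ)) l (𝓝 (∑' k : ℕ, s ^ k * (b k : ℝ))) := by
  rcases l.eq_or_neBot with rfl | hl
  · exact tendsto_bot
  have hs' : Summable fun k : ℕ => s ^ k * (A + B * k) := by
    obtain ⟨x, hx⟩ := hb.exists
    refine summable_pow_mul_of_le hs (A := A) (B := B) fun k => ?_
    rw [abs_of_nonneg ((abs_nonneg _).trans (hx k))]
  refine tendsto_tsum_of_dominated_convergence hs' (fun k => ?_) ?_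
  · refine tendsto_const_nhds.congr' ?_
    filter_upwards [h k] with x hx
    rw [hx]
  · filter_upwards [hb] with x hx k
    rw [Real.norm_eq_abs, abs_mul, abs_of_pos (pow_pos hs.1 k)]
    exact mul_le_mul_of_nonneg_left (hx k) (pow_pos hs.1 k).le

/-- Cutting the interval according to the first `N` codes gives fewer than `(N + 2) ^ 2` classes, on
each of which the sum varies by at most a constant times `r ^ N` for some `r < 1`. Such covers show
that every Hausdorff measure of positive dimension vanishes. -/
lemma dimH_closure_image_codes {s : ℝ} (hs : s ∈ Ioo (0 : ℝ) 1) {a : ℕ → ℝ → ℤ}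
    (hmono : ∀ k, Monotone (a k)) {x₀ x₁ : ℝ} (hd : ∀ k : ℕ, a k x₁ - a k x₀ ≤ k + 2)
    (hsum : ∀ x, Summable fun k => s ^ k * (a k x : ℝ)) (c₀ c₁ : ℝ) :
    dimH (closure ((fun x => c₀ + c₁ * ∑' k : ℕ, s ^ k * (a k x : ℝ)) '' Icc x₀ x₁)) = 0 := by
  set G : ℝ → ℝ := fun x => c₀ + c₁ * ∑' k : ℕ, s ^ k * (a k x : ℝ)
  -- Replacing the ratio `s` by a larger `r < 1` absorbs the linear growth `k + 2` of the code
  -- increments.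
  obtain ⟨r, hsr, hr1⟩ := exists_between hs.2
  have hr0 : 0 < r := hs.1.trans hsr
  have hq : s / r ∈ Ioo (0 : ℝ) 1 := ⟨div_pos hs.1 hr0, (div_lt_one hr0).2 hsr⟩
  have hS : Summable fun k : ℕ => (s / r) ^ k * ((k : ℝ) + 2) :=
    summable_pow_mul_of_le hq (A := 2) (B := 1) fun k => by
      rw [abs_of_nonneg (by positivity)]; linarith
  set C : ℝ := |c₁| * ∑' k : ℕ, (s / r) ^ k * ((k : ℝ) + 2)
  have hC : 0 ≤ C := mul_nonneg (abs_nonneg _) (tsum_nonneg fun k => by have := hq.1; positivity)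
  set code : ℕ → ℝ → ℤ := fun N x => ∑ k ∈ Finset.range N, (a k x - a k x₀)
  have hclose : ∀ N : ℕ, ∀ x ∈ Icc x₀ x₁, ∀ y ∈ Icc x₀ x₁, code N x = code N y → x ≤ y →
      |G x - G y| ≤ C * r ^ N := by
    intro N x hx y hy hxy hle
    -- All summands of `code` are monotone, so equality of the sums forces equality term by term; a
    -- single integer thus records all `N` codes.
    have h1 : ∀ k < N, a k x = a k y := by
      have := (Finset.sum_eq_sum_iff_of_le (s := Finset.range N)
        (f := fun k => a k x - a k x₀) (g := fun k => a k y - a k x₀)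
        (fun k _ => by have := hmono k hle; omega)).1 hxy
      intro k hk
      have := this k (Finset.mem_range.2 hk)
      omega
    have hterm : ∀ k, ‖s ^ k * (a k x : ℝ) - s ^ k * (a k y : ℝ)‖
        ≤ r ^ N * ((s / r) ^ k * ((k : ℝ) + 2)) := by
      intro k
      rw [← mul_sub, Real.norm_eq_abs, abs_mul, abs_of_pos (pow_pos hs.1 k)]
      by_cases hk : k < N
      · rw [h1 k hk, sub_self, abs_zero, mul_zero]
        have := hq.1; positivity
      · have h2 : |(a k x : ℝ) - a k y| ≤ k + 2 := by
          have e1 := hmono k hx.1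
          have e2 := hmono k hle
          have e3 := hmono k hy.2
          have e4 := hd k
          have : |a k x - a k y| ≤ k + 2 := by rw [abs_le]; omega
          exact_mod_cast this
        have h3 : s ^ k = r ^ k * (s / r) ^ k := by rw [← mul_pow, mul_div_cancel₀ _ hr0.ne']
        have h4 : r ^ k ≤ r ^ N := pow_le_pow_of_le_one hr0.le hr1.le (not_lt.1 hk)
        rw [h3, mul_assoc]
        have := pow_pos hq.1 k
        gcongr
    have e : G x - G y = c₁ * ∑' k : ℕ, (s ^ k * (a k x : ℝ) - s ^ k * (a k y : ℝ)) := by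
      rw [(hsum x).tsum_sub (hsum y)]; simp only [G]; ring
    rw [e, abs_mul]
    have := tsum_of_norm_bounded (hS.mul_left (r ^ N)).hasSum hterm
    rw [tsum_mul_left] at this
    calc _ ≤ |c₁| * (r ^ N * ∑' k : ℕ, (s / r) ^ k * ((k : ℝ) + 2)) :=
          mul_le_mul_of_nonneg_left this (abs_nonneg _)
      _ = C * r ^ N := by simp only [C]; ring
  have hclose' : ∀ N : ℕ, ∀ x ∈ Icc x₀ x₁, ∀ y ∈ Icc x₀ x₁, code N x = code N y →
      |G x - G y| ≤ C * r ^ N := by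
    intro N x hx y hy h
    rcases le_total x y with hle | hle
    · exact hclose N x hx y hy h hle
    · rw [abs_sub_comm]; exact hclose N y hy x hx h.symm hle
  have hcode : ∀ N : ℕ, ∀ x ∈ Icc x₀ x₁, 0 ≤ code N x ∧ code N x < ((N + 2) ^ 2 : ℕ) := by
    intro N x hx
    constructor
    · exact Finset.sum_nonneg fun k _ => by have := hmono k hx.1; omega
    · have : code N x ≤ ∑ k ∈ Finset.range N, ((N : ℤ) + 1) := Finset.sum_le_sum fun k hk => by
        have h1 := hmono k hx.2
        have h2 := hd k
        have := Finset.mem_range.1 hk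
        omega
      rw [Finset.sum_const, Finset.card_range, nsmul_eq_mul] at this
      push_cast
      nlinarith
  refine le_antisymm (dimH_le fun d hd' => ?_) bot_le
  by_contra! hpos
  have hpos' : 0 < (d : ℝ) := by exact_mod_cast hpos
  have key := Measure.hausdorffMeasure_le_liminf_sum (ι := fun N : ℕ => Fin ((N + 2) ^ 2))
    (d : ℝ) (closure (G '' Icc x₀ x₁)) (l := atTop) (fun N => ENNReal.ofReal (C * r ^ N))
    (by
      have : Tendsto (fun N : ℕ => C * r ^ N) atTop (𝓝 (C * 0)) :=
        (tendsto_pow_atTop_nhds_zero_of_lt_one hr0.le hr1).const_mul C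
      simpa using ENNReal.tendsto_ofReal this)
    (fun N i => closure (G '' {x | x ∈ Icc x₀ x₁ ∧ code N x = (i : ℕ)}))
    (Eventually.of_forall fun N i => by
      rw [Metric.ediam_closure]
      refine Metric.ediam_le ?_
      rintro _ ⟨x, hx, rfl⟩ _ ⟨y, hy, rfl⟩
      rw [edist_dist, Real.dist_eq]
      exact ENNReal.ofReal_le_ofReal (hclose' N x hx.1 y hy.1 (hx.2.trans hy.2.symm)))
    (Eventually.of_forall fun N => by
      rw [← closure_iUnion_of_finite]
      refine closure_mono ?_
      rintro _ ⟨x, hx, rfl⟩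
      obtain ⟨h1, h2⟩ := hcode N x hx
      refine mem_iUnion.2 ⟨⟨(code N x).toNat, by omega⟩, x, ⟨hx, ?_⟩, rfl⟩
      simp only; omega)
  have hlim : Tendsto (fun N : ℕ => ENNReal.ofReal (((N + 2) ^ 2 : ℝ) * (C * r ^ N) ^ (d : ℝ)))
      atTop (𝓝 0) := by
    rw [← ENNReal.ofReal_zero]
    refine ENNReal.tendsto_ofReal ?_
    have hrd : r ^ (d : ℝ) ∈ Ioo (0 : ℝ) 1 :=
      ⟨Real.rpow_pos_of_pos hr0 _, Real.rpow_lt_one hr0.le hr1 hpos'⟩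
    have e : ∀ N : ℕ, ((N + 2) ^ 2 : ℝ) * (C * r ^ N) ^ (d : ℝ) =
        C ^ (d : ℝ) * (((N : ℝ) ^ 2 * (r ^ (d : ℝ)) ^ N) + 4 * ((N : ℝ) ^ 1 * (r ^ (d : ℝ)) ^ N)
          + 4 * (r ^ (d : ℝ)) ^ N) := by
      intro N
      have e1 : (r ^ N) ^ (d : ℝ) = (r ^ (d : ℝ)) ^ N := by
        rw [← Real.rpow_natCast, ← Real.rpow_mul hr0.le, mul_comm, Real.rpow_mul hr0.le,
          Real.rpow_natCast]
      rw [Real.mul_rpow hC (pow_pos hr0 N).le, e1]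
      ring
    simp_rw [e]
    have l1 := tendsto_pow_const_mul_const_pow_of_abs_lt_one 2
      (r := r ^ (d : ℝ)) (by rw [abs_of_pos hrd.1]; exact hrd.2)
    have l2 := tendsto_pow_const_mul_const_pow_of_abs_lt_one 1
      (r := r ^ (d : ℝ)) (by rw [abs_of_pos hrd.1]; exact hrd.2)
    have l3 := tendsto_pow_atTop_nhds_zero_of_lt_one hrd.1.le hrd.2
    simpa using ((l1.add (l2.const_mul 4)).add (l3.const_mul 4)).const_mul (C ^ (d : ℝ))
  have hle : liminf (fun N : ℕ => ∑ i : Fin ((N + 2) ^ 2),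
      Metric.ediam (closure (G '' {x | x ∈ Icc x₀ x₁ ∧ code N x = ((i : ℕ) : ℤ)})) ^ (d : ℝ)) atTop
      ≤ 0 := by
    rw [← hlim.liminf_eq]
    refine liminf_le_liminf (Eventually.of_forall fun N => ?_)
    have hb : ∀ i : Fin ((N + 2) ^ 2), Metric.ediam
        (closure (G '' {x | x ∈ Icc x₀ x₁ ∧ code N x = ((i : ℕ) : ℤ)})) ^ (d : ℝ) ≤
        ENNReal.ofReal ((C * r ^ N) ^ (d : ℝ)) := fun i => by
      rw [← ENNReal.ofReal_rpow_of_nonneg (mul_nonneg hC (pow_pos hr0 N).le) hpos'.le]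
      refine ENNReal.rpow_le_rpow ?_ hpos'.le
      rw [Metric.ediam_closure]
      refine Metric.ediam_le ?_
      rintro _ ⟨x, hx, rfl⟩ _ ⟨y, hy, rfl⟩
      rw [edist_dist, Real.dist_eq]
      exact ENNReal.ofReal_le_ofReal (hclose' N x hx.1 y hy.1 (hx.2.trans hy.2.symm))
    refine (Finset.sum_le_sum fun i _ => hb i).trans ?_
    rw [Finset.sum_const, Finset.card_univ, Fintype.card_fin, nsmul_eq_mul,
      ENNReal.ofReal_mul (by positivity)]
    gcongr
    rw [← ENNReal.ofReal_natCast]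
    exact ENNReal.ofReal_le_ofReal (by push_cast; exact le_rfl)
  rw [hd'] at key
  exact absurd (key.trans hle) (by simp)

/-! ### Intervals of parameters with a common rotation number -/

/-- Lower end of the set of `δ` with rotation number `ρ`. -/
noncomputable def plateauLo (s ρ : ℝ) : ℝ :=
  (1 - s) ^ 2 * ∑' k : ℕ, s ^ k * ((⌈(k + 1) * ρ⌉ : ℤ) : ℝ)

/-- Upper end of the set of `δ` with rotation number `ρ`. -/
noncomputable def plateauHi (s ρ : ℝ) : ℝ :=
  (1 - s) ^ 2 * ∑' k : ℕ, s ^ k * ((⌊(k + 1) * ρ⌋ + 1 : ℤ) : ℝ)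

section
variable {s : ℝ} (hs : s ∈ Ioo (0 : ℝ) 1)

lemma abs_ceil_mul_le {x c : ℝ} (hx : |x| ≤ c) (k : ℕ) :
    |((⌈((k : ℝ) + 1) * x⌉ : ℤ) : ℝ)| ≤ (c + 1) + c * k := by
  have h1 := Int.le_ceil (((k : ℝ) + 1) * x)
  have h2 := Int.ceil_lt_add_one (((k : ℝ) + 1) * x)
  rw [abs_le] at hx ⊢
  have : (0 : ℝ) ≤ k := k.cast_nonneg
  constructor <;> nlinarith [hx.1, hx.2]

lemma abs_floor_mul_le {x c : ℝ} (hx : |x| ≤ c) (k : ℕ) :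
    |((⌊((k : ℝ) + 1) * x⌋ + 1 : ℤ) : ℝ)| ≤ (c + 1) + c * k := by
  have h1 := Int.floor_le (((k : ℝ) + 1) * x)
  have h2 := Int.lt_floor_add_one (((k : ℝ) + 1) * x)
  rw [abs_le] at hx ⊢
  have : (0 : ℝ) ≤ k := k.cast_nonneg
  push_cast
  constructor <;> nlinarith [hx.1, hx.2]

include hs

lemma summable_lo (ρ : ℝ) : Summable fun k : ℕ => s ^ k * ((⌈(k + 1) * ρ⌉ : ℤ) : ℝ) :=
  summable_pow_mul_of_le hs (abs_ceil_mul_le le_rfl)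

lemma summable_hi (ρ : ℝ) : Summable fun k : ℕ => s ^ k * ((⌊(k + 1) * ρ⌋ + 1 : ℤ) : ℝ) :=
  summable_pow_mul_of_le hs (abs_floor_mul_le le_rfl)

/-- For `x < y` one has `⌊x⌋ + 1 ≤ ⌈y⌉`, so the codes compare term by term; strictness comes from an
index where the two multiples differ by more than 1. -/
lemma plateauHi_lt_plateauLo {ρ ρ' : ℝ} (h : ρ < ρ') : plateauHi s ρ < plateauLo s ρ' := by
  have h1 : 0 < (1 - s) ^ 2 := by have := hs.2; nlinarith
  refine mul_lt_mul_of_pos_left ?_ h1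
  have hlt : ∀ k : ℕ, ((k : ℝ) + 1) * ρ < (k + 1) * ρ' := fun k => by
    have : (0 : ℝ) < (k : ℝ) + 1 := by positivity
    nlinarith
  have hle : ∀ k : ℕ, ⌊((k : ℝ) + 1) * ρ⌋ + 1 ≤ ⌈((k : ℝ) + 1) * ρ'⌉ := fun k => by
    rw [Int.add_one_le_iff, Int.lt_ceil]
    exact (Int.floor_le _).trans_lt (hlt k)
  obtain ⟨i, hi⟩ := exists_nat_gt (1 / (ρ' - ρ))
  refine (summable_hi hs ρ).tsum_lt_tsum (i := i) (fun k => ?_) ?_ (summable_lo hs ρ')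
  · exact mul_le_mul_of_nonneg_left (Int.cast_le.2 (hle k)) (pow_pos hs.1 k).le
  · refine mul_lt_mul_of_pos_left ?_ (pow_pos hs.1 i)
    rw [div_lt_iff₀ (by linarith)] at hi
    push_cast
    have := Int.le_ceil (((i : ℝ) + 1) * ρ')
    have := Int.floor_le (((i : ℝ) + 1) * ρ)
    nlinarith

lemma plateauLo_le_plateauHi (ρ : ℝ) : plateauLo s ρ ≤ plateauHi s ρ := by
  refine mul_le_mul_of_nonneg_left ?_ (sq_nonneg _)
  refine (summable_lo hs ρ).tsum_le_tsum (fun k => ?_) (summable_hi hs ρ)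
  exact mul_le_mul_of_nonneg_left (Int.cast_le.2 (Int.ceil_le_floor_add_one _))
    (pow_pos hs.1 k).le

/-- At the index `k = r.den - 1` the multiple `(k + 1) * r` is an integer, and there the ceiling is
strictly below the floor plus one. -/
lemma plateauLo_lt_plateauHi (r : ℚ) : plateauLo s r < plateauHi s r := by
  have h1 : 0 < (1 - s) ^ 2 := by have := hs.2; nlinarith
  refine mul_lt_mul_of_pos_left ?_ h1
  have hq : ((r.den - 1 : ℕ) : ℝ) + 1 = r.den := by
    have := r.pos
    rw [Nat.cast_sub (by omega)]; simp
  have hn : (r.den : ℝ) * (r : ℝ) = (r.num : ℤ) := by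
    have := Rat.mul_den_eq_num r
    rw [mul_comm]; exact_mod_cast this
  refine (summable_lo hs r).tsum_lt_tsum (i := r.den - 1) (fun k => ?_) ?_ (summable_hi hs r)
  · exact mul_le_mul_of_nonneg_left (Int.cast_le.2 (Int.ceil_le_floor_add_one _))
      (pow_pos hs.1 k).le
  · refine mul_lt_mul_of_pos_left ?_ (pow_pos hs.1 _)
    rw [hq, hn, Int.ceil_intCast, Int.floor_intCast]
    push_cast; linarith

omit hs in
lemma ceil_eq_floor_add_one {x : ℝ} (hx : ∀ n : ℤ, x ≠ n) : ⌈x⌉ = ⌊x⌋ + 1 := by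
  rw [Int.ceil_eq_iff]
  push_cast
  have h1 : (⌊x⌋ : ℝ) < x := lt_of_le_of_ne (Int.floor_le x) (Ne.symm (hx _))
  exact ⟨by linarith, (Int.lt_floor_add_one x).le⟩

omit hs in
lemma plateauLo_eq_plateauHi {ρ : ℝ} (h : Irrational ρ) : plateauLo s ρ = plateauHi s ρ := by
  unfold plateauLo plateauHi
  congr 2
  funext k
  rw [ceil_eq_floor_add_one]
  intro n hn
  have : Irrational (((k + 1 : ℕ) : ℝ) * ρ) := h.natCast_mul (by omega)
  exact this ⟨n, by push_cast; exact hn.symm⟩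

omit hs in
lemma tendsto_mul_nhdsLT {c : ℝ} (hc : 0 < c) (ρ : ℝ) :
    Tendsto (fun x => c * x) (𝓝[<] ρ) (𝓝[<] (c * ρ)) := by
  refine tendsto_nhdsWithin_iff.2 ⟨?_, ?_⟩
  · exact ((continuous_const.mul continuous_id).tendsto ρ).mono_left nhdsWithin_le_nhds
  · filter_upwards [self_mem_nhdsWithin] with t ht
    exact mul_lt_mul_of_pos_left ht hc

omit hs in
lemma tendsto_mul_nhdsGT {c : ℝ} (hc : 0 < c) (ρ : ℝ) :
    Tendsto (fun x => c * x) (𝓝[>] ρ) (𝓝[>] (c * ρ)) := by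
  refine tendsto_nhdsWithin_iff.2 ⟨?_, ?_⟩
  · exact ((continuous_const.mul continuous_id).tendsto ρ).mono_left nhdsWithin_le_nhds
  · filter_upwards [self_mem_nhdsWithin] with t ht
    exact mul_lt_mul_of_pos_left ht hc

omit hs in
lemma eventually_ceil_eq_left (u : ℝ) : ∀ᶠ t in 𝓝[<] u, ⌈t⌉ = ⌈u⌉ := by
  have h1 : Ioo ((⌈u⌉ : ℝ) - 1) u ∈ 𝓝[<] u :=
    Ioo_mem_nhdsLT (by linarith [Int.ceil_lt_add_one u])
  filter_upwards [h1] with t ht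
  rw [Int.ceil_eq_iff]
  exact ⟨ht.1, by linarith [ht.2, Int.le_ceil u]⟩

omit hs in
lemma eventually_floor_eq_right (u : ℝ) : ∀ᶠ t in 𝓝[>] u, ⌊t⌋ = ⌊u⌋ := by
  have h1 : Ioo u ((⌊u⌋ : ℝ) + 1) ∈ 𝓝[>] u :=
    Ioo_mem_nhdsGT (Int.lt_floor_add_one u)
  filter_upwards [h1] with t ht
  rw [Int.floor_eq_iff]
  exact ⟨by linarith [ht.1, Int.floor_le u], ht.2⟩

omit hs in
lemma eventually_ceil_eq_right (u : ℝ) : ∀ᶠ t in 𝓝[>] u, ⌈t⌉ = ⌊u⌋ + 1 := by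
  have h1 : Ioo u ((⌊u⌋ : ℝ) + 1) ∈ 𝓝[>] u :=
    Ioo_mem_nhdsGT (Int.lt_floor_add_one u)
  filter_upwards [h1] with t ht
  rw [Int.ceil_eq_iff]
  push_cast
  exact ⟨by linarith [ht.1, Int.floor_le u], ht.2.le⟩

omit hs in
lemma eventually_abs_le (l : Set ℝ) (ρ : ℝ) : ∀ᶠ x in 𝓝[l] ρ, |x| ≤ |ρ| + 1 := by
  refine nhdsWithin_le_nhds ?_
  have := (continuous_abs.tendsto ρ).eventually (Iio_mem_nhds (lt_add_one |ρ|))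
  filter_upwards [this] with x hx using le_of_lt hx

lemma tendsto_plateauLo_left (ρ : ℝ) : Tendsto (plateauLo s) (𝓝[<] ρ) (𝓝 (plateauLo s ρ)) := by
  refine Tendsto.const_mul _ (tendsto_tsum_codes hs (A := |ρ| + 1 + 1) (B := |ρ| + 1) ?_ ?_)
  · filter_upwards [eventually_abs_le _ ρ] with x hx k using abs_ceil_mul_le hx k
  · exact fun k => (tendsto_mul_nhdsLT (by positivity) ρ).eventually (eventually_ceil_eq_left _)

/-- Just to the right of `u` the ceiling equals `⌊u⌋ + 1`. The lower ends therefore jump exactly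
across the interval of `ρ`, which is why no `δ` is missed. -/
lemma tendsto_plateauLo_right (ρ : ℝ) : Tendsto (plateauLo s) (𝓝[>] ρ) (𝓝 (plateauHi s ρ)) := by
  refine Tendsto.const_mul _ (tendsto_tsum_codes hs (A := |ρ| + 1 + 1) (B := |ρ| + 1) ?_ ?_)
  · filter_upwards [eventually_abs_le _ ρ] with x hx k using abs_ceil_mul_le hx k
  · exact fun k => (tendsto_mul_nhdsGT (by positivity) ρ).eventually (eventually_ceil_eq_right _)

lemma tendsto_plateauHi_right (ρ : ℝ) : Tendsto (plateauHi s) (𝓝[>] ρ) (𝓝 (plateauHi s ρ)) := by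
  refine Tendsto.const_mul _ (tendsto_tsum_codes hs (A := |ρ| + 1 + 1) (B := |ρ| + 1) ?_ ?_)
  · filter_upwards [eventually_abs_le _ ρ] with x hx k using abs_floor_mul_le hx k
  · intro k
    filter_upwards [(tendsto_mul_nhdsGT (c := (k : ℝ) + 1) (by positivity) ρ).eventually
      (eventually_floor_eq_right _)] with x hx
    rw [hx]

/-- This normalization gives `plateauLo` the value `n` at an integer `n` and puts it above the
identity, so the supremum over the lower ends below a given `δ` is finite. -/
lemma sq_mul_tsum_succ : (1 - s) ^ 2 * ∑' k : ℕ, s ^ k * ((k : ℝ) + 1) = 1 := by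
  have h := tsum_coe_mul_geometric_of_norm_lt_one (𝕜 := ℝ) (r := s)
    (by rw [Real.norm_eq_abs, abs_of_pos hs.1]; exact hs.2)
  have h2 := (hasSum_coe_mul_geometric_of_norm_lt_one (𝕜 := ℝ) (r := s)
    (by rw [Real.norm_eq_abs, abs_of_pos hs.1]; exact hs.2)).summable
  have h3 := summable_geometric_of_lt_one hs.1.le hs.2
  have e : ∀ k : ℕ, s ^ k * ((k : ℝ) + 1) = k * s ^ k + s ^ k := fun k => by ring
  rw [tsum_congr e, h2.tsum_add h3, h, tsum_geometric_of_lt_one hs.1.le hs.2]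
  have : 1 - s ≠ 0 := by linarith [hs.2]
  field_simp
  ring

lemma le_plateauLo (ρ : ℝ) : ρ ≤ plateauLo s ρ := by
  have h1 : Summable fun k : ℕ => s ^ k * ((k : ℝ) + 1) :=
    summable_pow_mul_of_le hs (A := 1) (B := 1) fun k => by
      rw [abs_of_nonneg (by positivity)]; linarith
  calc ρ = ((1 - s) ^ 2 * ∑' k : ℕ, s ^ k * ((k : ℝ) + 1)) * ρ := by
        rw [sq_mul_tsum_succ hs, one_mul]
    _ = (1 - s) ^ 2 * ∑' k : ℕ, s ^ k * ((k : ℝ) + 1) * ρ := by rw [tsum_mul_right, mul_assoc]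
    _ ≤ _ := by
        refine mul_le_mul_of_nonneg_left ?_ (sq_nonneg _)
        refine (h1.mul_right ρ).tsum_le_tsum (fun k => ?_) (summable_lo hs ρ)
        rw [mul_assoc]
        exact mul_le_mul_of_nonneg_left (Int.le_ceil _) (pow_pos hs.1 k).le

lemma plateauLo_int (n : ℤ) : plateauLo s n = n := by
  unfold plateauLo
  have e : ∀ k : ℕ, s ^ k * ((⌈((k : ℝ) + 1) * (n : ℝ)⌉ : ℤ) : ℝ) = s ^ k * ((k : ℝ) + 1) * n :=
    fun k => by
      rw [show ((k : ℝ) + 1) * (n : ℝ) = (((k + 1) * n : ℤ) : ℝ) by push_cast; ring,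
        Int.ceil_intCast]
      push_cast; ring
  rw [tsum_congr e, tsum_mul_right, ← mul_assoc, sq_mul_tsum_succ hs, one_mul]

/-- The rotation number is the supremum of the `ρ` with lower end at most `δ`. The left limit gives
the lower bound on `δ`, and the right limit, which is the upper end, gives the other. -/
lemma exists_mem_plateau (δ : ℝ) : ∃ ρ, plateauLo s ρ ≤ δ ∧ δ ≤ plateauHi s ρ := by
  set S : Set ℝ := {ρ | plateauLo s ρ ≤ δ}
  have hne : S.Nonempty := ⟨((⌊δ⌋ : ℤ) : ℝ), by
    change plateauLo s _ ≤ δ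
    rw [plateauLo_int hs]; exact Int.floor_le δ⟩
  have hb : BddAbove S := ⟨δ, fun ρ h => (le_plateauLo hs ρ).trans h⟩
  have hmono : StrictMono (plateauLo s) := fun x y h =>
    (plateauLo_le_plateauHi hs x).trans_lt (plateauHi_lt_plateauLo hs h)
  refine ⟨sSup S, ?_, ?_⟩
  · refine le_of_tendsto (tendsto_plateauLo_left hs (sSup S)) ?_
    filter_upwards [self_mem_nhdsWithin] with x hx
    obtain ⟨y, h1, h2⟩ := exists_lt_of_lt_csSup hne hx
    exact (hmono h2).le.trans h1
  · refine ge_of_tendsto (tendsto_plateauLo_right hs (sSup S)) ?_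
    filter_upwards [self_mem_nhdsWithin] with x hx
    by_contra! hc
    exact absurd (le_csSup hb hc.le) (not_le.2 hx)

end

/-! ### Admissible parameters -/

section
variable {s : ℝ} (hs : s ∈ Ioo (0 : ℝ) 1) {ρ δ : ℝ}
include hs

/-- Together with `stairL_zero` this explains the two ends: `δ` lies between them exactly when 0
lies in the closed jump of the staircase at 0. -/
lemma stair_zero : stair s ρ δ 0 = (δ - plateauLo s ρ) / (1 - s) := by
  have h1 : (1 - s) ≠ 0 := by linarith [hs.2]
  unfold stair plateauLo
  have e : ∀ k : ℕ, s ^ k * ((⌊(0 : ℝ) - (k + 1) * ρ⌋ : ℤ) : ℝ)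
      = -(s ^ k * ((⌈(k + 1) * ρ⌉ : ℤ) : ℝ)) := fun k => by
    rw [zero_sub, Int.floor_neg]; push_cast; ring
  rw [tsum_congr e, tsum_neg]
  generalize (∑' k : ℕ, s ^ k * _ : ℝ) = T
  field_simp
  ring

lemma stairL_zero : stairL s ρ δ 0 = (δ - plateauHi s ρ) / (1 - s) := by
  have h1 : (1 - s) ≠ 0 := by linarith [hs.2]
  unfold stairL plateauHi
  have e : ∀ k : ℕ, s ^ k * ((⌈(0 : ℝ) - (k + 1) * ρ⌉ - 1 : ℤ) : ℝ)
      = -(s ^ k * ((⌊(k + 1) * ρ⌋ + 1 : ℤ) : ℝ)) := fun k => by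
    rw [zero_sub, Int.ceil_neg]; push_cast; ring
  rw [tsum_congr e, tsum_neg]
  generalize (∑' k : ℕ, s ^ k * _ : ℝ) = T
  field_simp
  ring

lemma summable_stairL (t : ℝ) :
    Summable fun k : ℕ => s ^ k * (((⌈t - (k + 1) * ρ⌉ - 1 : ℤ)) : ℝ) :=
  ((summable_ceil hs t ρ).sub (summable_geometric_of_lt_one hs.1.le hs.2)).congr
      fun k => by push_cast; ring

lemma stair_le_stairL {t t' : ℝ} (h : t < t') : stair s ρ δ t ≤ stairL s ρ δ t' := by
  unfold stair stairL
  have h1 : (0 : ℝ) ≤ 1 - s := by linarith [hs.2]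
  gcongr with k
  · exact summable_floor hs t ρ
  · exact summable_stairL hs t'
  · exact (pow_pos hs.1 k).le
  · rw [Int.le_sub_one_iff, Int.lt_ceil]
    exact (Int.floor_le _).trans_lt (by linarith)

/-- Equivariance under integer translations reduces preservation of integer parts to `[0,1)`. There
the lower bound 0 is the condition at the lower end, and only the strict upper bound has to be
assumed. -/
lemma admissible_of_lt_one (h0 : plateauLo s ρ ≤ δ) (h0' : δ ≤ plateauHi s ρ)
    (h1 : ∀ t < 1, stair s ρ δ t < 1) : Admissible s ρ δ := by
  have hs1 : 0 < 1 - s := by linarith [hs.2]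
  refine ⟨fun t => ?_, ?_⟩
  · have e : t = Int.fract t + ⌊t⌋ := (Int.fract_add_floor t).symm
    have h2 := h1 _ (Int.fract_lt_one t)
    have h3 : 0 ≤ stair s ρ δ (Int.fract t) := by
      refine le_trans ?_ (stair_mono hs (Int.fract_nonneg t))
      rw [stair_zero hs]
      exact div_nonneg (by linarith) hs1.le
    have h4 : stair s ρ δ t = stair s ρ δ (Int.fract t) + ⌊t⌋ := by
      conv_lhs => rw [e]
      exact stair_add_int hs _ _
    rw [Int.floor_eq_iff, h4]
    constructor <;> linarith
  · rw [stairL_zero hs]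
    exact div_nonpos_of_nonpos_of_nonneg (by linarith) hs1.le

lemma stair_le_of_lt_one {t : ℝ} (h : t < 1) :
    stair s ρ δ t ≤ (δ - plateauHi s ρ) / (1 - s) + 1 := by
  have := stairL_add_int hs (ρ := ρ) (δ := δ) 0 1
  rw [stairL_zero hs, zero_add, Int.cast_one] at this
  rw [← this]
  exact stair_le_stairL hs h

lemma admissible_of_lt (h0 : plateauLo s ρ ≤ δ) (h1 : δ < plateauHi s ρ) :
    Admissible s ρ δ := by
  refine admissible_of_lt_one hs h0 h1.le fun t ht => ?_
  have h2 := stair_le_of_lt_one hs (ρ := ρ) (δ := δ) ht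
  have h3 : (δ - plateauHi s ρ) / (1 - s) < 0 :=
    div_neg_of_neg_of_pos (by linarith) (by linarith [hs.2])
  linarith

omit hs in
-- Forward half-orbits of an irrational rotation are dense. Density of the group generated by `ρ`
-- and 1 gives an element `g = n * ρ + k` smaller than the target interval, and multiples of `g`
-- cannot step over that interval.
lemma exists_nat_mul_add_int_mem {ρ : ℝ} (h : Irrational ρ) (t₀ : ℝ) {a b : ℝ} (hab : a < b)
    (N : ℕ) : ∃ n : ℕ, N ≤ n ∧ ∃ k : ℤ, t₀ + n * ρ + k ∈ Ioo a b := by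
  have hd : Dense (AddSubgroup.closure {ρ, 1} : Set ℝ) := by
    rw [dense_addSubgroupClosure_pair_iff]; simpa using h
  set ε := min (b - a) 1
  have hε : 0 < ε := lt_min (by linarith) one_pos
  obtain ⟨g, hg, hgε⟩ := hd.exists_mem_open (isOpen_Ioo (a := 0) (b := ε))
    ⟨ε / 2, by linarith, by linarith⟩
  rw [SetLike.mem_coe, AddSubgroup.mem_closure_pair] at hg
  obtain ⟨n, k, hnk⟩ := hg
  simp only [zsmul_eq_mul, mul_one] at hnk
  have hn0 : n ≠ 0 := by
    rintro rfl
    rw [Int.cast_zero, zero_mul, zero_add] at hnk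
    rw [← hnk] at hgε
    have h1 : (0 : ℤ) < k := by exact_mod_cast hgε.1
    have h2 : (k : ℝ) < 1 := hgε.2.trans_le (min_le_right _ _)
    have h3 : k < 1 := by exact_mod_cast h2
    omega
  have hgab : g < b - a := hgε.2.trans_le (min_le_left _ _)
  have hg0 : 0 < g := hgε.1
  -- The number of rotation steps must be nonnegative: for `n < 0` one descends by `g` from far
  -- above, for `n > 0` one ascends from far below. The shift `M` makes the distance so long that at
  -- least `N` steps are used.
  rcases lt_or_gt_of_ne hn0 with hneg | hpos
  · set M : ℤ := ⌈N * g + b - t₀⌉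
    have hM := Int.le_ceil (N * g + b - t₀)
    set j : ℤ := ⌊(t₀ + M - b) / g⌋ + 1
    have hj1 : (t₀ + M - b) / g < j := by push_cast [j]; exact Int.lt_floor_add_one _
    have hj2 : (j : ℝ) ≤ (t₀ + M - b) / g + 1 := by
      push_cast [j]; linarith [Int.floor_le ((t₀ + M - b) / g)]
    rw [div_lt_iff₀ hg0] at hj1
    have hj2' : (j : ℝ) * g ≤ (t₀ + M - b) + g := by
      have := mul_le_mul_of_nonneg_right hj2 hg0.le
      rwa [add_mul, div_mul_cancel₀ _ hg0.ne', one_mul] at this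
    have hjN : (N : ℤ) ≤ j := by
      have : (N : ℝ) * g < j * g := by linarith
      have := lt_of_mul_lt_mul_right this hg0.le
      exact_mod_cast this.le
    have hmul : (N : ℤ) ≤ j * (-n) := by nlinarith
    refine ⟨(j * (-n)).toNat, by omega, M - j * k, ?_⟩
    have e : (((j * (-n)).toNat : ℕ) : ℝ) = -(j * n) := by
      have : (((j * (-n)).toNat : ℕ) : ℤ) = j * (-n) := Int.toNat_of_nonneg (by omega)
      have h2 : (((j * (-n)).toNat : ℕ) : ℝ) = ((j * (-n) : ℤ) : ℝ) := by exact_mod_cast this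
      rw [h2]; push_cast; ring
    have e2 : t₀ + (((j * (-n)).toNat : ℕ) : ℝ) * ρ + ((M - j * k : ℤ) : ℝ) = t₀ + M - j * g := by
      rw [e, ← hnk]; push_cast; ring
    rw [e2]
    exact ⟨by linarith, by linarith⟩
  · set M : ℤ := ⌈N * g - a + t₀⌉
    have hM := Int.le_ceil (N * g - a + t₀)
    set j : ℤ := ⌊(a - t₀ + M) / g⌋ + 1
    have hj1 : (a - t₀ + M) / g < j := by push_cast [j]; exact Int.lt_floor_add_one _
    have hj2 : (j : ℝ) ≤ (a - t₀ + M) / g + 1 := by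
      push_cast [j]; linarith [Int.floor_le ((a - t₀ + M) / g)]
    rw [div_lt_iff₀ hg0] at hj1
    have hj2' : (j : ℝ) * g ≤ (a - t₀ + M) + g := by
      have := mul_le_mul_of_nonneg_right hj2 hg0.le
      rwa [add_mul, div_mul_cancel₀ _ hg0.ne', one_mul] at this
    have hjN : (N : ℤ) ≤ j := by
      have : (N : ℝ) * g < j * g := by linarith
      have := lt_of_mul_lt_mul_right this hg0.le
      exact_mod_cast this.le
    have hmul : (N : ℤ) ≤ j * n := by nlinarith
    refine ⟨(j * n).toNat, by omega, j * k - M, ?_⟩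
    have e : (((j * n).toNat : ℕ) : ℝ) = j * n := by
      have : (((j * n).toNat : ℕ) : ℤ) = j * n := Int.toNat_of_nonneg (by omega)
      have h2 : (((j * n).toNat : ℕ) : ℝ) = ((j * n : ℤ) : ℝ) := by exact_mod_cast this
      rw [h2]; push_cast; ring
    have e2 : t₀ + (((j * n).toNat : ℕ) : ℝ) * ρ + ((j * k - M : ℤ) : ℝ) = t₀ - M + j * g := by
      rw [e, ← hnk]; push_cast; ring
    rw [e2]
    exact ⟨by linarith, by linarith⟩

lemma stair_lt_of_floor_lt {t t' : ℝ} (h : t ≤ t') {k : ℕ}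
    (hk : ⌊t - (k + 1) * ρ⌋ < ⌊t' - (k + 1) * ρ⌋) : stair s ρ δ t < stair s ρ δ t' := by
  have h1 : (0 : ℝ) < 1 - s := by linarith [hs.2]
  unfold stair
  refine add_lt_add_right (mul_lt_mul_of_pos_left ?_ h1) _
  refine (summable_floor hs t ρ).tsum_lt_tsum (i := k) (fun j => ?_) ?_ (summable_floor hs t' ρ)
  · exact mul_le_mul_of_nonneg_left (Int.cast_le.2 (Int.floor_mono (by linarith)))
      (pow_pos hs.1 j).le
  · exact mul_lt_mul_of_pos_left (by exact_mod_cast hk) (pow_pos hs.1 k)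

/-- The jumps of `stair` sit at the points `(k + 1) * ρ` modulo 1, which meet every interval. -/
lemma stair_strictMono (h : Irrational ρ) : StrictMono (stair s ρ δ) := fun t t' hlt => by
  obtain ⟨n, hn1, k, hk⟩ := exists_nat_mul_add_int_mem h 0 hlt 1
  obtain ⟨n, rfl⟩ : ∃ j, n = j + 1 := ⟨n - 1, by omega⟩
  refine stair_lt_of_floor_lt hs hlt.le (k := n) ?_
  have h2 : ⌊t - ((n : ℝ) + 1) * ρ⌋ < k := by
    rw [Int.floor_lt]; have := hk.1; push_cast at this; linarith
  have h3 : k ≤ ⌊t' - ((n : ℝ) + 1) * ρ⌋ := by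
    rw [Int.le_floor]; have := hk.2; push_cast at this; linarith
  omega

/-- Here both ends coincide and the left limit of `stair` at 1 equals 1; strict monotonicity keeps
the values before 1 below it. -/
lemma admissible_of_irrational (h : Irrational ρ) (hδ : δ = plateauLo s ρ) :
    Admissible s ρ δ := by
  have e := plateauLo_eq_plateauHi (s := s) h
  refine admissible_of_lt_one hs hδ.ge (hδ.trans e).le fun t ht => ?_
  have h2 := stair_le_of_lt_one hs (ρ := ρ) (δ := δ) (show (t + 1) / 2 < 1 by linarith)
  rw [hδ.trans e, sub_self, zero_div, zero_add, ← e, ← hδ] at h2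
  exact (stair_strictMono hs h (by linarith)).trans_le h2

end

end HomothetySurface

open scoped Pointwise


namespace HomothetySurface

/-! ### The attractor of the contracted rotation -/

/-- `K` is the invariant attractor of the contracted rotation `y ↦ s y + δ mod 1`. -/
structure IsCircleAttractor (s δ : ℝ) (K : Set ℝ) : Prop where
  compact : IsCompact K
  subset : K ⊆ Icc 0 1
  nonempty : K.Nonempty
  forward : ∀ κ ∈ K, (∀ n : ℤ, s * κ + δ ≠ n) → Int.fract (s * κ + δ) ∈ K
  backward : ∀ κ ∈ K, κ ∈ Ioo (0 : ℝ) 1 → ∃ κ' ∈ K, ∃ n : ℤ, s * κ' + δ = κ + n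
  attracts : ∀ (N : ℕ) (y : ℕ → ℝ), (∀ j ≤ N, y j ∈ Ioo (0 : ℝ) 1) →
    (∀ j < N, ∃ n : ℤ, s * y j + δ = y (j + 1) + n) → Metric.infDist (y N) K ≤ s ^ N

/-- A bi-infinite orbit in `K`, away from the discontinuity, whose forward half is dense in `K`. -/
def HasDenseOrbit (s δ : ℝ) (K : Set ℝ) : Prop :=
  ∃ y : ℤ → ℝ, (∀ n, y n ∈ Ioo (0 : ℝ) 1) ∧ (∀ n, y n ∈ K) ∧
    (∀ n, ∃ k : ℤ, s * y n + δ = y (n + 1) + k) ∧ ∀ N : ℤ, K ⊆ closure (y '' Ici N)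

/-- The invariant set of the contracted rotation with rotation number `ρ`. -/
def circleAttractor (s ρ δ : ℝ) : Set ℝ := closure (stair s ρ δ '' Ico 0 1)

/-- The orbit of the contracted rotation that corresponds to the rotation orbit of `t`. -/
noncomputable def stairOrbit (s ρ δ t : ℝ) (n : ℤ) : ℝ := stair s ρ δ (Int.fract (t + n * ρ))

section
variable {s : ℝ} (hs : s ∈ Ioo (0 : ℝ) 1) {ρ δ : ℝ} (ha : Admissible s ρ δ)

include ha in
lemma stair_mem_Ico {t : ℝ} (ht : t ∈ Ico (0 : ℝ) 1) : stair s ρ δ t ∈ Ico (0 : ℝ) 1 := by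
  have h1 := ha.1 t
  rw [Int.floor_eq_zero_iff.2 ht] at h1
  exact Int.floor_eq_zero_iff.1 h1

include ha in
lemma stairOrbit_mem_Ico (t : ℝ) (n : ℤ) : stairOrbit s ρ δ t n ∈ Ico (0 : ℝ) 1 :=
  stair_mem_Ico ha ⟨Int.fract_nonneg _, Int.fract_lt_one _⟩

lemma stairOrbit_mem (t : ℝ) (n : ℤ) : stairOrbit s ρ δ t n ∈ circleAttractor s ρ δ :=
  subset_closure ⟨_, ⟨Int.fract_nonneg _, Int.fract_lt_one _⟩, rfl⟩

include hs in
lemma stair_fract (t : ℝ) : ∃ k : ℤ, stair s ρ δ t = stair s ρ δ (Int.fract t) + k := by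
  refine ⟨⌊t⌋, ?_⟩
  rw [← stair_add_int hs, Int.fract_add_floor]

include hs ha in
lemma mul_stair_add {t : ℝ} (ht : t ∈ Ico (0 : ℝ) 1) :
    s * stair s ρ δ t + δ = stair s ρ δ (t + ρ) := by
  rw [stair_add hs, Int.floor_eq_zero_iff.2 ht]; simp

include hs ha in
lemma stairOrbit_succ (t : ℝ) (n : ℤ) :
    ∃ k : ℤ, s * stairOrbit s ρ δ t n + δ = stairOrbit s ρ δ t (n + 1) + k := by
  unfold stairOrbit
  rw [mul_stair_add hs ha ⟨Int.fract_nonneg _, Int.fract_lt_one _⟩]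
  have e : Int.fract (t + n * ρ) + ρ = (t + (n + 1 : ℤ) * ρ) + ((-⌊t + n * ρ⌋ : ℤ) : ℝ) := by
    rw [Int.fract]; push_cast; ring
  obtain ⟨k, hk⟩ := stair_fract hs (ρ := ρ) (δ := δ) (t + (n + 1 : ℤ) * ρ)
  rw [e, stair_add_int hs, hk]
  exact ⟨k + -⌊t + n * ρ⌋, by push_cast; ring⟩

lemma isClosed_range_intCast : IsClosed (range ((↑) : ℤ → ℝ)) :=
  Int.isClosedEmbedding_coe_real.isClosed_range

include hs ha in
lemma circleAttractor_compact : IsCompact (circleAttractor s ρ δ) := by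
  refine (isCompact_Icc (a := (0 : ℝ)) (b := 1)).of_isClosed_subset isClosed_closure
    (closure_minimal ?_ isClosed_Icc)
  rintro _ ⟨t, ht, rfl⟩
  exact Ico_subset_Icc_self (stair_mem_Ico ha ht)

include hs ha in
-- Invariance is inherited by the closure from the conjugacy. The estimate in `attracts` concerns
-- finite orbits, so it serves both for forward convergence and for locating points with arbitrarily
-- long past.
lemma isCircleAttractor : IsCircleAttractor s δ (circleAttractor s ρ δ) where
  compact := circleAttractor_compact hs ha
  subset := closure_minimal (by
    rintro _ ⟨t, ht, rfl⟩
    exact Ico_subset_Icc_self (stair_mem_Ico ha ht)) isClosed_Icc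
  nonempty := ⟨_, subset_closure ⟨0, ⟨le_rfl, one_pos⟩, rfl⟩⟩
  forward := by
    intro κ hκ hn
    have hc : ContinuousAt (fun κ => Int.fract (s * κ + δ)) κ :=
      ContinuousAt.comp (f := fun κ => s * κ + δ)
        (continuousAt_fract (fun h => hn _ h)) (by fun_prop)
    refine hc.continuousWithinAt.mem_closure hκ ?_
    rintro _ ⟨t, ht, rfl⟩
    simp only
    rw [mul_stair_add hs ha ht]
    obtain ⟨k, hk⟩ := stair_fract hs (ρ := ρ) (δ := δ) (t + ρ)
    have hf : Int.fract (t + ρ) ∈ Ico (0 : ℝ) 1 := ⟨Int.fract_nonneg _, Int.fract_lt_one _⟩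
    rw [hk, Int.fract_add_intCast, Int.fract_eq_self.2 (stair_mem_Ico ha hf)]
    exact ⟨_, hf, rfl⟩
  backward := by
    intro κ hκ _
    set S : Set ℝ := {κ | ∃ κ' ∈ circleAttractor s ρ δ, ∃ n : ℤ, s * κ' + δ = κ + n}
    have hS : S = (fun p : ℝ × ℝ => s * p.1 + δ + p.2) ''
        (circleAttractor s ρ δ ×ˢ range ((↑) : ℤ → ℝ)) := by
      ext κ
      constructor
      · rintro ⟨κ', h, n, hn⟩
        exact ⟨(κ', ((-n : ℤ) : ℝ)), ⟨h, -n, rfl⟩, by push_cast; linarith⟩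
      · rintro ⟨⟨κ', n'⟩, ⟨h, n, rfl⟩, rfl⟩
        exact ⟨κ', h, -n, by push_cast; ring⟩
    -- Having a preimage in the attractor modulo 1 is a closed condition, because a compact set plus
    -- the closed set of integers is closed; hence it is enough to check it on the image of `stair`.
    have hSc : IsClosed S := by
      have : S = ((fun x => s * x + δ) '' circleAttractor s ρ δ) + range ((↑) : ℤ → ℝ) := by
        rw [hS]; ext κ
        constructor
        · rintro ⟨⟨κ', n'⟩, ⟨h, h'⟩, rfl⟩
          exact ⟨_, ⟨κ', h, rfl⟩, _, h', rfl⟩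
        · rintro ⟨_, ⟨κ', h, rfl⟩, _, h', rfl⟩
          exact ⟨(κ', _), ⟨h, h'⟩, rfl⟩
      rw [this]
      have hc : Continuous fun x : ℝ => s * x + δ := by fun_prop
      exact isClosed_range_intCast.add_left_of_isCompact
        ((circleAttractor_compact hs ha).image hc)
    refine closure_minimal (s := stair s ρ δ '' Ico 0 1) ?_ hSc hκ
    rintro _ ⟨t, ht, rfl⟩
    have hf : Int.fract (t - ρ) ∈ Ico (0 : ℝ) 1 := ⟨Int.fract_nonneg _, Int.fract_lt_one _⟩
    refine ⟨_, subset_closure ⟨_, hf, rfl⟩, -⌊t - ρ⌋, ?_⟩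
    rw [mul_stair_add hs ha hf, ← stair_add_int hs]
    congr 1; rw [Int.fract]; push_cast; ring
  attracts := by
    intro N y hy hstep
    set x : ℕ → ℝ := fun n => Nat.rec (y 0) (fun _ r => lift s δ r) n
    have hx : ∀ n, x (n + 1) = lift s δ (x n) := fun n => rfl
    have hxy : ∀ j ≤ N, ∃ k : ℤ, x j = y j + k := by
      intro j
      induction j with
      | zero => exact fun _ => ⟨0, by simp [x]⟩
      | succ n ih =>
        intro hn
        obtain ⟨k, hk⟩ := ih (by omega)
        obtain ⟨l, hl⟩ := hstep n (by omega)
        have hy' := hy n (by omega)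
        have hf : ⌊x n⌋ = k := by
          rw [hk, Int.floor_add_intCast, Int.floor_eq_zero_iff.2 ⟨hy'.1.le, hy'.2⟩, zero_add]
        refine ⟨l + k, ?_⟩
        rw [hx, lift, hf, hk]; push_cast; linear_combination hl
    -- A comparison orbit on the staircase with the same integer parts starts at distance less than
    -- 1, and `N` common steps shrink this distance by `s ^ N`.
    obtain ⟨t, ht⟩ := exists_finite_coding hs ha hx N
    have h1 := iterate_sub_stair hs hx fun j hj => ht j hj.le
    have hfr : ∀ u v : ℝ, ⌊u⌋ = ⌊v⌋ → |u - v| < 1 := fun u v h => Int.abs_sub_lt_one_of_floor_eq_floor h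
    have h2 : |x 0 - stair s ρ δ t| < 1 := hfr _ _ (by rw [ha.1]; simpa using ht 0 (by omega))
    obtain ⟨k, hk⟩ := hxy N le_rfl
    have hyN := hy N le_rfl
    have hkt : ⌊t + N * ρ⌋ = k := by
      rw [← ht N le_rfl, hk, Int.floor_add_intCast, Int.floor_eq_zero_iff.2 ⟨hyN.1.le, hyN.2⟩,
        zero_add]
    have hmem : stair s ρ δ (Int.fract (t + N * ρ)) ∈ circleAttractor s ρ δ :=
      subset_closure ⟨_, ⟨Int.fract_nonneg _, Int.fract_lt_one _⟩, rfl⟩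
    refine (Metric.infDist_le_dist_of_mem hmem).trans ?_
    have e : y N - stair s ρ δ (Int.fract (t + N * ρ)) = s ^ N * (x 0 - stair s ρ δ t) := by
      rw [← h1, hk, Int.fract, hkt]
      have := stair_add_int hs (ρ := ρ) (δ := δ) (t + N * ρ - k) k
      rw [sub_add_cancel] at this
      rw [this]; ring
    rw [Real.dist_eq, e, abs_mul, abs_of_pos (pow_pos hs.1 N)]
    have := pow_pos hs.1 N
    nlinarith

/-! #### Reflection -/

omit hs in
-- The map `y ↦ 1 - y` conjugates the contracted rotations with parameters `δ` and `1 - s - δ`. It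
-- gives access to the upper ends of the rational intervals, where the right-continuous staircase is
-- not admissible.
lemma IsCircleAttractor.reflect {K : Set ℝ} (h : IsCircleAttractor s (1 - s - δ) K) :
    IsCircleAttractor s δ ((fun y => 1 - y) '' K) where
  compact := h.compact.image (by fun_prop)
  subset := by
    rintro _ ⟨κ, hκ, rfl⟩
    have := h.subset hκ
    exact ⟨by linarith [this.2], by linarith [this.1]⟩
  nonempty := h.nonempty.image _
  forward := by
    rintro _ ⟨κ, hκ, rfl⟩ hn
    have hn' : ∀ n : ℤ, s * κ + (1 - s - δ) ≠ n := fun n hn' => hn (1 - n) (by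
      push_cast; linarith)
    refine ⟨_, h.forward κ hκ hn', ?_⟩
    set w := s * κ + (1 - s - δ)
    have h1 : 0 < Int.fract w := (Int.fract_pos).2 (fun h => hn' _ h)
    have h2 := Int.fract_lt_one w
    symm
    rw [Int.fract_eq_iff]
    refine ⟨by linarith, by linarith, -⌊w⌋, ?_⟩
    have := Int.fract_add_floor w
    simp only [w] at *
    push_cast; linarith
  backward := by
    rintro _ ⟨κ, hκ, rfl⟩ hκ'
    obtain ⟨κ', h1, n, hn⟩ := h.backward κ hκ ⟨by linarith [hκ'.2], by linarith [hκ'.1]⟩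
    exact ⟨_, ⟨κ', h1, rfl⟩, -n, by push_cast; linarith⟩
  attracts := by
    intro N y hy hstep
    have h1 := h.attracts N (fun j => 1 - y j)
      (fun j hj => ⟨by linarith [(hy j hj).2], by linarith [(hy j hj).1]⟩)
      (fun j hj => by
        obtain ⟨n, hn⟩ := hstep j hj
        exact ⟨-n, by push_cast; linarith⟩)
    refine le_trans (le_of_eq ?_) h1
    have hiso : Isometry fun y : ℝ => 1 - y := (IsometryEquiv.subLeft (1 : ℝ)).isometry
    have := Metric.infDist_image (x := 1 - y N) (t := K) hiso
    simpa using this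

/-! #### Continuity and dimension -/

omit ha in
include hs in
lemma tendsto_stair_right (t : ℝ) : Tendsto (stair s ρ δ) (𝓝[>] t) (𝓝 (stair s ρ δ t)) := by
  refine Tendsto.const_add _ (Tendsto.const_mul _
    (tendsto_tsum_codes hs (A := |t| + 1 + |ρ| + 1) (B := |ρ|) ?_ ?_))
  · filter_upwards [eventually_abs_le _ t] with x hx k
    exact (abs_floor_sub_le x ρ k).trans (by linarith)
  · intro k
    have : Tendsto (fun x => x - ((k : ℝ) + 1) * ρ) (𝓝[>] t) (𝓝[>] (t - ((k : ℝ) + 1) * ρ)) := by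
      refine tendsto_nhdsWithin_iff.2 ⟨?_, ?_⟩
      · exact ((continuous_id.sub continuous_const).tendsto t).mono_left nhdsWithin_le_nhds
      · filter_upwards [self_mem_nhdsWithin] with x hx
        exact sub_lt_sub_right (mem_Ioi.1 hx) _
    exact this.eventually (eventually_floor_eq_right _)

omit ha in
include hs in
lemma tendsto_stair_left (t : ℝ) : Tendsto (stair s ρ δ) (𝓝[<] t) (𝓝 (stairL s ρ δ t)) := by
  refine Tendsto.const_add _ (Tendsto.const_mul _
    (tendsto_tsum_codes hs (A := |t| + 1 + |ρ| + 1) (B := |ρ|) ?_ ?_))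
  · filter_upwards [eventually_abs_le _ t] with x hx k
    exact (abs_floor_sub_le x ρ k).trans (by linarith)
  · intro k
    have := tendsto_sub_const_nhdsLT t (-(((k : ℝ) + 1) * ρ))
    exact this.eventually (eventually_floor_eq_ceil_sub_one _)

omit ha in
include hs in
-- On a unit interval each code `⌊t - (k + 1) * ρ⌋` increases by only 1, well within the bound of
-- `dimH_closure_image_codes`.
lemma dimH_circleAttractor : dimH (circleAttractor s ρ δ) = 0 := by
  have h := dimH_closure_image_codes hs (a := fun k t => ⌊t - (k + 1) * ρ⌋)
    (fun k x y h => Int.floor_mono (by linarith)) (x₀ := 0) (x₁ := 1)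
    (fun k => by
      rw [show (1 : ℝ) - (k + 1) * ρ = 0 - (k + 1) * ρ + 1 by ring, Int.floor_add_one]; omega)
    (fun x => summable_floor hs x ρ) (δ / (1 - s)) (1 - s)
  refine le_antisymm (le_trans (dimH_mono (closure_mono (image_mono ?_))) h.le) bot_le
  exact Ico_subset_Icc_self

/-! #### Irrational rotation numbers -/

section
variable (hi : Irrational ρ) (hδ : δ = plateauLo s ρ)
include hs hi hδ

lemma stair_zero_eq : stair s ρ δ 0 = 0 := by rw [stair_zero hs, hδ]; simp

lemma stairOrbit_mem_Ioo {t : ℝ} {n : ℤ} (h : ∀ k : ℤ, t + n * ρ ≠ k) :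
    stairOrbit s ρ δ t n ∈ Ioo (0 : ℝ) 1 := by
  refine ⟨?_, (stairOrbit_mem_Ico (admissible_of_irrational hs hi hδ) t n).2⟩
  rw [← stair_zero_eq hs hi hδ]
  exact stair_strictMono hs hi (Int.fract_pos.2 fun e => h _ e)

/-- Right continuity of `stair` transports the density of a forward rotation orbit to the attractor.
-/
lemma hasDenseOrbit_irrational : HasDenseOrbit s δ (circleAttractor s ρ δ) := by
  have ha := admissible_of_irrational hs hi hδ
  -- The starting parameter `ρ / 2` is chosen so that its two-sided rotation orbit avoids the
  -- integers: `(2 * n + 1) * ρ` is irrational.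
  have hreg : ∀ n k : ℤ, ρ / 2 + n * ρ ≠ k := fun n k h => by
    have h1 : Irrational (((2 * n + 1 : ℤ) : ℝ) * ρ) := hi.intCast_mul (by omega)
    exact h1 ⟨2 * k, by push_cast; linarith⟩
  refine ⟨stairOrbit s ρ δ (ρ / 2), fun n => stairOrbit_mem_Ioo hs hi hδ (hreg n),
    stairOrbit_mem _, stairOrbit_succ hs ha _, fun N => closure_minimal ?_ isClosed_closure⟩
  rintro _ ⟨t, ht, rfl⟩
  rw [mem_closure_iff_nhds]
  intro W hW
  have h1 := (tendsto_stair_right hs (ρ := ρ) (δ := δ) t).eventually hW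
  obtain ⟨u, hu, hu'⟩ := (mem_nhdsGT_iff_exists_Ioo_subset' (lt_add_one t)).1 h1
  obtain ⟨n, hn, k, hk⟩ := exists_nat_mul_add_int_mem hi (ρ / 2)
    (show t < min u 1 from lt_min hu ht.2) N.toNat
  have hf : Int.fract (ρ / 2 + ((n : ℤ) : ℝ) * ρ) = ρ / 2 + n * ρ + k := by
    rw [Int.fract_eq_iff]
    exact ⟨ht.1.trans hk.1.le, hk.2.trans_le (min_le_right _ _), -k, by push_cast; ring⟩
  refine ⟨stairOrbit s ρ δ (ρ / 2) n, ?_, (n : ℤ), ?_, rfl⟩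
  · rw [stairOrbit, hf]
    exact hu' ⟨hk.1, hk.2.trans_le (min_le_left _ _)⟩
  · simp only [mem_Ici]; omega

lemma zero_mem_circleAttractor : (0 : ℝ) ∈ circleAttractor s ρ δ :=
  subset_closure ⟨0, ⟨le_rfl, one_pos⟩, stair_zero_eq hs hi hδ⟩

lemma one_mem_circleAttractor : (1 : ℝ) ∈ circleAttractor s ρ δ := by
  have h1 := tendsto_stair_left hs (ρ := ρ) (δ := δ) 1
  have h2 : stairL s ρ δ 1 = 1 := by
    have := stairL_add_int hs (ρ := ρ) (δ := δ) 0 1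
    rw [stairL_zero hs, zero_add, Int.cast_one] at this
    rw [this, hδ, plateauLo_eq_plateauHi hi]; simp
  rw [h2] at h1
  refine mem_closure_of_tendsto h1 ?_
  filter_upwards [Ioo_mem_nhdsLT (zero_lt_one' ℝ)] with t ht
  exact ⟨t, ⟨ht.1.le, ht.2⟩, rfl⟩

/-- A strictly increasing right-continuous function approaches each of its values by different
values. -/
lemma preperfect_circleAttractor : Preperfect (circleAttractor s ρ δ) := by
  refine (Preperfect.perfect_closure ?_).acc
  rintro _ ⟨t, ht, rfl⟩
  rw [accPt_iff_frequently]
  have h1 := tendsto_stair_right hs (ρ := ρ) (δ := δ) t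
  refine h1.frequently (Eventually.frequently ?_)
  filter_upwards [Ioo_mem_nhdsGT ht.2] with u hu
  exact ⟨(stair_strictMono hs hi hu.1).ne', u, ⟨ht.1.trans hu.1.le, hu.2⟩, rfl⟩

/-- For irrational `ρ` the orbit of 0 never meets the discontinuity again. On the surface this
prevents trajectories that leave `Z` inside the sheet from returning to it. -/
lemma exists_free_orbit_zero : ∃ y : ℕ → ℝ, y 0 = 0 ∧ (∀ n, y (n + 1) ∈ Ioo (0 : ℝ) 1) ∧
    ∀ n, ∃ k : ℤ, s * y n + δ = y (n + 1) + k := by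
  have ha := admissible_of_irrational hs hi hδ
  refine ⟨fun n => stairOrbit s ρ δ 0 n, ?_, fun n => ?_, fun n => ?_⟩
  · simp [stairOrbit, stair_zero_eq hs hi hδ]
  · refine stairOrbit_mem_Ioo hs hi hδ fun k hk => ?_
    have h1 : Irrational (((n + 1 : ℤ) : ℝ) * ρ) := hi.intCast_mul (by omega)
    exact h1 ⟨k, by push_cast at *; linarith⟩
  · simpa using stairOrbit_succ hs ha 0 n

omit ha in
-- Reflection turns the upper end of the circle into the lower one and replaces `ρ` by `-ρ`; the two
-- ends of the interval coincide, so the condition on `δ` is preserved.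
lemma exists_free_orbit_one : ∃ y : ℕ → ℝ, y 0 = 1 ∧ (∀ n, y (n + 1) ∈ Ioo (0 : ℝ) 1) ∧
    ∀ n, ∃ k : ℤ, s * y n + δ = y (n + 1) + k := by
  have hδ' : 1 - s - δ = plateauLo s (-ρ) := by
    rw [hδ, plateauLo_eq_plateauHi hi]
    unfold plateauHi plateauLo
    have e : ∀ k : ℕ, s ^ k * ((⌈((k : ℝ) + 1) * (-ρ)⌉ : ℤ) : ℝ) =
        s ^ k - s ^ k * ((⌊((k : ℝ) + 1) * ρ⌋ + 1 : ℤ) : ℝ) := fun k => by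
      rw [mul_neg, Int.ceil_neg]; push_cast; ring
    rw [tsum_congr e, (summable_geometric_of_lt_one hs.1.le hs.2).tsum_sub (summable_hi hs ρ),
      mul_sub, show (1 - s) ^ 2 * ∑' k : ℕ, s ^ k = (1 - s) * ((1 - s) * ∑' k : ℕ, s ^ k) by ring,
      tsum_geometric_succ hs]
    ring
  obtain ⟨y, h0, h1, h2⟩ := exists_free_orbit_zero hs hi.neg hδ'
  refine ⟨fun n => 1 - y n, by simp [h0], fun n => ⟨?_, ?_⟩, fun n => ?_⟩
  · linarith [(h1 n).2]
  · linarith [(h1 n).1]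
  · obtain ⟨k, hk⟩ := h2 n
    exact ⟨-k, by push_cast; linarith⟩

end

end


/-! ### Rational rotation numbers: regular and singular cycles -/

/-- `K` is a single periodic orbit that avoids the discontinuity. -/
def IsRegularCycle (s δ : ℝ) (K : Set ℝ) : Prop :=
  ∃ (q : ℕ) (y : ℤ → ℝ), 0 < q ∧ (∀ n, y n ∈ Ioo (0 : ℝ) 1) ∧ range y = K ∧
    (∀ n, ∃ k : ℤ, s * y n + δ = y (n + 1) + k) ∧ ∀ i j, y i = y j ↔ (q : ℤ) ∣ i - j

/-- `K` is a finite orbit that starts and ends at the discontinuity. -/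
def IsSingularCycle (s δ : ℝ) (K : Set ℝ) : Prop :=
  ∃ (q : ℕ) (y : ℕ → ℝ), (y 0 = 0 ∨ y 0 = 1) ∧ (∀ j < q, y (j + 1) ∈ Ioo (0 : ℝ) 1) ∧
    (∀ j < q, ∃ k : ℤ, s * y j + δ = y (j + 1) + k) ∧ (∃ k : ℤ, s * y q + δ = k) ∧
    K = y '' Iic q

section
variable {s : ℝ} (hs : s ∈ Ioo (0 : ℝ) 1) (r : ℚ) {δ : ℝ}

lemma den_mul_cast : (r.den : ℝ) * (r : ℝ) = r.num := by
  have := Rat.mul_den_eq_num r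
  rw [mul_comm]; exact_mod_cast this

lemma den_cast_pos : (0 : ℝ) < r.den := by exact_mod_cast r.pos

/-- Bézout's identity solves the congruence, and adding a large multiple of the denominator pushes
the solution beyond `N`. -/
lemma exists_mul_num_eq (a N : ℤ) : ∃ n ≥ N, ∃ k : ℤ, n * r.num = a + k * r.den := by
  have hc : IsCoprime r.num (r.den : ℤ) := by
    rw [Int.isCoprime_iff_gcd_eq_one]; exact r.reduced
  obtain ⟨u, v, huv⟩ := hc
  have hq : (1 : ℤ) ≤ r.den := by have := r.pos; omega
  refine ⟨a * u + r.den * (|N| + |a * u|), ?_, (|N| + |a * u|) * r.num - a * v, ?_⟩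
  · have h1 := neg_abs_le (a * u)
    have h2 := le_abs_self N
    have h3 : |N| + |a * u| ≤ r.den * (|N| + |a * u|) := by
      have := abs_nonneg N; have := abs_nonneg (a * u); nlinarith
    linarith
  · linear_combination a * huv

/-- For rational `r` the staircase jumps only at multiples of `1 / r.den`, so the attractor is
finite. -/
lemma stair_eq_stair_floor (t : ℝ) : stair s r δ t = stair s r δ (⌊r.den * t⌋ / r.den) := by
  unfold stair
  have hq := den_cast_pos r
  have hqr := den_mul_cast r
  congr 3
  funext k
  congr 2
  refine eq_of_forall_le_iff fun n => ?_
  rw [Int.le_floor, Int.le_floor]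
  have e1 : (n : ℝ) ≤ t - (k + 1) * r ↔ ((n * r.den + (k + 1) * r.num : ℤ) : ℝ) ≤ r.den * t := by
    push_cast
    rw [← hqr, ← mul_le_mul_iff_right₀ hq]
    constructor <;> intro h <;> linarith
  have e2 : (n : ℝ) ≤ (⌊r.den * t⌋ : ℝ) / r.den - (k + 1) * r ↔
      ((n * r.den + (k + 1) * r.num : ℤ) : ℝ) ≤ ⌊r.den * t⌋ := by
    push_cast
    rw [← hqr, ← mul_le_mul_iff_right₀ hq, mul_sub, mul_div_cancel₀ _ hq.ne']
    constructor <;> intro h <;> linarith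
  rw [e1, e2, Int.cast_le, Int.le_floor]

include hs in
-- Every multiple of `1 / r.den` really is a jump, since some positive multiple of `r` is congruent
-- to it modulo 1. Hence the cycle has exactly `r.den` points.
lemma stair_div_lt {a b : ℤ} (h : a < b) : stair s r δ (a / r.den) < stair s r δ (b / r.den) := by
  have hq := den_cast_pos r
  have hqr := den_mul_cast r
  obtain ⟨n, hn, k, hk⟩ := exists_mul_num_eq r b 1
  obtain ⟨m, rfl⟩ : ∃ m : ℕ, n = m + 1 := ⟨(n - 1).toNat, by omega⟩
  have hk' : ((m : ℝ) + 1) * r.num = b + k * r.den := by exact_mod_cast hk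
  have hab : (a : ℝ) < b := by exact_mod_cast h
  refine stair_lt_of_floor_lt hs (by gcongr) (k := m) ?_
  have e : ∀ c : ℝ, c / r.den - (m + 1) * r = (c - b) / r.den + ((-k : ℤ) : ℝ) := fun c => by
    push_cast; field_simp; linear_combination -hk' - ((m : ℝ) + 1) * hqr
  rw [e, e, Int.floor_add_intCast, Int.floor_add_intCast]
  simp only [sub_self, zero_div, Int.floor_zero]
  have : ⌊((a : ℝ) - b) / r.den⌋ < 0 := by
    rw [Int.floor_lt]; push_cast; exact div_neg_of_neg_of_pos (by linarith) hq
  omega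

lemma fract_mul_cast (n : ℤ) : ∃ a : ℤ, 0 ≤ a ∧ a < r.den ∧
    Int.fract (0 + n * (r : ℝ)) = a / r.den ∧ a = n * r.num % r.den := by
  have hq := den_cast_pos r
  have hq' : (0 : ℤ) < r.den := by exact_mod_cast r.pos
  have hqr := den_mul_cast r
  refine ⟨n * r.num % r.den, Int.emod_nonneg _ hq'.ne', Int.emod_lt_of_pos _ hq', ?_, rfl⟩
  rw [Int.fract_eq_iff]
  have h1 : ((n * r.num % r.den : ℤ) : ℝ) < r.den := by exact_mod_cast Int.emod_lt_of_pos _ hq'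
  have h0 : (0 : ℝ) ≤ ((n * r.num % r.den : ℤ) : ℝ) := by exact_mod_cast Int.emod_nonneg _ hq'.ne'
  refine ⟨div_nonneg h0 hq.le, (div_lt_one hq).2 h1, n * r.num / r.den, ?_⟩
  have h2 : ((n * r.num % r.den : ℤ) : ℝ) + r.den * ((n * r.num / r.den : ℤ) : ℝ)
      = n * r.num := by exact_mod_cast Int.emod_add_mul_ediv (n * r.num) r.den
  field_simp
  linear_combination -h2 + (n : ℝ) * hqr

include hs in
lemma stairOrbit_eq_iff (i j : ℤ) :
    stairOrbit s r δ 0 i = stairOrbit s r δ 0 j ↔ (r.den : ℤ) ∣ i - j := by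
  obtain ⟨a, -, -, ha, ha'⟩ := fract_mul_cast r i
  obtain ⟨b, -, -, hb, hb'⟩ := fract_mul_cast r j
  have hinj : stairOrbit s r δ 0 i = stairOrbit s r δ 0 j ↔ a = b := by
    unfold stairOrbit
    rw [ha, hb]
    refine ⟨fun h => ?_, fun h => by rw [h]⟩
    rcases lt_trichotomy a b with h1 | h1 | h1
    · exact absurd h (stair_div_lt hs r h1).ne
    · exact h1
    · exact absurd h (stair_div_lt hs r h1).ne'
  have hc : IsCoprime (r.den : ℤ) r.num := by
    refine IsCoprime.symm ?_
    rw [Int.isCoprime_iff_gcd_eq_one]; exact r.reduced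
  rw [hinj, ha', hb', ← Int.ModEq, Int.modEq_comm, Int.modEq_iff_dvd, ← sub_mul]
  exact ⟨fun h => hc.dvd_of_dvd_mul_right h, fun h => h.mul_right _⟩

lemma circleAttractor_rat : circleAttractor s r δ = range (stairOrbit s r δ 0) := by
  have hq := den_cast_pos r
  have hqr := den_mul_cast r
  have e : stair s r δ '' Ico 0 1 = range (stairOrbit s r δ 0) := by
    ext x
    constructor
    · rintro ⟨t, ht, rfl⟩
      obtain ⟨n, -, k, hk⟩ := exists_mul_num_eq r ⌊r.den * t⌋ 0
      have hk' : (n : ℝ) * r.num = ⌊r.den * t⌋ + k * r.den := by exact_mod_cast hk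
      refine ⟨n, ?_⟩
      rw [stair_eq_stair_floor r t, stairOrbit]
      congr 1
      rw [Int.fract_eq_iff]
      have h0 : (0 : ℝ) ≤ ⌊r.den * t⌋ := by
        exact_mod_cast Int.floor_nonneg.2 (mul_nonneg hq.le ht.1)
      refine ⟨div_nonneg h0 hq.le, (div_lt_one hq).2 ?_, k, ?_⟩
      · exact (Int.floor_le _).trans_lt (by nlinarith [ht.2])
      · field_simp; linear_combination hk' + (n : ℝ) * hqr
    · rintro ⟨n, rfl⟩
      exact ⟨_, ⟨Int.fract_nonneg _, Int.fract_lt_one _⟩, rfl⟩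
  have hfin : (range (stairOrbit s r δ 0)).Finite := by
    refine ((finite_Icc (0 : ℤ) r.den).image fun a : ℤ => stair s r δ (a / r.den)).subset ?_
    rintro _ ⟨n, rfl⟩
    obtain ⟨a, h0, h1, h, -⟩ := fract_mul_cast r n
    exact ⟨a, ⟨h0, h1.le⟩, by rw [stairOrbit, h]⟩
  rw [circleAttractor, e, hfin.isClosed.closure_eq]

include hs in
-- Strictly above the lower end `stair` is positive at 0, and strictly below the upper end it is
-- admissible; the cycle then avoids 0 and 1.
lemma isRegularCycle_rat (h0 : plateauLo s r < δ) (h1 : δ < plateauHi s r) :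
    IsRegularCycle s δ (circleAttractor s r δ) := by
  have ha := admissible_of_lt hs h0.le h1
  refine ⟨r.den, stairOrbit s r δ 0, r.pos, fun n => ⟨?_, (stairOrbit_mem_Ico ha 0 n).2⟩,
    (circleAttractor_rat r).symm, stairOrbit_succ hs ha 0, stairOrbit_eq_iff hs r⟩
  refine lt_of_lt_of_le ?_ (stair_mono hs (Int.fract_nonneg _))
  rw [stair_zero hs]
  exact div_pos (by linarith) (by linarith [hs.2])

lemma IsRegularCycle.hasDenseOrbit {K : Set ℝ} (h : IsRegularCycle s δ K) :
    HasDenseOrbit s δ K := by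
  obtain ⟨q, y, hq, hy, rfl, hstep, hper⟩ := h
  refine ⟨y, hy, mem_range_self, hstep, fun N => ?_⟩
  rintro _ ⟨n, rfl⟩
  refine subset_closure ⟨n + q * (|N| + |n|), ?_, ?_⟩
  · have h1 := neg_abs_le n
    have h2 := le_abs_self N
    have h3 : |N| + |n| ≤ q * (|N| + |n|) := by
      have := abs_nonneg N; have := abs_nonneg n; have : (1 : ℤ) ≤ q := by omega
      nlinarith
    change N ≤ _
    linarith
  · rw [hper]; exact ⟨|N| + |n|, by ring⟩

include hs in
-- At the lower end `stair` vanishes at 0, so the periodic orbit passes through the discontinuity.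
lemma isSingularCycle_rat (h : δ = plateauLo s r) :
    IsSingularCycle s δ (circleAttractor s r δ) := by
  have ha := admissible_of_lt hs h.ge (h ▸ plateauLo_lt_plateauHi hs r)
  have hst0 : stair s r δ 0 = 0 := by rw [stair_zero hs, h]; simp
  have h0 : stairOrbit s r δ 0 0 = 0 := by simp [stairOrbit, hst0]
  have hqr := den_mul_cast r
  -- The `r.den` points are indexed from 0 to `r.den - 1`, and the step from the last one leads back
  -- to the discontinuity.
  refine ⟨r.den - 1, fun n => stairOrbit s r δ 0 n, Or.inl (by simpa using h0),
    fun j hj => ⟨?_, (stairOrbit_mem_Ico ha 0 _).2⟩,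
    fun j _ => by simpa using stairOrbit_succ hs ha 0 j, ?_, ?_⟩
  · refine lt_of_le_of_ne (stairOrbit_mem_Ico ha 0 _).1 fun he => ?_
    replace he := (stairOrbit_eq_iff hs r _ _).1 (h0.trans he)
    have := r.pos
    have h2 : (r.den : ℤ) ∣ ((j + 1 : ℕ) : ℤ) := by
      rw [← dvd_neg]; simpa using he
    have := Int.le_of_dvd (by omega) h2
    omega
  · obtain ⟨k, hk⟩ := stairOrbit_succ hs ha 0 ((r.den - 1 : ℕ) : ℤ)
    have hz : stairOrbit s r δ 0 (((r.den - 1 : ℕ) : ℤ) + 1) = 0 := by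
      refine ((stairOrbit_eq_iff hs r _ _).2 ?_).trans h0
      have := r.pos
      exact ⟨1, by omega⟩
    exact ⟨k, by rw [hk, hz, zero_add]⟩
  · rw [circleAttractor_rat]
    refine Subset.antisymm ?_ (by rintro _ ⟨n, -, rfl⟩; exact mem_range_self _)
    rintro _ ⟨n, rfl⟩
    have hq' : (0 : ℤ) < r.den := by exact_mod_cast r.pos
    have h1 := Int.emod_nonneg n hq'.ne'
    have h2 := Int.emod_lt_of_pos n hq'
    refine ⟨(n % r.den).toNat, ?_, ?_⟩
    · simp only [mem_Iic]; omega
    · simp only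
      rw [stairOrbit_eq_iff hs, Int.toNat_of_nonneg h1]
      exact ⟨-(n / r.den), by have := Int.emod_add_mul_ediv n r.den; linarith⟩

lemma IsSingularCycle.reflect {K : Set ℝ} (h : IsSingularCycle s (1 - s - δ) K) :
    IsSingularCycle s δ ((fun y => 1 - y) '' K) := by
  obtain ⟨q, y, h0, h1, h2, ⟨k, h3⟩, rfl⟩ := h
  refine ⟨q, fun n => 1 - y n, ?_, fun j hj => ⟨?_, ?_⟩, fun j hj => ?_, ⟨1 - k, ?_⟩, ?_⟩
  · rcases h0 with h0 | h0 <;> simp [h0]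
  · linarith [(h1 j hj).2]
  · linarith [(h1 j hj).1]
  · obtain ⟨k, hk⟩ := h2 j hj
    exact ⟨-k, by push_cast; linarith⟩
  · push_cast; linarith
  · rw [image_image]

include hs in
-- At the upper end `stair` attains 1 before `t = 1` and is not admissible. Reflection exchanges the
-- two ends and replaces `r` by `-r`.
lemma exists_singularCycle (h : δ = plateauLo s r ∨ δ = plateauHi s r) :
    ∃ K, IsCircleAttractor s δ K ∧ IsSingularCycle s δ K := by
  rcases h with h | h
  · exact ⟨_, isCircleAttractor hs (admissible_of_lt hs h.ge (h ▸ plateauLo_lt_plateauHi hs r)),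
      isSingularCycle_rat hs r h⟩
  · have h' : 1 - s - δ = plateauLo s ((-r : ℚ) : ℝ) := by
      rw [h]
      unfold plateauHi plateauLo
      have e : ∀ k : ℕ, s ^ k * ((⌈((k : ℝ) + 1) * ((-r : ℚ) : ℝ)⌉ : ℤ) : ℝ) =
          s ^ k - s ^ k * ((⌊((k : ℝ) + 1) * (r : ℝ)⌋ + 1 : ℤ) : ℝ) := fun k => by
        rw [Rat.cast_neg, mul_neg, Int.ceil_neg]; push_cast; ring
      rw [tsum_congr e, (summable_geometric_of_lt_one hs.1.le hs.2).tsum_sub (summable_hi hs r),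
        mul_sub, show (1 - s) ^ 2 * ∑' k : ℕ, s ^ k = (1 - s) * ((1 - s) * ∑' k : ℕ, s ^ k) by ring,
        tsum_geometric_succ hs]
      ring
    exact ⟨_, (isCircleAttractor hs (admissible_of_lt hs h'.ge
      (h' ▸ plateauLo_lt_plateauHi hs (-r)))).reflect, (isSingularCycle_rat hs (-r) h').reflect⟩

lemma eq_of_mem_Ioo_of_add_int {x y : ℝ} (hx : x ∈ Ioo (0 : ℝ) 1) (hy : y ∈ Ioo (0 : ℝ) 1)
    {k l : ℤ} (h : x + k = y + l) : x = y := by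
  have h1 : (-1 : ℝ) < ((k - l : ℤ) : ℝ) := by push_cast; linarith [hx.1, hx.2, hy.1, hy.2]
  have h2 : ((k - l : ℤ) : ℝ) < 1 := by push_cast; linarith [hx.1, hx.2, hy.1, hy.2]
  have h3 : (-1 : ℤ) < k - l := by exact_mod_cast h1
  have h4 : k - l < (1 : ℤ) := by exact_mod_cast h2
  have : k = l := by omega
  subst this
  linarith

include hs in
/-- There are no regular infinite backward orbits if the attractor is singular. -/
lemma IsSingularCycle.no_backward_orbit {K : Set ℝ} (hA : IsCircleAttractor s δ K)
    (h : IsSingularCycle s δ K) (y : ℕ → ℝ) (hy : ∀ n, y n ∈ Ioo (0 : ℝ) 1)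
    (hstep : ∀ n, ∃ k : ℤ, s * y (n + 1) + δ = y n + k) : False := by
  have hmem : ∀ n, y n ∈ K := by
    intro n
    rw [hA.compact.isClosed.mem_iff_infDist_zero hA.nonempty]
    refine le_antisymm ?_ Metric.infDist_nonneg
    -- The point `y n` has a regular past of every length `N`, hence lies within `s ^ N` of `K` for
    -- all `N`.
    refine ge_of_tendsto' (tendsto_pow_atTop_nhds_zero_of_lt_one hs.1.le hs.2) fun N => ?_
    have := hA.attracts N (fun j => y (n + N - j)) (fun j _ => hy _) (fun j hj => by
      have := hstep (n + N - (j + 1))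
      rwa [show n + N - (j + 1) + 1 = n + N - j by omega] at this)
    simpa using this
  obtain ⟨q, z, h0, h1, h2, ⟨k, h3⟩, rfl⟩ := h
  -- The point `z (q - d)` reaches the discontinuity after `d + 1` steps, whereas `y n` still has
  -- `n` regular steps ahead.
  have key : ∀ d ≤ q, ∀ n, d + 1 ≤ n → y n ≠ z (q - d) := by
    intro d
    induction d with
    | zero =>
      intro _ n hn he
      obtain ⟨m, rfl⟩ : ∃ m, n = m + 1 := ⟨n - 1, by omega⟩
      obtain ⟨l, hl⟩ := hstep m
      rw [he, Nat.sub_zero, h3] at hl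
      have := hy m
      have e1 : (0 : ℝ) < ((k - l : ℤ) : ℝ) := by push_cast; linarith [this.1]
      have e2 : ((k - l : ℤ) : ℝ) < 1 := by push_cast; linarith [this.2]
      have e3 : 0 < k - l := by exact_mod_cast e1
      have e4 : k - l < 1 := by exact_mod_cast e2
      omega
    | succ d ih =>
      intro hd n hn he
      obtain ⟨m, rfl⟩ : ∃ m, n = m + 1 := ⟨n - 1, by omega⟩
      obtain ⟨l, hl⟩ := hstep m
      obtain ⟨l', hl'⟩ := h2 (q - (d + 1)) (by omega)
      rw [show q - (d + 1) + 1 = q - d by omega] at hl'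
      rw [he, hl'] at hl
      have hz := h1 (q - (d + 1)) (by omega)
      rw [show q - (d + 1) + 1 = q - d by omega] at hz
      exact ih (by omega) m (by omega) (eq_of_mem_Ioo_of_add_int (hy m) hz hl.symm)
  obtain ⟨j, hj, he⟩ := hmem (q + 1)
  have hj' : j ≤ q := hj
  refine key (q - j) (by omega) (q + 1) (by omega) ?_
  rw [← he]; congr 1; omega

include hs in
/-- Regular orbits accumulate at all points of a singular cycle. -/
lemma IsSingularCycle.accumulates {K : Set ℝ} (hA : IsCircleAttractor s δ K)
    (h : IsSingularCycle s δ K) (y : ℕ → ℝ) (hy : ∀ n, y n ∈ Ioo (0 : ℝ) 1)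
    (hstep : ∀ n, ∃ k : ℤ, s * y n + δ = y (n + 1) + k) :
    ∀ κ ∈ K, MapClusterPt κ atTop y := by
  have hlim : Tendsto (fun n => Metric.infDist (y n) K) atTop (𝓝 0) :=
    squeeze_zero (fun _ => Metric.infDist_nonneg)
      (fun n => hA.attracts n y (fun j _ => hy j) (fun j _ => hstep j))
      (tendsto_pow_atTop_nhds_zero_of_lt_one hs.1.le hs.2)
  have hclK : ∀ κ, MapClusterPt κ atTop y → κ ∈ K := by
    intro κ hκ
    rw [hA.compact.isClosed.mem_iff_infDist_zero hA.nonempty]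
    have h1 := hκ.continuousAt_comp (f := fun x => Metric.infDist x K)
      (Metric.continuous_infDist_pt K).continuousAt
    obtain ⟨φ, hφ, hφ'⟩ := h1.tendsto_subseq
    exact tendsto_nhds_unique hφ' (hlim.comp hφ.tendsto_atTop)
  have hcompact : ∀ u : ℕ → ℕ, Tendsto u atTop atTop → ∃ κ ∈ Icc (0 : ℝ) 1,
      ∃ φ : ℕ → ℕ, StrictMono φ ∧ Tendsto (y ∘ u ∘ φ) atTop (𝓝 κ) := fun u _ => by
    obtain ⟨κ, h1, φ, h2, h3⟩ := (isCompact_Icc (a := (0 : ℝ)) (b := 1)).tendsto_subseq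
      (x := y ∘ u) (fun n => Ioo_subset_Icc_self (hy (u n)))
    exact ⟨κ, h1, φ, h2, h3⟩
  obtain ⟨q, z, h0, h1, h2, ⟨k, h3⟩, rfl⟩ := h
  -- one step of the orbit
  have hnext : ∀ κ, MapClusterPt κ atTop y → ∃ κ' ∈ Icc (0 : ℝ) 1, MapClusterPt κ' atTop y ∧
      ∃ l : ℤ, s * κ + δ = κ' + l := by
    intro κ hκ
    obtain ⟨φ, hφ, hφ'⟩ := hκ.tendsto_subseq
    obtain ⟨κ', hκ', ψ, hψ, hψ'⟩ := hcompact (fun n => φ n + 1)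
      ((tendsto_add_atTop_nat 1).comp hφ.tendsto_atTop)
    refine ⟨κ', hκ', ?_, ?_⟩
    · refine MapClusterPt.of_comp (φ := fun n => φ (ψ n) + 1) ?_ (Tendsto.mapClusterPt hψ')
      exact (tendsto_add_atTop_nat 1).comp (hφ.tendsto_atTop.comp hψ.tendsto_atTop)
    · have hd : Tendsto (fun n => s * y (φ (ψ n)) + δ - y (φ (ψ n) + 1)) atTop
          (𝓝 (s * κ + δ - κ')) :=
        (((hφ'.comp hψ.tendsto_atTop).const_mul s).add_const δ).sub hψ'
      have := isClosed_range_intCast.mem_of_tendsto hd (Eventually.of_forall fun n => by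
        obtain ⟨l, hl⟩ := hstep (φ (ψ n))
        exact ⟨l, by linarith⟩)
      obtain ⟨l, hl⟩ := this
      exact ⟨l, by linarith⟩
  have hz01 : ∀ j, j ≤ q → z j ∈ Ioo (0 : ℝ) 1 ∨ (j = 0 ∧ (z j = 0 ∨ z j = 1)) := by
    intro j hj
    rcases j with _ | j
    · exact Or.inr ⟨rfl, h0⟩
    · exact Or.inl (h1 j (by omega))
  have hup : ∀ j < q, MapClusterPt (z j) atTop y → MapClusterPt (z (j + 1)) atTop y := by
    intro j hj hc
    obtain ⟨κ', hκ', hc', l, hl⟩ := hnext _ hc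
    obtain ⟨l', hl'⟩ := h2 j hj
    have hz := h1 j hj
    have e : z (j + 1) + l' = κ' + l := hl'.symm.trans hl
    have hκ'' : κ' ∈ Ioo (0 : ℝ) 1 := by
      refine ⟨lt_of_le_of_ne hκ'.1 fun h => ?_, lt_of_le_of_ne hκ'.2 fun h => ?_⟩
      · rw [← h] at e
        have e1 : (0 : ℝ) < ((l - l' : ℤ) : ℝ) := by push_cast; linarith [hz.1]
        have e2 : ((l - l' : ℤ) : ℝ) < 1 := by push_cast; linarith [hz.2]
        have e3 : 0 < l - l' := by exact_mod_cast e1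
        have e4 : l - l' < 1 := by exact_mod_cast e2
        omega
      · rw [h] at e
        have e1 : (-1 : ℝ) < ((l - l' : ℤ) : ℝ) := by push_cast; linarith [hz.1]
        have e2 : ((l - l' : ℤ) : ℝ) < 0 := by push_cast; linarith [hz.2]
        have e3 : -1 < l - l' := by exact_mod_cast e1
        have e4 : l - l' < 0 := by exact_mod_cast e2
        omega
    rwa [eq_of_mem_Ioo_of_add_int hz hκ'' e]
  -- The successor of the last point is an integer modulo 1, and `z 0` is the only point of `K`
  -- outside the open unit interval. So accumulation passes from the end of the finite orbit to its
  -- beginning.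
  have hlast : MapClusterPt (z q) atTop y → MapClusterPt (z 0) atTop y := by
    intro hc
    obtain ⟨κ', hκ', hc', l, hl⟩ := hnext _ hc
    have hκK := hclK κ' hc'
    obtain ⟨j, hj, rfl⟩ := hκK
    rcases hz01 j hj with hz | ⟨rfl, -⟩
    · exfalso
      rw [h3] at hl
      have e1 : (0 : ℝ) < ((k - l : ℤ) : ℝ) := by push_cast; linarith [hz.1]
      have e2 : ((k - l : ℤ) : ℝ) < 1 := by push_cast; linarith [hz.2]
      have e3 : 0 < k - l := by exact_mod_cast e1
      have e4 : k - l < 1 := by exact_mod_cast e2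
      omega
    · exact hc'
  obtain ⟨κ, -, φ, hφ, hφ'⟩ := hcompact id tendsto_id
  have hκ : MapClusterPt κ atTop y := MapClusterPt.of_comp hφ.tendsto_atTop (Tendsto.mapClusterPt hφ')
  obtain ⟨j₀, hj₀, rfl⟩ := hclK κ hκ
  have hj₀' : j₀ ≤ q := hj₀
  have hq : ∀ i, j₀ + i ≤ q → MapClusterPt (z (j₀ + i)) atTop y := by
    intro i
    induction i with
    | zero => exact fun _ => hκ
    | succ i ih => exact fun hi => hup (j₀ + i) (by omega) (ih (by omega))
  have hz0 : MapClusterPt (z 0) atTop y := by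
    refine hlast ?_
    have := hq (q - j₀) (by omega)
    rwa [show j₀ + (q - j₀) = q by omega] at this
  rintro _ ⟨j, hj, rfl⟩
  have hj' : j ≤ q := hj
  clear hj
  induction j with
  | zero => exact hz0
  | succ j ih => exact hup j (by omega) (ih (by omega))

end


/-! ### Exceptional slopes -/

lemma volume_eq_zero_of_dimH {S : Set ℝ} (h : dimH S = 0) : volume S = 0 := by
  rw [← hausdorffMeasure_real]
  have := hausdorffMeasure_of_dimH_lt (s := S) (d := 1) (by rw [h]; exact_mod_cast one_pos)
  exact_mod_cast this

lemma dense_compl_of_volume_eq_zero {S : Set ℝ} (h : volume S = 0) : Dense Sᶜ := by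
  rw [← interior_eq_empty_iff_dense_compl]
  by_contra hne
  have := (isOpen_interior (s := S)).measure_pos volume (nonempty_iff_ne_empty.2 hne)
  exact absurd (measure_mono_null interior_subset h) this.ne'

lemma isTotallyDisconnected_of_volume {S : Set ℝ} (h : volume S = 0) :
    IsTotallyDisconnected S := by
  intro t ht hpc x hx y hy
  by_contra hne
  wlog hlt : x < y generalizing x y
  · exact this hy hx (Ne.symm hne) (lt_of_le_of_ne (not_lt.1 hlt) (Ne.symm hne))
  have h1 : Icc x y ⊆ t := hpc.ordConnected.out hx hy
  obtain ⟨z, hz, hz'⟩ := (dense_compl_of_volume_eq_zero h).exists_mem_open isOpen_Ioo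
    (nonempty_Ioo.2 hlt)
  exact hz (ht (h1 (Ioo_subset_Icc_self hz')))

/-- Slopes in the interior of a phase-locked interval. -/
def lockedSlopes (s : ℝ) : Set ℝ := {a | ∃ r : ℚ, plateauLo s r < s * a ∧ s * a < plateauHi s r}

section
variable {s : ℝ} (hs : s ∈ Ioo (0 : ℝ) 1)

lemma isOpen_lockedSlopes : IsOpen (lockedSlopes s) := by
  have : lockedSlopes s = ⋃ r : ℚ, {a | plateauLo s r < s * a} ∩ {a | s * a < plateauHi s r} := by
    ext a; simp [lockedSlopes]
  rw [this]
  exact isOpen_iUnion fun r => (isOpen_lt (by fun_prop) (by fun_prop)).inter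
    (isOpen_lt (by fun_prop) (by fun_prop))

include hs

lemma plateauLo_strictMono : StrictMono (plateauLo s) := fun x _ h =>
  (plateauLo_le_plateauHi hs x).trans_lt (plateauHi_lt_plateauLo hs h)

lemma plateauHi_strictMono : StrictMono (plateauHi s) := fun _ y h =>
  (plateauHi_lt_plateauLo hs h).trans_le (plateauLo_le_plateauHi hs y)

lemma notMem_lockedSlopes {a ρ : ℝ} (h : s * a = plateauLo s ρ ∨ s * a = plateauHi s ρ) :
    a ∉ lockedSlopes s := by
  rintro ⟨r, h1, h2⟩
  have h3 : plateauLo s ρ ≤ s * a := by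
    rcases h with h | h
    · exact h.ge
    · exact (plateauLo_le_plateauHi hs ρ).trans h.ge
  have h4 : s * a ≤ plateauHi s ρ := by
    rcases h with h | h
    · exact h.le.trans (plateauLo_le_plateauHi hs ρ)
    · exact h.le
  rcases lt_trichotomy ρ r with hlt | rfl | hlt
  · linarith [plateauHi_lt_plateauLo hs hlt]
  · rcases h with h | h <;> linarith
  · linarith [plateauHi_lt_plateauLo hs hlt]

/-- A parameter in the interval of an irrational `ρ` is its only point, and a parameter in a
rational interval but outside the interior is one of the ends. -/
lemma singular_or_irrational {a : ℝ} (h : a ∉ lockedSlopes s) :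
    (∃ r : ℚ, s * a = plateauLo s r ∨ s * a = plateauHi s r) ∨
      ∃ ρ, Irrational ρ ∧ s * a = plateauLo s ρ := by
  obtain ⟨ρ, h1, h2⟩ := exists_mem_plateau hs (s * a)
  by_cases hρ : Irrational ρ
  · right
    exact ⟨ρ, hρ, le_antisymm (h2.trans (plateauLo_eq_plateauHi hρ).ge) h1⟩
  · left
    obtain ⟨r, rfl⟩ := not_not.1 hρ
    refine ⟨r, ?_⟩
    by_contra! hc
    exact h ⟨r, lt_of_le_of_ne h1 (Ne.symm hc.1), lt_of_le_of_ne h2 hc.2⟩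

/-- Exceptional slopes are lower or upper ends divided by `s`. Over each unit interval of `ρ` these
are sums whose `k`-th code increases by `k + 1`. -/
lemma dimH_compl_lockedSlopes : dimH (lockedSlopes s)ᶜ = 0 := by
  have hsub : (lockedSlopes s)ᶜ ⊆ ⋃ n : ℤ,
      ((fun x : ℝ => 0 + (1 - s) ^ 2 / s * ∑' k : ℕ, s ^ k * ((⌈(k + 1) * x⌉ : ℤ) : ℝ)) ''
        Icc (n : ℝ) (n + 1)) ∪
      ((fun x : ℝ => 0 + (1 - s) ^ 2 / s * ∑' k : ℕ, s ^ k * ((⌊(k + 1) * x⌋ + 1 : ℤ) : ℝ)) ''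
        Icc (n : ℝ) (n + 1)) := by
    intro a ha
    have hs0 := hs.1.ne'
    have hmem : ∀ ρ : ℝ, ρ ∈ Icc (⌊ρ⌋ : ℝ) (⌊ρ⌋ + 1) := fun ρ =>
      ⟨Int.floor_le ρ, (Int.lt_floor_add_one ρ).le⟩
    obtain ⟨ρ, h⟩ : ∃ ρ, s * a = plateauLo s ρ ∨ s * a = plateauHi s ρ := by
      rcases singular_or_irrational hs ha with ⟨r, h⟩ | ⟨ρ, -, h⟩
      · exact ⟨r, h⟩
      · exact ⟨ρ, Or.inl h⟩
    refine mem_iUnion.2 ⟨⌊ρ⌋, ?_⟩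
    rcases h with h | h
    · refine Or.inl ⟨ρ, hmem ρ, ?_⟩
      rw [plateauLo] at h
      simp only
      field_simp
      linarith
    · refine Or.inr ⟨ρ, hmem ρ, ?_⟩
      rw [plateauHi] at h
      simp only
      field_simp
      linarith
  refine le_antisymm ((dimH_mono hsub).trans ?_) bot_le
  rw [dimH_iUnion]
  refine iSup_le fun n => ?_
  have e : ∀ k : ℕ, ((k : ℝ) + 1) * ((n : ℝ) + 1) = ((k : ℝ) + 1) * n + ((k + 1 : ℤ) : ℝ) :=
    fun k => by push_cast; ring
  rw [dimH_union, max_le_iff]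
  constructor
  · refine (dimH_mono subset_closure).trans (dimH_closure_image_codes hs
      (a := fun k x => ⌈(k + 1) * x⌉) (fun k x y h => Int.ceil_mono (by gcongr)) (fun k => ?_)
      (summable_lo hs) _ _).le
    rw [e, Int.ceil_add_intCast]; omega
  · refine (dimH_mono subset_closure).trans (dimH_closure_image_codes hs
      (a := fun k x => ⌊(k + 1) * x⌋ + 1)
      (fun k x y h => add_le_add_left (Int.floor_mono (by gcongr)) 1) (fun k => ?_)
      (summable_hi hs) _ _).le
    rw [e, Int.floor_add_intCast]; omega

/-- Inversion is locally Lipschitz away from 0, so the chart at infinity adds to the dimension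
nothing but the single point 0. -/
lemma dirDimH_compl : dirDimH ((↑) '' lockedSlopes s : Set (OnePoint ℝ))ᶜ = 0 := by
  have e1 : {a : ℝ | (a : OnePoint ℝ) ∈ ((↑) '' lockedSlopes s : Set (OnePoint ℝ))ᶜ} =
      (lockedSlopes s)ᶜ := by
    ext a; simp
  have e2 : {u : ℝ | chartAtInfinity u ∈ ((↑) '' lockedSlopes s : Set (OnePoint ℝ))ᶜ} ⊆
      {0} ∪ (fun x : ℝ => x⁻¹) '' ((lockedSlopes s)ᶜ \ {0}) := by
    intro u hu
    by_cases h0 : u = 0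
    · exact Or.inl h0
    · right
      simp only [chartAtInfinity, h0, if_false, mem_ofPred_eq] at hu
      refine ⟨u⁻¹, ⟨fun h => hu ⟨_, h, rfl⟩, by simpa using h0⟩, inv_inv u⟩
  have h3 : dimH ((fun x : ℝ => x⁻¹) '' ((lockedSlopes s)ᶜ \ {0})) ≤ 0 := by
    refine (dimH_image_le_of_locally_lipschitzOn fun x hx => ?_).trans
      ((dimH_mono sdiff_subset).trans (dimH_compl_lockedSlopes hs).le)
    obtain ⟨K, t, ht, hK⟩ := (contDiffAt_inv ℝ (n := 1)
      (show x ≠ 0 from fun h => hx.2 h)).exists_lipschitzOnWith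
    exact ⟨K, t, nhdsWithin_le_nhds ht, hK⟩
  rw [dirDimH, e1, dimH_compl_lockedSlopes hs]
  refine le_antisymm (max_le le_rfl ((dimH_mono e2).trans ?_)) bot_le
  rw [dimH_union, dimH_countable (countable_singleton 0)]
  exact max_le le_rfl h3

lemma fullMeasure_lockedSlopes : FullMeasure ((↑) '' lockedSlopes s : Set (OnePoint ℝ)) := by
  have h := dirDimH_compl hs
  have h1 : dimH {a : ℝ | (a : OnePoint ℝ) ∈ ((↑) '' lockedSlopes s : Set (OnePoint ℝ))ᶜ} = 0 :=
    le_antisymm ((le_max_left _ _).trans h.le) bot_le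
  have h2 : dimH {u : ℝ | chartAtInfinity u ∈ ((↑) '' lockedSlopes s : Set (OnePoint ℝ))ᶜ} = 0 :=
    le_antisymm ((le_max_right _ _).trans h.le) bot_le
  exact ⟨volume_eq_zero_of_dimH h1, volume_eq_zero_of_dimH h2⟩

/-- A lower end is a limit of lower ends from the left, an upper end a limit of upper ends from the
right, and the slopes `n / s` tend to infinity. -/
lemma preperfect_compl : Preperfect ((↑) '' lockedSlopes s : Set (OnePoint ℝ))ᶜ := by
  have hmem : ∀ {a ρ : ℝ}, (s * a = plateauLo s ρ ∨ s * a = plateauHi s ρ) →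
      (a : OnePoint ℝ) ∈ ((↑) '' lockedSlopes s : Set (OnePoint ℝ))ᶜ := by
    rintro a ρ h ⟨b, hb, hba⟩
    rw [OnePoint.coe_eq_coe] at hba
    exact notMem_lockedSlopes hs h (hba ▸ hb)
  have hs0 := hs.1.ne'
  have hfin : ∀ (g : ℝ → ℝ) (l : Filter ℝ) [l.NeBot] (a : ℝ), Tendsto g l (𝓝 (s * a)) →
      (∀ᶠ ρ in l, g ρ ≠ s * a) → (∀ ρ, g ρ = plateauLo s ρ ∨ g ρ = plateauHi s ρ) →
      AccPt (a : OnePoint ℝ) (𝓟 ((↑) '' lockedSlopes s : Set (OnePoint ℝ))ᶜ) := by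
    intro g l _ a hg hne hpl
    rw [accPt_iff_frequently]
    have h1 : Tendsto (fun ρ => ((g ρ / s : ℝ) : OnePoint ℝ)) l (𝓝 (a : OnePoint ℝ)) := by
      refine (OnePoint.continuous_coe.tendsto a).comp ?_
      have := hg.div_const s
      rwa [mul_div_cancel_left₀ _ hs0] at this
    refine h1.frequently (Eventually.frequently ?_)
    filter_upwards [hne] with ρ hρ
    refine ⟨fun h => hρ ?_, hmem (ρ := ρ) ?_⟩
    · rw [OnePoint.coe_eq_coe] at h
      rw [← h, mul_div_cancel₀ _ hs0]
    · rw [mul_div_cancel₀ _ hs0]; exact hpl ρ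
  intro x hx
  induction x using OnePoint.rec with
  | infty =>
    rw [accPt_iff_frequently]
    have h1 : Tendsto (fun n : ℕ => (((n : ℝ) / s : ℝ) : OnePoint ℝ)) atTop
        (𝓝 (OnePoint.infty : OnePoint ℝ)) := by
      refine OnePoint.tendsto_coe_infty.comp ?_
      rw [coclosedCompact_eq_cocompact]
      exact (tendsto_natCast_atTop_atTop.atTop_div_const hs.1).mono_right atTop_le_cocompact
    refine h1.frequently (Eventually.frequently (Eventually.of_forall fun n => ?_))
    refine ⟨OnePoint.coe_ne_infty _, hmem (ρ := ((n : ℤ) : ℝ)) (Or.inl ?_)⟩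
    rw [plateauLo_int hs, mul_div_cancel₀ _ hs0]; simp
  | coe a =>
    have ha : a ∉ lockedSlopes s := fun h => hx ⟨a, h, rfl⟩
    obtain ⟨ρ, h⟩ : ∃ ρ, s * a = plateauLo s ρ ∨ s * a = plateauHi s ρ := by
      rcases singular_or_irrational hs ha with ⟨r, h⟩ | ⟨ρ, -, h⟩
      · exact ⟨r, h⟩
      · exact ⟨ρ, Or.inl h⟩
    rcases h with h | h
    · refine hfin (plateauLo s) (𝓝[<] ρ) a ?_ ?_ fun _ => Or.inl rfl
      · rw [h]; exact tendsto_plateauLo_left hs ρ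
      · filter_upwards [self_mem_nhdsWithin] with x hx
        rw [h]; exact (plateauLo_strictMono hs hx).ne
    · refine hfin (plateauHi s) (𝓝[>] ρ) a ?_ ?_ fun _ => Or.inr rfl
      · rw [h]; exact tendsto_plateauHi_right hs ρ
      · filter_upwards [self_mem_nhdsWithin] with x hx
        rw [h]; exact (plateauHi_strictMono hs hx).ne'

/-- Locked slopes are dense. An arc between two of them is open, and it meets the exceptional set in
the same points as its closure, so it separates a finite exceptional slope from any other. -/
lemma isTotallyDisconnected_compl :
    IsTotallyDisconnected ((↑) '' lockedSlopes s : Set (OnePoint ℝ))ᶜ := by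
  have hd : Dense (lockedSlopes s) := by
    have := dense_compl_of_volume_eq_zero (volume_eq_zero_of_dimH (dimH_compl_lockedSlopes hs))
    rwa [compl_compl] at this
  have key : ∀ t ⊆ ((↑) '' lockedSlopes s : Set (OnePoint ℝ))ᶜ, IsPreconnected t →
      ∀ a : ℝ, (a : OnePoint ℝ) ∈ t → ∀ y ∈ t, y = a := by
    intro t ht hpc a ha y hy
    by_contra hne
    obtain ⟨ε, hε, hy'⟩ : ∃ ε > 0, y ∉ ((↑) '' Ioo (a - ε) (a + ε) : Set (OnePoint ℝ)) := by
      induction y using OnePoint.rec with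
      | infty => exact ⟨1, one_pos, by simp⟩
      | coe b =>
        have hab : b ≠ a := fun h => hne (by rw [h])
        refine ⟨|b - a|, abs_pos.2 (sub_ne_zero.2 hab), ?_⟩
        rintro ⟨c, hc, hcb⟩
        rw [OnePoint.coe_eq_coe] at hcb
        subst hcb
        have := abs_lt.2 ⟨by linarith [hc.1] , show c - a < |c - a| by linarith [hc.2]⟩
        exact lt_irrefl _ this
    obtain ⟨u, hu, hu'⟩ := hd.exists_mem_open isOpen_Ioo (show (Ioo (a - ε) a).Nonempty from
      nonempty_Ioo.2 (by linarith))
    obtain ⟨v, hv, hv'⟩ := hd.exists_mem_open isOpen_Ioo (show (Ioo a (a + ε)).Nonempty from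
      nonempty_Ioo.2 (by linarith))
    obtain ⟨z, hzt, hz1, hz2⟩ := hpc ((↑) '' Ioo u v) ((↑) '' Icc u v)ᶜ
      (OnePoint.isOpenEmbedding_coe.isOpenMap _ isOpen_Ioo)
      (isCompact_Icc.image OnePoint.continuous_coe).isClosed.isOpen_compl
      (by
        intro z hz
        by_contra hc
        simp only [mem_union, mem_compl_iff, not_or, not_not] at hc
        obtain ⟨hc, w, hw, rfl⟩ := hc
        rcases hw.1.eq_or_lt with rfl | h1
        · exact ht hz ⟨_, hu, rfl⟩
        · rcases hw.2.eq_or_lt with rfl | h2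
          · exact ht hz ⟨_, hv, rfl⟩
          · exact hc ⟨w, ⟨h1, h2⟩, rfl⟩)
      ⟨a, ha, a, ⟨hu'.2, hv'.1⟩, rfl⟩
      ⟨y, hy, fun ⟨w, hw, hwy⟩ => hy' ⟨w, ⟨hu'.1.trans_le hw.1, hw.2.trans_lt hv'.2⟩, hwy⟩⟩
    exact hz2 (image_mono Ioo_subset_Icc_self hz1)
  intro t ht hpc x hx y hy
  induction x using OnePoint.rec with
  | infty =>
    induction y using OnePoint.rec with
    | infty => rfl
    | coe b => exact key t ht hpc b hy _ hx
  | coe a => exact (key t ht hpc a hx y hy).symm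

lemma isCantorSet_compl : IsCantorSet ((↑) '' lockedSlopes s : Set (OnePoint ℝ))ᶜ :=
  ⟨⟨OnePoint.infty, by simp⟩,
    (OnePoint.isOpenEmbedding_coe.isOpenMap _ isOpen_lockedSlopes).isClosed_compl.isCompact,
    preperfect_compl hs, isTotallyDisconnected_compl hs⟩

end


/-! ### The quotient -/

lemma mem_polygon {s x y : ℝ} : (x, y) ∈ polygon s ↔
    ((0 ≤ x ∧ x ≤ s) ∧ 0 ≤ y ∧ y ≤ 1) ∨ ((-s ≤ x ∧ x ≤ 0) ∧ s ≤ y ∧ y ≤ 1 + s) := Iff.rfl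

lemma mem_vertices {s x y : ℝ} : (x, y) ∈ vertices s ↔
    (x = 0 ∧ y = 0) ∨ (x = s ∧ y = 0) ∨ (x = s ∧ y = 1) ∨ (x = 0 ∧ y = 1) ∨ (x = 0 ∧ y = s) ∨
      (x = -s ∧ y = s) ∨ (x = -s ∧ y = 1 + s) ∨ (x = 0 ∧ y = 1 + s) := by
  simp [vertices]

open Classical in
/-- A normal form for points of the octagon modulo the side pairings. -/
noncomputable def normalForm (s : ℝ) (w : ℝ × ℝ) : ℝ × ℝ :=
  if w ∈ vertices s then (0, 0)
  else if w.1 = 0 ∧ w.2 < s then (s, w.2 / s)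
  else if w.1 = 0 ∧ 1 < w.2 then (-s, s + (w.2 - 1) / s)
  else if w.2 = 1 ∧ 0 < w.1 then (w.1, 0)
  else if w.2 = 1 + s ∧ w.1 < 0 then (w.1, s)
  else w

section
variable {s : ℝ} [hs : Fact (s ∈ Ioo (0 : ℝ) 1)]

lemma s_pos : 0 < s := hs.out.1

lemma s_lt_one : s < 1 := hs.out.2

lemma normalForm_vertex {w : ℝ × ℝ} (h : w ∈ vertices s) : normalForm s w = (0, 0) := by
  simp [normalForm, h]

lemma normalForm_left_low {y : ℝ} (h0 : 0 < y) (h1 : y < s) :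
    normalForm s (0, y) = (s, y / s) := by
  have h2 := s_pos (s := s)
  have h3 := s_lt_one (s := s)
  have : (0, y) ∉ vertices s := by rw [mem_vertices]; grind
  simp [normalForm, this, h1]

lemma normalForm_right_high {y : ℝ} (h0 : 1 < y) (h1 : y < 1 + s) :
    normalForm s (0, y) = (-s, s + (y - 1) / s) := by
  have h2 := s_pos (s := s)
  have h3 := s_lt_one (s := s)
  have : (0, y) ∉ vertices s := by rw [mem_vertices]; grind
  have h4 : ¬ y < s := by linarith
  simp [normalForm, this, h0, h4]

lemma normalForm_top_right {x : ℝ} (h0 : 0 < x) (h1 : x < s) :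
    normalForm s (x, 1) = (x, 0) := by
  have h2 := s_pos (s := s)
  have h3 := s_lt_one (s := s)
  have : (x, 1) ∉ vertices s := by rw [mem_vertices]; grind
  simp [normalForm, this, h0, h0.ne']

lemma normalForm_top_left {x : ℝ} (h0 : -s < x) (h1 : x < 0) :
    normalForm s (x, 1 + s) = (x, s) := by
  have h2 := s_pos (s := s)
  have h3 := s_lt_one (s := s)
  have : (x, 1 + s) ∉ vertices s := by rw [mem_vertices]; grind
  simp [normalForm, this, h1, h1.ne, h2.ne']

lemma normalForm_self {x y : ℝ} (h : (x, y) ∈ polygon s) (h1 : (x, y) ∉ vertices s)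
    (h2 : x = 0 → s < y ∧ y < 1) (h3 : 0 < x → y ≠ 1) (h4 : x < 0 → y ≠ 1 + s) :
    normalForm s (x, y) = (x, y) := by
  have := s_pos (s := s)
  have := s_lt_one (s := s)
  simp only [normalForm, h1, if_false]
  rw [mem_polygon] at h
  rw [mem_vertices] at h1
  rw [if_neg (by grind), if_neg (by grind), if_neg (by grind), if_neg (by grind)]

/-- Case distinction for the normal form. -/
lemma normalForm_cases {w : ℝ × ℝ} (h : w ∈ polygon s) :
    w ∈ vertices s ∨
    (w ∉ vertices s ∧ ∃ y, 0 < y ∧ y < 1 ∧ w = (0, s * y) ∧ normalForm s w = (s, y)) ∨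
    (w ∉ vertices s ∧ ∃ y, 0 < y ∧ y < 1 ∧ w = (0, 1 + s * y) ∧ normalForm s w = (-s, s + y)) ∨
    (w ∉ vertices s ∧ ∃ x, 0 < x ∧ x < s ∧ w = (x, 1) ∧ normalForm s w = (x, 0)) ∨
    (w ∉ vertices s ∧ ∃ x, -s < x ∧ x < 0 ∧ w = (x, 1 + s) ∧ normalForm s w = (x, s)) ∨
    (w ∉ vertices s ∧ normalForm s w = w ∧ (w.1 = 0 → s < w.2 ∧ w.2 < 1) ∧ (0 < w.1 → w.2 ≠ 1) ∧
      (w.1 < 0 → w.2 ≠ 1 + s)) := by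
  obtain ⟨x, y⟩ := w
  have p0 := s_pos (s := s)
  have p1 := s_lt_one (s := s)
  by_cases hv : (x, y) ∈ vertices s
  · exact Or.inl hv
  have hv' := hv
  have h' := h
  rw [mem_polygon] at h
  rw [mem_vertices] at hv
  by_cases c1 : x = 0 ∧ y < s
  · obtain ⟨rfl, c⟩ := c1
    have : 0 < y := by grind
    refine Or.inr (Or.inl ⟨hv', y / s, by positivity, (div_lt_one p0).2 c, ?_,
      normalForm_left_low this c⟩)
    rw [mul_div_cancel₀ _ p0.ne']
  by_cases c2 : x = 0 ∧ 1 < y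
  · obtain ⟨rfl, c⟩ := c2
    have : y < 1 + s := by grind
    refine Or.inr (Or.inr (Or.inl ⟨hv', (y - 1) / s, div_pos (by linarith) p0,
      (div_lt_one p0).2 (by linarith), ?_, normalForm_right_high c this⟩))
    rw [mul_div_cancel₀ _ p0.ne']; simp
  by_cases c3 : y = 1 ∧ 0 < x
  · obtain ⟨rfl, c⟩ := c3
    have : x < s := by grind
    exact Or.inr (Or.inr (Or.inr (Or.inl ⟨hv', x, c, this, rfl, normalForm_top_right c this⟩)))
  by_cases c4 : y = 1 + s ∧ x < 0
  · obtain ⟨rfl, c⟩ := c4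
    have : -s < x := by grind
    exact Or.inr (Or.inr (Or.inr (Or.inr (Or.inl
      ⟨hv', x, this, c, rfl, normalForm_top_left this c⟩))))
  have e1 : x = 0 → s < y ∧ y < 1 := by grind
  have e2 : 0 < x → y ≠ 1 := by grind
  have e3 : x < 0 → y ≠ 1 + s := by grind
  exact Or.inr (Or.inr (Or.inr (Or.inr (Or.inr ⟨hv', normalForm_self h' hv' e1 e2 e3, e1, e2, e3⟩))))

lemma normalForm_glue {p q : polygon s} (h : Glue s p q) :
    normalForm s p = normalForm s q := by
  have p0 := s_pos (s := s)
  have p1 := s_lt_one (s := s)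
  cases h with
  | edgeA y hy hp hq =>
    have hpp := p.2
    rw [hp] at hpp ⊢; rw [hq]
    rcases hy.1.eq_or_lt with rfl | h0
    · rw [normalForm_vertex (by rw [mem_vertices]; grind),
        normalForm_vertex (by rw [mem_vertices]; grind)]
    rcases hy.2.eq_or_lt with rfl | h1
    · rw [normalForm_vertex (by rw [mem_vertices]; grind),
        normalForm_vertex (by rw [mem_vertices]; grind)]
    rw [normalForm_left_low (by positivity) (by nlinarith), mul_div_cancel_left₀ _ p0.ne']
    exact normalForm_self hpp (by rw [mem_vertices]; grind) (by grind) (by grind) (by grind)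
  | edgeB x hx hp hq =>
    have hpp := p.2
    rw [hp] at hpp ⊢; rw [hq]
    rcases hx.1.eq_or_lt with rfl | h0
    · rw [normalForm_vertex (by rw [mem_vertices]; grind),
        normalForm_vertex (by rw [mem_vertices]; grind)]
    rcases hx.2.eq_or_lt with rfl | h1
    · rw [normalForm_vertex (by rw [mem_vertices]; grind),
        normalForm_vertex (by rw [mem_vertices]; grind)]
    rw [normalForm_top_right h0 h1]
    exact normalForm_self hpp (by rw [mem_vertices]; grind) (by grind) (by grind) (by grind)
  | edgeC y hy hp hq =>
    have hpp := p.2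
    rw [hp] at hpp ⊢; rw [hq]
    rcases hy.1.eq_or_lt with rfl | h0
    · rw [normalForm_vertex (by rw [mem_vertices]; grind),
        normalForm_vertex (by rw [mem_vertices]; grind)]
    rcases hy.2.eq_or_lt with rfl | h1
    · rw [normalForm_vertex (by rw [mem_vertices]; grind),
        normalForm_vertex (by rw [mem_vertices]; grind)]
    have := mul_pos p0 h0
    rw [normalForm_right_high (by linarith) (by nlinarith), add_sub_cancel_left,
      mul_div_cancel_left₀ _ p0.ne']
    exact normalForm_self hpp (by rw [mem_vertices]; grind) (by grind) (by grind) (by grind)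
  | edgeD x hx hp hq =>
    have hpp := p.2
    rw [hp] at hpp ⊢; rw [hq]
    rcases hx.1.eq_or_lt with rfl | h0
    · rw [normalForm_vertex (by rw [mem_vertices]; grind),
        normalForm_vertex (by rw [mem_vertices]; grind)]
    rcases hx.2.eq_or_lt with rfl | h1
    · rw [normalForm_vertex (by rw [mem_vertices]; grind),
        normalForm_vertex (by rw [mem_vertices]; grind)]
    rw [normalForm_top_left h0 h1]
    exact normalForm_self hpp (by rw [mem_vertices]; grind) (by grind) (by grind) (by grind)

lemma zero_mem_polygon : ((0 : ℝ), (0 : ℝ)) ∈ polygon s := by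
  have := s_pos (s := s); rw [mem_polygon]; grind

open Classical in
/-- The projection of the octagon to the surface, extended by a constant. -/
noncomputable def proj (s : ℝ) [Fact (s ∈ Ioo (0 : ℝ) 1)] (w : ℝ × ℝ) : Surface s :=
  if h : w ∈ polygon s then Quot.mk (Glue s) ⟨w, h⟩ else Quot.mk (Glue s) ⟨(0, 0), zero_mem_polygon⟩

lemma proj_of_mem {w : ℝ × ℝ} (h : w ∈ polygon s) : proj s w = Quot.mk (Glue s) ⟨w, h⟩ := dif_pos h

lemma rep_iff {w : ℝ × ℝ} {q : Surface s} : Rep s w q ↔ w ∈ polygon s ∧ proj s w = q := by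
  constructor
  · rintro ⟨h, rfl⟩; exact ⟨h, proj_of_mem h⟩
  · rintro ⟨h, rfl⟩; exact ⟨h, (proj_of_mem h).symm⟩

lemma exists_proj_eq (q : Surface s) : ∃ w ∈ polygon s, proj s w = q := by
  obtain ⟨⟨w, h⟩, rfl⟩ := Quot.exists_rep q
  exact ⟨w, h, proj_of_mem h⟩

lemma normalForm_eq_of_proj_eq {w w' : ℝ × ℝ} (h : w ∈ polygon s) (h' : w' ∈ polygon s)
    (he : proj s w = proj s w') : normalForm s w = normalForm s w' := by
  rw [proj_of_mem h, proj_of_mem h'] at he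
  exact congrArg (Quot.lift (fun p : polygon s => normalForm s p) fun _ _ => normalForm_glue) he

lemma proj_glue_A {y : ℝ} (h0 : 0 ≤ y) (h1 : y ≤ 1) : proj s (s, y) = proj s (0, s * y) := by
  have p0 := s_pos (s := s)
  have p1 := s_lt_one (s := s)
  have : 0 ≤ s * y := by positivity
  have : s * y ≤ s := by nlinarith
  rw [proj_of_mem (by rw [mem_polygon]; grind), proj_of_mem (by rw [mem_polygon]; grind)]
  exact Quot.sound (.edgeA _ _ y ⟨h0, h1⟩ rfl rfl)

lemma proj_glue_B {x : ℝ} (h0 : 0 ≤ x) (h1 : x ≤ s) : proj s (x, 0) = proj s (x, 1) := by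
  have p0 := s_pos (s := s)
  rw [proj_of_mem (by rw [mem_polygon]; grind), proj_of_mem (by rw [mem_polygon]; grind)]
  exact Quot.sound (.edgeB _ _ x ⟨h0, h1⟩ rfl rfl)

lemma proj_glue_C {y : ℝ} (h0 : 0 ≤ y) (h1 : y ≤ 1) :
    proj s (-s, s + y) = proj s (0, 1 + s * y) := by
  have p0 := s_pos (s := s)
  have p1 := s_lt_one (s := s)
  have : 0 ≤ s * y := by positivity
  have : s * y ≤ s := by nlinarith
  rw [proj_of_mem (by rw [mem_polygon]; grind), proj_of_mem (by rw [mem_polygon]; grind)]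
  exact Quot.sound (.edgeC _ _ y ⟨h0, h1⟩ rfl rfl)

lemma proj_glue_D {x : ℝ} (h0 : -s ≤ x) (h1 : x ≤ 0) : proj s (x, s) = proj s (x, 1 + s) := by
  have p0 := s_pos (s := s)
  rw [proj_of_mem (by rw [mem_polygon]; grind), proj_of_mem (by rw [mem_polygon]; grind)]
  exact Quot.sound (.edgeD _ _ x ⟨h0, h1⟩ rfl rfl)

lemma proj_vertex {w : ℝ × ℝ} (h : w ∈ vertices s) : proj s w = proj s (0, 0) := by
  have p0 := s_pos (s := s)
  have a0 := proj_glue_A (s := s) le_rfl zero_le_one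
  have a1 := proj_glue_A (s := s) zero_le_one le_rfl
  have b0 := proj_glue_B (s := s) le_rfl p0.le
  have b1 := proj_glue_B (s := s) p0.le le_rfl
  have c0 := proj_glue_C (s := s) le_rfl zero_le_one
  have c1 := proj_glue_C (s := s) zero_le_one le_rfl
  have d0 := proj_glue_D (s := s) le_rfl (by linarith)
  have d1 := proj_glue_D (s := s) (by linarith : -s ≤ 0) le_rfl
  simp only [mul_zero, mul_one, add_zero] at a0 a1 c0 c1
  rw [add_comm s 1] at c1
  obtain ⟨x, y⟩ := w
  rw [mem_vertices] at h
  rcases h with ⟨rfl, rfl⟩ | ⟨rfl, rfl⟩ | ⟨rfl, rfl⟩ | ⟨rfl, rfl⟩ | ⟨rfl, rfl⟩ | ⟨rfl, rfl⟩ |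
    ⟨rfl, rfl⟩ | ⟨rfl, rfl⟩
  · rfl
  · exact a0
  · rw [← b1, a0]
  · rw [b0]
  · rw [← a1, ← b1, a0]
  · rw [c0, b0]
  · rw [← d0, c0, b0]
  · rw [← c1, ← d0, c0, b0]

lemma proj_normalForm {w : ℝ × ℝ} (h : w ∈ polygon s) : proj s (normalForm s w) = proj s w := by
  have p0 := s_pos (s := s)
  rcases normalForm_cases h with hv | ⟨-, y, h0, h1, rfl, e⟩ | ⟨-, y, h0, h1, rfl, e⟩ |
    ⟨-, x, h0, h1, rfl, e⟩ | ⟨-, x, h0, h1, rfl, e⟩ | ⟨-, e, -⟩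
  · rw [normalForm_vertex hv, proj_vertex hv]
  · rw [e, proj_glue_A h0.le h1.le]
  · rw [e, proj_glue_C h0.le h1.le]
  · rw [e, proj_glue_B h0.le h1.le]
  · rw [e, proj_glue_D h0.le h1.le]
  · rw [e]

lemma proj_eq_iff {w w' : ℝ × ℝ} (h : w ∈ polygon s) (h' : w' ∈ polygon s) :
    proj s w = proj s w' ↔ normalForm s w = normalForm s w' :=
  ⟨normalForm_eq_of_proj_eq h h', fun e => by rw [← proj_normalForm h, e, proj_normalForm h']⟩

lemma normalForm_eq_zero {w : ℝ × ℝ} (h : w ∈ polygon s) (e : normalForm s w = (0, 0)) :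
    w ∈ vertices s := by
  have p0 := s_pos (s := s)
  rcases normalForm_cases h with hv | ⟨-, y, h0, h1, rfl, e'⟩ | ⟨-, y, h0, h1, rfl, e'⟩ |
    ⟨-, x, h0, h1, rfl, e'⟩ | ⟨-, x, h0, h1, rfl, e'⟩ | ⟨hv, e', -⟩
  · exact hv
  all_goals rw [e'] at e
  · simp at e; linarith
  · simp at e; linarith
  · simp at e; linarith
  · simp at e; linarith
  · rw [e] at hv; exact absurd (by rw [mem_vertices]; grind) hv

lemma singularSet_eq : singularSet s = {proj s (0, 0)} := by
  ext q
  constructor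
  · rintro ⟨v, hv, h⟩
    rw [rep_iff] at h
    rw [← h.2]; exact proj_vertex hv
  · rintro rfl
    refine ⟨(0, 0), by rw [mem_vertices]; grind, ?_⟩
    rw [rep_iff]; exact ⟨zero_mem_polygon, rfl⟩

lemma proj_mem_singularSet {w : ℝ × ℝ} (h : w ∈ polygon s) :
    proj s w ∈ singularSet s ↔ w ∈ vertices s := by
  rw [singularSet_eq, mem_singleton_iff, proj_eq_iff h zero_mem_polygon,
    normalForm_vertex (w := ((0 : ℝ), (0 : ℝ))) (by rw [mem_vertices]; grind)]
  exact ⟨normalForm_eq_zero h, normalForm_vertex⟩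

lemma glue_iff {p q : polygon s} : Glue s p q ↔
    ((p : ℝ × ℝ).1 = s ∧ (q : ℝ × ℝ).1 = 0 ∧ (q : ℝ × ℝ).2 = s * (p : ℝ × ℝ).2) ∨
    ((p : ℝ × ℝ).2 = 0 ∧ (q : ℝ × ℝ).2 = 1 ∧ (q : ℝ × ℝ).1 = (p : ℝ × ℝ).1) ∨
    ((p : ℝ × ℝ).1 = -s ∧ (q : ℝ × ℝ).1 = 0 ∧ (q : ℝ × ℝ).2 = 1 + s * ((p : ℝ × ℝ).2 - s)) ∨
    ((p : ℝ × ℝ).2 = s ∧ (q : ℝ × ℝ).2 = 1 + s ∧ (q : ℝ × ℝ).1 = (p : ℝ × ℝ).1) := by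
  have p0 := s_pos (s := s)
  have p1 := s_lt_one (s := s)
  obtain ⟨⟨x, y⟩, hp⟩ := p
  obtain ⟨⟨x', y'⟩, hq⟩ := q
  constructor
  · rintro (⟨y, hy, hp, hq⟩ | ⟨x, hx, hp, hq⟩ | ⟨y, hy, hp, hq⟩ |
      ⟨x, hx, hp, hq⟩)
    all_goals
      simp only [Prod.mk.injEq] at hp hq
      obtain ⟨rfl, rfl⟩ := hp
      obtain ⟨rfl, rfl⟩ := hq
      simp
  · have hp' := mem_polygon.1 hp
    have hq' := mem_polygon.1 hq
    simp only
    rintro (⟨rfl, rfl, rfl⟩ | ⟨rfl, rfl, rfl⟩ | ⟨rfl, rfl, rfl⟩ | ⟨rfl, rfl, rfl⟩)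
    · exact .edgeA _ _ y (by constructor <;> grind) rfl rfl
    · exact .edgeB _ _ x' (by constructor <;> grind) rfl rfl
    · exact .edgeC _ _ (y - s) (by constructor <;> grind) (by simp) rfl
    · exact .edgeD _ _ x' (by constructor <;> grind) rfl rfl

lemma isCompact_polygon : IsCompact (polygon s) :=
  (isCompact_Icc.prod isCompact_Icc).union (isCompact_Icc.prod isCompact_Icc)

instance : CompactSpace (polygon s) := isCompact_iff_compactSpace.1 isCompact_polygon

/-- Away from the vertices equivalent points are at most one gluing apart. This writes the
equivalence relation as a finite union of explicit closed sets. -/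
lemma glue_or_of_normalForm_eq {p q : polygon s} (h : normalForm s p = normalForm s q) :
    p = q ∨ Glue s p q ∨ Glue s q p ∨ ((p : ℝ × ℝ) ∈ vertices s ∧ (q : ℝ × ℝ) ∈ vertices s) := by
  have p0 := s_pos (s := s)
  have p1 := s_lt_one (s := s)
  by_cases hv : (p : ℝ × ℝ) ∈ vertices s
  · rw [normalForm_vertex hv] at h
    exact Or.inr (Or.inr (Or.inr ⟨hv, normalForm_eq_zero q.2 h.symm⟩))
  by_cases hv' : (q : ℝ × ℝ) ∈ vertices s
  · rw [normalForm_vertex hv'] at h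
    exact Or.inr (Or.inr (Or.inr ⟨normalForm_eq_zero p.2 h, hv'⟩))
  rw [glue_iff, glue_iff, Subtype.ext_iff]
  rcases normalForm_cases p.2 with c | ⟨-, y, h0, h1, hp, e⟩ | ⟨-, y, h0, h1, hp, e⟩ |
    ⟨-, x, h0, h1, hp, e⟩ | ⟨-, x, h0, h1, hp, e⟩ | ⟨-, e, -⟩ <;>
  rcases normalForm_cases q.2 with c' | ⟨-, y', h0', h1', hp', e'⟩ | ⟨-, y', h0', h1', hp', e'⟩ |
    ⟨-, x', h0', h1', hp', e'⟩ | ⟨-, x', h0', h1', hp', e'⟩ | ⟨-, e', -⟩ <;>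
  first
  | exact absurd c hv
  | exact absurd c' hv'
  | (rw [e, e'] at h
     first
     | (simp only [Prod.mk.injEq] at h; rw [hp, hp']; grind)
     | (rw [← h, hp]; simp)
     | (rw [h, hp']; simp)
     | exact Or.inl h)

lemma isClosed_rel : IsClosed {x : polygon s × polygon s | normalForm s x.1 = normalForm s x.2} := by
  have hfin : (vertices s).Finite := by unfold vertices; exact Set.toFinite _
  have hG : IsClosed {x : polygon s × polygon s | Glue s x.1 x.2} := by
    simp only [glue_iff]
    refine IsClosed.union ?_ (IsClosed.union ?_ (IsClosed.union ?_ ?_)) <;>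
    exact (isClosed_eq (by fun_prop) (by fun_prop)).inter
      ((isClosed_eq (by fun_prop) (by fun_prop)).inter (isClosed_eq (by fun_prop) (by fun_prop)))
  have hG' : IsClosed {x : polygon s × polygon s | Glue s x.2 x.1} :=
    hG.preimage (f := fun x : polygon s × polygon s => (x.2, x.1)) (by fun_prop)
  have hV : IsClosed {x : polygon s × polygon s |
      (x.1 : ℝ × ℝ) ∈ vertices s ∧ (x.2 : ℝ × ℝ) ∈ vertices s} :=
    (hfin.isClosed.preimage (f := fun x : polygon s × polygon s => (x.1 : ℝ × ℝ))
      (by fun_prop)).inter (hfin.isClosed.preimage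
        (f := fun x : polygon s × polygon s => (x.2 : ℝ × ℝ)) (by fun_prop))
  have hD : IsClosed {x : polygon s × polygon s | x.1 = x.2} := isClosed_eq (by fun_prop) (by fun_prop)
  convert hD.union (hG.union (hG'.union hV)) using 1
  ext x
  constructor
  · exact fun h => glue_or_of_normalForm_eq h
  · rintro (h | h | h | ⟨h, h'⟩)
    · exact congrArg (fun p : polygon s => normalForm s p) h
    · exact normalForm_glue h
    · exact (normalForm_glue h).symm
    · exact (normalForm_vertex h).trans (normalForm_vertex h').symm

lemma mk_eq_iff {p q : polygon s} :
    (Quot.mk (Glue s) p : Surface s) = Quot.mk (Glue s) q ↔ normalForm s p = normalForm s q := by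
  have := proj_eq_iff p.2 q.2
  rwa [proj_of_mem p.2, proj_of_mem q.2] at this

lemma continuous_mk : Continuous (fun p : polygon s => (Quot.mk (Glue s) p : Surface s)) :=
  continuous_quot_mk

/-- The saturation of a closed set is the projection of a closed, hence compact, part of the
equivalence relation. -/
lemma isClosedMap_mk : IsClosedMap (fun p : polygon s => (Quot.mk (Glue s) p : Surface s)) := by
  intro C hC
  rw [← isQuotientMap_quot_mk.isClosed_preimage]
  have : Quot.mk (Glue s) ⁻¹' ((fun p : polygon s => (Quot.mk (Glue s) p : Surface s)) '' C) =
      Prod.snd '' ({x : polygon s × polygon s | normalForm s x.1 = normalForm s x.2} ∩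
        (C ×ˢ univ)) := by
    ext p
    constructor
    · rintro ⟨c, hc, h⟩
      exact ⟨(c, p), ⟨mk_eq_iff.1 h, hc, mem_univ _⟩, rfl⟩
    · rintro ⟨⟨c, p'⟩, ⟨h, hc, -⟩, rfl⟩
      exact ⟨c, hc, mk_eq_iff.2 h⟩
  rw [this]
  exact ((isClosed_rel.inter (hC.prod isClosed_univ)).isCompact.image continuous_snd).isClosed

/-- Fibres are closed in the compact octagon, so normality separates them, and the closed quotient
map carries the separation down. -/
instance : T2Space (Surface s) := by
  refine ⟨fun q q' hne => ?_⟩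
  set π := fun p : polygon s => (Quot.mk (Glue s) p : Surface s)
  have hfib : ∀ q : Surface s, IsClosed (π ⁻¹' {q}) := fun q => by
    obtain ⟨p, rfl⟩ := Quot.exists_rep q
    have : π ⁻¹' {π p} = (fun p' : polygon s => (p', p)) ⁻¹'
        {x | normalForm s x.1 = normalForm s x.2} := by
      ext p'; exact mk_eq_iff
    exact this ▸ isClosed_rel.preimage (by fun_prop)
  have hd : Disjoint (π ⁻¹' {q}) (π ⁻¹' {q'}) :=
    Disjoint.preimage π (disjoint_singleton.2 hne)
  obtain ⟨U, V, hU, hV, hUq, hVq, hUV⟩ := normal_separation (hfib q) (hfib q') hd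
  refine ⟨(π '' Uᶜ)ᶜ, (π '' Vᶜ)ᶜ, (isClosedMap_mk _ hU.isClosed_compl).isOpen_compl,
    (isClosedMap_mk _ hV.isClosed_compl).isOpen_compl, ?_, ?_, ?_⟩
  · rintro ⟨p, hp, rfl⟩; exact hp (hUq rfl)
  · rintro ⟨p, hp, rfl⟩; exact hp (hVq rfl)
  · rw [Set.disjoint_left]
    intro r h1 h2
    obtain ⟨p, rfl⟩ := Quot.exists_rep r
    have h3 : p ∈ U := by_contra fun h => h1 ⟨p, h, rfl⟩
    have h4 : p ∈ V := by_contra fun h => h2 ⟨p, h, rfl⟩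
    exact Set.disjoint_left.1 hUV h3 h4

lemma continuousOn_proj : ContinuousOn (proj s) (polygon s) := by
  rw [continuousOn_iff_continuous_domRestrict]
  exact continuous_mk.congr fun p => (proj_of_mem p.2).symm

end


/-! ### The local parametrizations -/

section
variable {s : ℝ} [hs : Fact (s ∈ Ioo (0 : ℝ) 1)]

lemma mem_interior_polygon {x y : ℝ} : (x, y) ∈ interior (polygon s) ↔
    (-s < x ∧ x < s) ∧ (0 < y ∧ y < 1 + s) ∧ (x < 0 ∨ y < 1) ∧ (0 < x ∨ s < y) := by
  have p0 := s_pos (s := s)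
  have p1 := s_lt_one (s := s)
  constructor
  · intro h
    rw [mem_interior_iff_mem_nhds] at h
    -- The diagonal direction suffices as a test: along it, one way or the other, every boundary
    -- point leaves the octagon, including the two reentrant corners `(0, s)` and `(0, 1)`.
    have hc : ∀ σ : ℝ, ∃ ε > 0, (x + σ * ε, y + σ * ε) ∈ polygon s := fun σ => by
      have h1 : Tendsto (fun ε : ℝ => (x + σ * ε, y + σ * ε)) (𝓝[>] 0) (𝓝 (x, y)) := by
        have : Tendsto (fun ε : ℝ => (x + σ * ε, y + σ * ε)) (𝓝 0) (𝓝 (x + σ * 0, y + σ * 0)) :=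
          Continuous.tendsto (by fun_prop) 0
        simpa using this.mono_left nhdsWithin_le_nhds
      obtain ⟨ε, h2, h3⟩ := ((h1.eventually h).and self_mem_nhdsWithin).exists
      exact ⟨ε, h3, h2⟩
    obtain ⟨ε, hε, h1⟩ := hc 1
    obtain ⟨ε', hε', h2⟩ := hc (-1)
    have h3 := mem_polygon.1 (mem_of_mem_nhds h)
    rw [mem_polygon] at h1 h2
    simp only [one_mul, neg_mul] at h1 h2
    refine ⟨⟨?_, ?_⟩, ⟨?_, ?_⟩, ?_, ?_⟩
    · grind
    · grind
    · grind
    · grind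
    · by_contra! hcon; grind
    · by_contra! hcon; grind
  · intro h
    have ho : IsOpen {w : ℝ × ℝ | (-s < w.1 ∧ w.1 < s) ∧ (0 < w.2 ∧ w.2 < 1 + s) ∧
        (w.1 < 0 ∨ w.2 < 1) ∧ (0 < w.1 ∨ s < w.2)} := by
      have k1 : ∀ a : ℝ, IsOpen {w : ℝ × ℝ | a < w.1} := fun a =>
        isOpen_lt continuous_const continuous_fst
      have k2 : ∀ a : ℝ, IsOpen {w : ℝ × ℝ | w.1 < a} := fun a =>
        isOpen_lt continuous_fst continuous_const
      have k3 : ∀ a : ℝ, IsOpen {w : ℝ × ℝ | a < w.2} := fun a =>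
        isOpen_lt continuous_const continuous_snd
      have k4 : ∀ a : ℝ, IsOpen {w : ℝ × ℝ | w.2 < a} := fun a =>
        isOpen_lt continuous_snd continuous_const
      exact ((k1 _).inter (k2 _)).inter (((k3 _).inter (k4 _)).inter
        (((k2 _).union (k4 _)).inter ((k1 _).union (k3 _))))
    refine interior_maximal ?_ ho h
    rintro ⟨x, y⟩ h
    simp only [mem_ofPred_eq] at h
    rw [mem_polygon]
    grind

lemma mem_chartA {x y : ℝ} : (x, y) ∈ chartDomain s .A ↔
    (s / 2 < x ∧ x < s + 1 / 2) ∧ 0 < y ∧ y < 1 := Iff.rfl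

lemma mem_chartB {x y : ℝ} : (x, y) ∈ chartDomain s .B ↔
    (0 < x ∧ x < s) ∧ 1 / 2 < y ∧ y < 3 / 2 := Iff.rfl

lemma mem_chartC {x y : ℝ} : (x, y) ∈ chartDomain s .C ↔
    (-s - 1 / 2 < x ∧ x < -s / 2) ∧ s < y ∧ y < 1 + s := Iff.rfl

lemma mem_chartD {x y : ℝ} : (x, y) ∈ chartDomain s .D ↔
    (-s < x ∧ x < 0) ∧ s + 1 / 2 < y ∧ y < s + 3 / 2 := Iff.rfl

lemma mem_chartI {x y : ℝ} : (x, y) ∈ chartDomain s .interior ↔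
    (-s < x ∧ x < s) ∧ (0 < y ∧ y < 1 + s) ∧ (x < 0 ∨ y < 1) ∧ (0 < x ∨ s < y) :=
  mem_interior_polygon

lemma isOpen_chartDomain (c : ChartIndex) : IsOpen (chartDomain s c) := by
  cases c
  · exact isOpen_interior
  all_goals exact isOpen_Ioo.prod isOpen_Ioo

lemma normalForm_interior {x y : ℝ} (h : (x, y) ∈ interior (polygon s)) :
    normalForm s (x, y) = (x, y) := by
  have hm := interior_subset h
  rw [mem_interior_polygon] at h
  exact normalForm_self hm (by
    intro hv
    rw [mem_vertices] at hv
    rcases hv with h | h | h | h | h | h | h | h <;> grind) (by grind) (by grind) (by grind)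

/-- A point of a chart domain is either mapped to the interior of the octagon, and then the chart
is locally a homothety, or it lies on the seam of the chart. -/
lemma chart_dichotomy {c : ChartIndex} {z : ℝ × ℝ} (h : z ∈ chartDomain s c) :
    (chartFold s c z ∈ interior (polygon s) ∧ ∃ r > 0, ∀ᶠ w in 𝓝 z,
      chartFold s c w = chartFold s c z + (r : ℝ) • (w - z)) ∨
    (c = .A ∧ z.1 = s) ∨ (c = .B ∧ z.2 = 1) ∨ (c = .C ∧ z.1 = -s) ∨ (c = .D ∧ z.2 = 1 + s) := by
  have p0 := s_pos (s := s)
  have p1 := s_lt_one (s := s)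
  obtain ⟨x, y⟩ := z
  have hid : ∀ c', (∀ᶠ w in 𝓝 (x, y), chartFold s c' w = w) → ∃ r > 0, ∀ᶠ w in 𝓝 (x, y),
      chartFold s c' w = chartFold s c' (x, y) + (r : ℝ) • (w - (x, y)) := by
    intro c' h
    refine ⟨1, one_pos, ?_⟩
    filter_upwards [h] with w hw
    rw [hw, h.self_of_nhds]; simp
  have hlt1 : ∀ {a b : ℝ}, a < b → ∀ᶠ w : ℝ × ℝ in 𝓝 (a, y), w.1 < b := fun h =>
    (continuous_fst.tendsto _).eventually (Iio_mem_nhds h)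
  have hgt1 : ∀ {a b : ℝ}, b < a → ∀ᶠ w : ℝ × ℝ in 𝓝 (a, y), b < w.1 := fun h =>
    (continuous_fst.tendsto _).eventually (Ioi_mem_nhds h)
  have hlt2 : ∀ {a b : ℝ}, a < b → ∀ᶠ w : ℝ × ℝ in 𝓝 (x, a), w.2 < b := fun h =>
    (continuous_snd.tendsto _).eventually (Iio_mem_nhds h)
  have hgt2 : ∀ {a b : ℝ}, b < a → ∀ᶠ w : ℝ × ℝ in 𝓝 (x, a), b < w.2 := fun h =>
    (continuous_snd.tendsto _).eventually (Ioi_mem_nhds h)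
  cases c with
  | interior => exact Or.inl ⟨h, hid _ (Eventually.of_forall fun w => rfl)⟩
  | A =>
    rw [mem_chartA] at h
    rcases lt_trichotomy x s with hx | hx | hx
    · left
      refine ⟨?_, hid _ ?_⟩
      · simp only [chartFold, hx.le, if_true]
        rw [mem_interior_polygon]; grind
      · filter_upwards [hlt1 hx] with w hw
        simp [chartFold, hw.le]
    · exact Or.inr (Or.inl ⟨rfl, hx⟩)
    · left
      have hx' : ¬ x ≤ s := not_le.2 hx
      refine ⟨?_, s, p0, ?_⟩
      · simp only [chartFold, hx', if_false]
        rw [mem_interior_polygon]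
        have : 0 < s * (x - s) := mul_pos p0 (by linarith)
        have : s * (x - s) < s := by nlinarith
        have : 0 < s * y := mul_pos p0 h.2.1
        have : s * y < s := by nlinarith
        grind
      · filter_upwards [hgt1 hx] with w hw
        simp only [chartFold, hx', if_false, not_le.2 hw]
        ext <;> simp <;> ring
  | B =>
    rw [mem_chartB] at h
    rcases lt_trichotomy y 1 with hy | hy | hy
    · left
      refine ⟨?_, hid _ ?_⟩
      · simp only [chartFold, hy.le, if_true]
        rw [mem_interior_polygon]; grind
      · filter_upwards [hlt2 hy] with w hw
        simp [chartFold, hw.le]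
    · exact Or.inr (Or.inr (Or.inl ⟨rfl, hy⟩))
    · left
      have hy' : ¬ y ≤ 1 := not_le.2 hy
      refine ⟨?_, 1, one_pos, ?_⟩
      · simp only [chartFold, hy', if_false]
        rw [mem_interior_polygon]
        grind
      · filter_upwards [hgt2 hy] with w hw
        simp only [chartFold, hy', if_false, not_le.2 hw]
        ext <;> simp
  | C =>
    rw [mem_chartC] at h
    rcases lt_trichotomy x (-s) with hx | hx | hx
    · left
      have hx' : ¬ -s ≤ x := not_le.2 hx
      refine ⟨?_, s, p0, ?_⟩
      · simp only [chartFold, hx', if_false]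
        rw [mem_interior_polygon]
        have : s * (x + s) < 0 := mul_neg_of_pos_of_neg p0 (by linarith)
        have : -s < s * (x + s) := by nlinarith
        have : 0 < s * (y - s) := mul_pos p0 (by linarith)
        have : s * (y - s) < s := by nlinarith
        grind
      · filter_upwards [hlt1 hx] with w hw
        simp only [chartFold, hx', if_false, not_le.2 hw]
        ext <;> simp <;> ring
    · exact Or.inr (Or.inr (Or.inr (Or.inl ⟨rfl, hx⟩)))
    · left
      refine ⟨?_, hid _ ?_⟩
      · simp only [chartFold, hx.le, if_true]
        rw [mem_interior_polygon]; grind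
      · filter_upwards [hgt1 hx] with w hw
        simp [chartFold, hw.le]
  | D =>
    rw [mem_chartD] at h
    rcases lt_trichotomy y (1 + s) with hy | hy | hy
    · left
      refine ⟨?_, hid _ ?_⟩
      · simp only [chartFold, hy.le, if_true]
        rw [mem_interior_polygon]; grind
      · filter_upwards [hlt2 hy] with w hw
        simp [chartFold, hw.le]
    · exact Or.inr (Or.inr (Or.inr (Or.inr ⟨rfl, hy⟩)))
    · left
      have hy' : ¬ y ≤ 1 + s := not_le.2 hy
      refine ⟨?_, 1, one_pos, ?_⟩
      · simp only [chartFold, hy', if_false]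
        rw [mem_interior_polygon]
        grind
      · filter_upwards [hgt2 hy] with w hw
        simp only [chartFold, hy', if_false, not_le.2 hw]
        ext <;> simp

/-- On a seam the fold is the identity and the normal form is explicit; seam points of different
charts, or different ones of the same chart, therefore stay distinct in the surface. -/
lemma chart_seam {c : ChartIndex} {z : ℝ × ℝ} (h : z ∈ chartDomain s c)
    (hz : (c = .A ∧ z.1 = s) ∨ (c = .B ∧ z.2 = 1) ∨ (c = .C ∧ z.1 = -s) ∨
      (c = .D ∧ z.2 = 1 + s)) :
    chartFold s c z = z ∧ z ∈ polygon s ∧ z ∉ vertices s ∧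
    ((c = .A ∧ z.1 = s ∧ normalForm s z = z ∧ 0 < z.2 ∧ z.2 < 1) ∨
     (c = .B ∧ z.2 = 1 ∧ normalForm s z = (z.1, 0) ∧ 0 < z.1 ∧ z.1 < s) ∨
     (c = .C ∧ z.1 = -s ∧ normalForm s z = z ∧ s < z.2 ∧ z.2 < 1 + s) ∨
     (c = .D ∧ z.2 = 1 + s ∧ normalForm s z = (z.1, s) ∧ -s < z.1 ∧ z.1 < 0)) := by
  have p0 := s_pos (s := s)
  have p1 := s_lt_one (s := s)
  obtain ⟨x, y⟩ := z
  have key : (x, y) ∈ polygon s ∧ (x, y) ∉ vertices s := by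
    rw [mem_polygon, mem_vertices]
    rcases hz with ⟨rfl, hz⟩ | ⟨rfl, hz⟩ | ⟨rfl, hz⟩ | ⟨rfl, hz⟩ <;> simp only at hz <;> subst hz
    · rw [mem_chartA] at h; constructor <;> grind
    · rw [mem_chartB] at h; constructor <;> grind
    · rw [mem_chartC] at h; constructor <;> grind
    · rw [mem_chartD] at h; constructor <;> grind
  rcases hz with ⟨rfl, hz⟩ | ⟨rfl, hz⟩ | ⟨rfl, hz⟩ | ⟨rfl, hz⟩ <;> simp only at hz <;> subst hz
  · rw [mem_chartA] at h
    refine ⟨by simp [chartFold], key.1, key.2, Or.inl ⟨rfl, rfl, ?_, h.2⟩⟩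
    exact normalForm_self key.1 key.2 (by grind) (by grind) (by grind)
  · rw [mem_chartB] at h
    exact ⟨by simp [chartFold], key.1, key.2, Or.inr (Or.inl ⟨rfl, rfl,
      normalForm_top_right h.1.1 h.1.2, h.1⟩)⟩
  · rw [mem_chartC] at h
    refine ⟨by simp [chartFold], key.1, key.2, Or.inr (Or.inr (Or.inl ⟨rfl, rfl, ?_, h.2⟩))⟩
    exact normalForm_self key.1 key.2 (by grind) (by grind) (by grind)
  · rw [mem_chartD] at h
    exact ⟨by simp [chartFold], key.1, key.2, Or.inr (Or.inr (Or.inr ⟨rfl, rfl,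
      normalForm_top_left h.1.1 h.1.2, h.1⟩))⟩

lemma chartFold_mem {c : ChartIndex} {z : ℝ × ℝ} (h : z ∈ chartDomain s c) :
    chartFold s c z ∈ polygon s := by
  rcases chart_dichotomy h with ⟨h1, -⟩ | h1
  · exact interior_subset h1
  · obtain ⟨e, h2, -⟩ := chart_seam h h1
    rw [e]; exact h2

/-- The local parametrization with label `c`. -/
noncomputable def param (s : ℝ) [Fact (s ∈ Ioo (0 : ℝ) 1)] (c : ChartIndex) (z : ℝ × ℝ) :
    Surface s := proj s (chartFold s c z)

lemma notMem_vertices_of_interior {w : ℝ × ℝ} (h : w ∈ interior (polygon s)) :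
    w ∉ vertices s := by
  have p0 := s_pos (s := s)
  obtain ⟨x, y⟩ := w
  rw [mem_interior_polygon] at h
  intro hv
  rw [mem_vertices] at hv
  rcases hv with h | h | h | h | h | h | h | h <;> grind

lemma param_notMem {c : ChartIndex} {z : ℝ × ℝ} (h : z ∈ chartDomain s c) :
    param s c z ∉ singularSet s := by
  rw [param, proj_mem_singularSet (chartFold_mem h)]
  rcases chart_dichotomy h with ⟨h1, -⟩ | h1
  · exact notMem_vertices_of_interior h1
  · obtain ⟨e, -, h2, -⟩ := chart_seam h h1
    rw [e]; exact h2

lemma normalForm_of_mem_interior {w : ℝ × ℝ} (h : w ∈ interior (polygon s)) :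
    normalForm s w = w := normalForm_interior (x := w.1) (y := w.2) h

lemma normalForm_seam_notMem_interior {c : ChartIndex} {z : ℝ × ℝ} (h : z ∈ chartDomain s c)
    (hz : (c = .A ∧ z.1 = s) ∨ (c = .B ∧ z.2 = 1) ∨ (c = .C ∧ z.1 = -s) ∨
      (c = .D ∧ z.2 = 1 + s)) : normalForm s z ∉ interior (polygon s) := by
  have p0 := s_pos (s := s)
  have p1 := s_lt_one (s := s)
  obtain ⟨x, y⟩ := z
  obtain ⟨-, -, -, h1⟩ := chart_seam h hz
  rcases h1 with ⟨-, h1, e, h2⟩ | ⟨-, h1, e, h2⟩ | ⟨-, h1, e, h2⟩ | ⟨-, h1, e, h2⟩ <;>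
  · rw [e, mem_interior_polygon]; grind

/-- Transition maps are homotheties. -/
lemma param_transition {c c' : ChartIndex} {z z' : ℝ × ℝ} (h : z ∈ chartDomain s c)
    (h' : z' ∈ chartDomain s c') (hp : param s c z = param s c' z') :
    ∃ r > 0, ∀ᶠ w in 𝓝 z, z' + (r : ℝ) • (w - z) ∈ chartDomain s c' ∧
      param s c w = param s c' (z' + r • (w - z)) := by
  have p0 := s_pos (s := s)
  have p1 := s_lt_one (s := s)
  have hnf := normalForm_eq_of_proj_eq (chartFold_mem h) (chartFold_mem h') hp
  have hcont : ∀ r : ℝ, Tendsto (fun w => z' + r • (w - z)) (𝓝 z) (𝓝 z') := fun r => by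
    have : Tendsto (fun w => z' + r • (w - z)) (𝓝 z) (𝓝 (z' + r • (z - z))) :=
      Continuous.tendsto (by fun_prop) z
    simpa using this
  have hdom : ∀ r : ℝ, ∀ᶠ w in 𝓝 z, z' + r • (w - z) ∈ chartDomain s c' := fun r =>
    (hcont r).eventually ((isOpen_chartDomain c').mem_nhds h')
  rcases chart_dichotomy h with ⟨h1, r, hr, h2⟩ | h1
  · rcases chart_dichotomy h' with ⟨h1', r', hr', h2'⟩ | h1'
    · rw [normalForm_of_mem_interior h1, normalForm_of_mem_interior h1'] at hnf
      refine ⟨r / r', div_pos hr hr', ?_⟩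
      filter_upwards [hdom (r / r'), h2, (hcont (r / r')).eventually h2'] with w hw1 hw2 hw3
      refine ⟨hw1, ?_⟩
      rw [param, param, hw2, hw3, hnf, add_sub_cancel_left, smul_smul, mul_div_cancel₀ _ hr'.ne']
    · exfalso
      have hn := normalForm_seam_notMem_interior h' h1'
      rw [(chart_seam h' h1').1, normalForm_of_mem_interior h1] at hnf
      exact hn (hnf ▸ h1)
  · rcases chart_dichotomy h' with ⟨h1', r', hr', h2'⟩ | h1'
    · exfalso
      have hn := normalForm_seam_notMem_interior h h1
      rw [(chart_seam h h1).1, normalForm_of_mem_interior h1'] at hnf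
      exact hn (hnf ▸ h1')
    · have hcz : c = c' ∧ z = z' := by
        obtain ⟨ez, -, -, k⟩ := chart_seam h h1
        obtain ⟨ez', -, -, k'⟩ := chart_seam h' h1'
        rw [ez, ez'] at hnf
        obtain ⟨x, y⟩ := z
        obtain ⟨x', y'⟩ := z'
        clear ez ez' hdom hcont h1 h1' hp h h'
        rcases k with ⟨k0, h1, e, h2⟩ | ⟨k0, h1, e, h2⟩ | ⟨k0, h1, e, h2⟩ | ⟨k0, h1, e, h2⟩ <;>
        rcases k' with ⟨k0', h1', e', h2'⟩ | ⟨k0', h1', e', h2'⟩ | ⟨k0', h1', e', h2'⟩ |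
          ⟨k0', h1', e', h2'⟩ <;>
        · rw [e, e'] at hnf
          simp only [Prod.mk.injEq] at hnf h1 h1' h2 h2' ⊢
          grind
      obtain ⟨rfl, rfl⟩ := hcz
      refine ⟨1, one_pos, ?_⟩
      filter_upwards [(isOpen_chartDomain c).mem_nhds h] with w hw
      rw [one_smul, add_sub_cancel]
      exact ⟨hw, rfl⟩

lemma injOn_param (c : ChartIndex) : InjOn (param s c) (chartDomain s c) := by
  have p0 := s_pos (s := s)
  have p1 := s_lt_one (s := s)
  rintro ⟨x, y⟩ h ⟨x', y'⟩ h' e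
  have hnf := normalForm_eq_of_proj_eq (chartFold_mem h) (chartFold_mem h') e
  rcases chart_dichotomy h with ⟨h1, -⟩ | h1 <;> rcases chart_dichotomy h' with ⟨h1', -⟩ | h1'
  · rw [normalForm_of_mem_interior h1, normalForm_of_mem_interior h1'] at hnf
    cases c with
    | interior => exact hnf
    | A =>
      rw [mem_chartA] at h h'
      by_cases c1 : x ≤ s <;> by_cases c2 : x' ≤ s <;>
        simp only [chartFold, c1, c2, if_true, if_false, Prod.mk.injEq] at hnf ⊢
      · exact hnf
      · nlinarith
      · nlinarith
      · exact ⟨by nlinarith [mul_left_cancel₀ p0.ne' hnf.1], mul_left_cancel₀ p0.ne' hnf.2⟩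
    | B =>
      rw [mem_chartB] at h h'
      simp only [chartFold] at hnf
      grind
    | C =>
      rw [mem_chartC] at h h'
      by_cases c1 : -s ≤ x <;> by_cases c2 : -s ≤ x' <;>
        simp only [chartFold, c1, c2, if_true, if_false, Prod.mk.injEq] at hnf ⊢
      · exact hnf
      · nlinarith
      · nlinarith
      · exact ⟨by nlinarith [mul_left_cancel₀ p0.ne' hnf.1],
          by nlinarith [mul_left_cancel₀ p0.ne' (add_left_cancel hnf.2)]⟩
    | D =>
      rw [mem_chartD] at h h'
      simp only [chartFold] at hnf
      grind
  · exfalso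
    have hn := normalForm_seam_notMem_interior h' h1'
    rw [(chart_seam h' h1').1, normalForm_of_mem_interior h1] at hnf
    exact hn (hnf ▸ h1)
  · exfalso
    have hn := normalForm_seam_notMem_interior h h1
    rw [(chart_seam h h1).1, normalForm_of_mem_interior h1'] at hnf
    exact hn (hnf ▸ h1')
  · obtain ⟨ez, -, -, k⟩ := chart_seam h h1
    obtain ⟨ez', -, -, k'⟩ := chart_seam h' h1'
    rw [ez, ez'] at hnf
    clear ez ez' h1 h1' e h h'
    rcases k with ⟨k0, h1, e, h2⟩ | ⟨k0, h1, e, h2⟩ | ⟨k0, h1, e, h2⟩ | ⟨k0, h1, e, h2⟩ <;>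
    rcases k' with ⟨k0', h1', e', h2'⟩ | ⟨k0', h1', e', h2'⟩ | ⟨k0', h1', e', h2'⟩ |
      ⟨k0', h1', e', h2'⟩ <;>
    · rw [e, e'] at hnf
      simp only [Prod.mk.injEq] at hnf h1 h1' h2 h2' ⊢
      grind

end


/-! ### Continuation of trajectories -/

section
variable {s : ℝ} [hs : Fact (s ∈ Ioo (0 : ℝ) 1)]

/-- In the chart `c` the curve `τ` moves at time `t` through `z` with velocity `v • d`. -/
def LineGerm (s : ℝ) [Fact (s ∈ Ioo (0 : ℝ) 1)] (d : ℝ × ℝ) (τ : ℝ → Surface s) (t : ℝ)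
    (c : ChartIndex) (z : ℝ × ℝ) (v : ℝ) : Prop :=
  ∀ᶠ u in 𝓝 t, z + (v * (u - t)) • d ∈ chartDomain s c ∧ τ u = param s c (z + (v * (u - t)) • d)

lemma straightAt_iff {d : ℝ × ℝ} {τ : ℝ → Surface s} {t : ℝ} :
    StraightAt s d τ t ↔ ∃ c z v, 0 < v ∧ LineGerm s d τ t c z v := by
  unfold StraightAt LineGerm
  refine exists_congr fun c => exists_congr fun z => exists_congr fun v => and_congr_right fun _ =>
    eventually_congr (Eventually.of_forall fun u => and_congr_right fun h => ?_)
  rw [rep_iff]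
  exact ⟨fun k => k.2.symm, fun k => ⟨chartFold_mem h, k.symm⟩⟩

lemma LineGerm.self {d : ℝ × ℝ} {τ : ℝ → Surface s} {t : ℝ} {c : ChartIndex} {z : ℝ × ℝ} {v : ℝ}
    (h : LineGerm s d τ t c z v) : z ∈ chartDomain s c ∧ τ t = param s c z := by
  simpa using h.self_of_nhds

lemma tendsto_line (z d : ℝ × ℝ) (v t : ℝ) :
    Tendsto (fun u : ℝ => z + (v * (u - t)) • d) (𝓝 t) (𝓝 z) := by
  have : Tendsto (fun u : ℝ => z + (v * (u - t)) • d) (𝓝 t) (𝓝 (z + (v * (t - t)) • d)) :=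
    Continuous.tendsto (by fun_prop) t
  simpa using this

/-- Transition maps are direct homotheties, so changing charts only rescales the speed by a positive
factor. -/
lemma LineGerm.transfer {d : ℝ × ℝ} {τ : ℝ → Surface s} {t : ℝ} {c c' : ChartIndex}
    {z z' : ℝ × ℝ} {v : ℝ} (hv : 0 < v) (h : LineGerm s d τ t c z v) (hz' : z' ∈ chartDomain s c')
    (e : τ t = param s c' z') : ∃ v' > 0, LineGerm s d τ t c' z' v' := by
  obtain ⟨r, hr, h1⟩ := param_transition h.self.1 hz' (h.self.2.symm.trans e)
  refine ⟨r * v, mul_pos hr hv, ?_⟩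
  filter_upwards [h, (tendsto_line z d v t).eventually h1] with u hu1 hu2
  have : z' + r • (z + (v * (u - t)) • d - z) = z' + (r * v * (u - t)) • d := by
    rw [add_sub_cancel_left, smul_smul, mul_assoc]
  rw [this] at hu2
  exact ⟨hu2.1, hu1.2.trans hu2.2⟩

lemma StraightAt.lineGerm {d : ℝ × ℝ} {τ : ℝ → Surface s} {t : ℝ} (h : StraightAt s d τ t)
    {c : ChartIndex} {z : ℝ × ℝ} (hz : z ∈ chartDomain s c) (e : τ t = param s c z) :
    ∃ v > 0, LineGerm s d τ t c z v := by
  obtain ⟨c', z', v, hv, h'⟩ := straightAt_iff.1 h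
  exact h'.transfer hv hz e

lemma StraightAt.congr {d : ℝ × ℝ} {τ σ : ℝ → Surface s} {t : ℝ} (h : StraightAt s d τ t)
    (e : τ =ᶠ[𝓝 t] σ) : StraightAt s d σ t := by
  obtain ⟨c, z, v, hv, h'⟩ := h
  refine ⟨c, z, v, hv, ?_⟩
  filter_upwards [h', e] with u h1 h2
  rw [← h2]; exact h1

/-- The set of times at which the two germs agree is open, and it is relatively closed because two
lines through a common point that meet again have equal speeds. By continuity the agreement extends
to the endpoints. -/
lemma IsTrajectory.eqOn {d : ℝ × ℝ} (hd : d ≠ 0) {I J : Set ℝ} {τ σ : ℝ → Surface s}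
    (hτ : IsTrajectory s d I τ) (hσ : IsTrajectory s d J σ) {t₀ : ℝ} (h0 : t₀ ∈ interior I)
    (h0' : t₀ ∈ interior J) (e : τ =ᶠ[𝓝 t₀] σ) : EqOn τ σ (I ∩ J) := by
  have hoc : (I ∩ J).OrdConnected := hτ.interval.inter hσ.interval
  have hconv : Convex ℝ (I ∩ J) := hoc.convex
  have hint : interior (I ∩ J) = interior I ∩ interior J := interior_inter
  have key : interior (I ∩ J) ⊆ {t | τ =ᶠ[𝓝 t] σ} := by
    refine hconv.interior.isPreconnected.subset_of_closure_inter_subset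
      isOpen_setOfPred_eventually_nhds ⟨t₀, hint ▸ ⟨h0, h0'⟩, e⟩ ?_
    rintro t ⟨htc, ht⟩
    rw [hint] at ht
    by_contra hnot
    have c1 : ContinuousAt τ t := hτ.continuous.continuousAt (mem_interior_iff_mem_nhds.1 ht.1)
    have c2 : ContinuousAt σ t := hσ.continuous.continuousAt (mem_interior_iff_mem_nhds.1 ht.2)
    have hfr : ∃ᶠ u in 𝓝 t, u ∈ {t | τ =ᶠ[𝓝 t] σ} := mem_closure_iff_frequently.1 htc
    have heq : τ t = σ t := by
      by_contra hne
      have : ∀ᶠ u in 𝓝 t, τ u ≠ σ u :=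
        (c1.prodMk c2).eventually (isClosed_diagonal.isOpen_compl.mem_nhds
          (show (τ t, σ t) ∈ (diagonal (Surface s))ᶜ from hne))
      obtain ⟨u, hu, hu'⟩ := (hfr.and_eventually this).exists
      exact hu' (EventuallyEq.eq_of_nhds hu)
    obtain ⟨c, z, v, hv, h1⟩ := straightAt_iff.1 (hτ.straight t ht.1)
    obtain ⟨v', hv', h2⟩ := (hσ.straight t ht.2).lineGerm h1.self.1 (heq ▸ h1.self.2)
    -- In one chart both curves are lines through the same point with proportional velocities;
    -- agreement at a single nearby time `u ≠ t` equates their speeds.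
    obtain ⟨u, hu, h3, h4⟩ := (hfr.and_eventually (h1.and h2)).exists
    have hut : u ≠ t := fun h => hnot (h ▸ hu)
    have h5 := injOn_param c h3.1 h4.1 (h3.2.symm.trans ((EventuallyEq.eq_of_nhds hu).trans h4.2))
    have h6 := smul_left_injective ℝ hd (add_left_cancel h5)
    have h7 : v = v' := mul_right_cancel₀ (sub_ne_zero.2 hut) h6
    subst h7
    exact hnot (by filter_upwards [h1, h2] with w hw1 hw2; rw [hw1.2, hw2.2])
  refine EqOn.of_subset_closure (s := interior (I ∩ J))
    (fun t ht => EventuallyEq.eq_of_nhds (key ht))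
    (hτ.continuous.mono inter_subset_left) (hσ.continuous.mono inter_subset_right)
    interior_subset ?_
  rw [hconv.closure_interior_eq_closure_of_nonempty_interior ⟨t₀, hint ▸ ⟨h0, h0'⟩⟩]
  exact subset_closure

/-- Trajectories with the same germ at one time have a common extension. -/
lemma exists_glued_trajectory {d : ℝ × ℝ} (hd : d ≠ 0) {ι : Type*} [Nonempty ι] {J : ι → Set ℝ}
    {σ : ι → ℝ → Surface s} (hσ : ∀ i, IsTrajectory s d (J i) (σ i)) {t₀ : ℝ}
    (h0 : ∀ i, t₀ ∈ interior (J i)) (e : ∀ i j, σ i =ᶠ[𝓝 t₀] σ j) :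
    ∃ ρ, IsTrajectory s d (⋃ i, J i) ρ ∧ ∀ i, EqOn ρ (σ i) (J i) := by
  classical
  have agree : ∀ i j, EqOn (σ i) (σ j) (J i ∩ J j) := fun i j =>
    (hσ i).eqOn hd (hσ j) (h0 i) (h0 j) (e i j)
  have hex : ∀ t, ∃ i, t ∈ (⋃ i, J i) → t ∈ J i := fun t => by
    by_cases h : t ∈ ⋃ i, J i
    · obtain ⟨i, hi⟩ := mem_iUnion.1 h; exact ⟨i, fun _ => hi⟩
    · exact ⟨Classical.arbitrary ι, fun h' => absurd h' h⟩
  choose f hf using hex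
  have hρ : ∀ i, EqOn (fun t => σ (f t) t) (σ i) (J i) := fun i t ht =>
    agree (f t) i ⟨hf t (mem_iUnion_of_mem i ht), ht⟩
  have hoc : (⋃ i, J i).OrdConnected := by
    refine IsPreconnected.ordConnected ?_
    exact isPreconnected_iUnion ⟨t₀, mem_iInter.2 fun i => interior_subset (h0 i)⟩
      fun i => (hσ i).interval.isPreconnected
  -- Continuity and straightness of the union are local, so each time needs a single `J i` that is a
  -- neighbourhood within the union. The common time `t₀` makes the intervals reach out from one
  -- centre.
  have claim : ∀ t ∈ ⋃ i, J i, ∃ i, t ∈ J i ∧ J i ∈ 𝓝[⋃ i, J i] t := by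
    intro t ht
    obtain ⟨i, hi⟩ := mem_iUnion.1 ht
    have h0i : t₀ ∈ J i := interior_subset (h0 i)
    rcases lt_trichotomy t₀ t with h | rfl | h
    · by_cases hc : ∃ t' ∈ ⋃ i, J i, t < t'
      · obtain ⟨t', ht', hlt⟩ := hc
        obtain ⟨j, hj⟩ := mem_iUnion.1 ht'
        have hsub := (hσ j).interval.out (interior_subset (h0 j)) hj
        exact ⟨j, hsub ⟨h.le, hlt.le⟩, mem_nhdsWithin_of_mem_nhds
          (mem_of_superset (Icc_mem_nhds h hlt) hsub)⟩
      · push Not at hc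
        refine ⟨i, hi, ?_⟩
        filter_upwards [self_mem_nhdsWithin, mem_nhdsWithin_of_mem_nhds (Ioi_mem_nhds h)]
          with u hu hu'
        exact (hσ i).interval.out h0i hi ⟨hu'.le, hc u hu⟩
    · exact ⟨i, hi, mem_nhdsWithin_of_mem_nhds (mem_interior_iff_mem_nhds.1 (h0 i))⟩
    · by_cases hc : ∃ t' ∈ ⋃ i, J i, t' < t
      · obtain ⟨t', ht', hlt⟩ := hc
        obtain ⟨j, hj⟩ := mem_iUnion.1 ht'
        have hsub := (hσ j).interval.out hj (interior_subset (h0 j))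
        exact ⟨j, hsub ⟨hlt.le, h.le⟩, mem_nhdsWithin_of_mem_nhds
          (mem_of_superset (Icc_mem_nhds hlt h) hsub)⟩
      · push Not at hc
        refine ⟨i, hi, ?_⟩
        filter_upwards [self_mem_nhdsWithin, mem_nhdsWithin_of_mem_nhds (Iio_mem_nhds h)]
          with u hu hu'
        exact (hσ i).interval.out hi h0i ⟨hc u hu, hu'.le⟩
  have claim' : ∀ t ∈ interior (⋃ i, J i), ∃ i, t ∈ interior (J i) := by
    intro t ht
    obtain ⟨i, -, h⟩ := claim t (interior_subset ht)
    rw [nhdsWithin_eq_nhds.2 (mem_interior_iff_mem_nhds.1 ht)] at h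
    exact ⟨i, mem_interior_iff_mem_nhds.2 h⟩
  refine ⟨fun t => σ (f t) t, ⟨hoc, ⟨t₀, ?_⟩, ?_, ?_, ?_⟩, hρ⟩
  · exact interior_mono (subset_iUnion J (Classical.arbitrary ι)) (h0 _)
  · intro t ht
    obtain ⟨i, hi, h⟩ := claim t ht
    have h1 : ContinuousWithinAt (σ i) (⋃ i, J i) t :=
      ((hσ i).continuous t hi).mono_of_mem_nhdsWithin h
    exact h1.congr_of_eventuallyEq (mem_of_superset h (hρ i)) (hρ i hi)
  · intro t ht
    obtain ⟨i, hi⟩ := claim' t ht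
    have := (hσ i).regular t hi
    rwa [← hρ i (interior_subset hi)] at this
  · intro t ht
    obtain ⟨i, hi⟩ := claim' t ht
    exact ((hσ i).straight t hi).congr
      (mem_of_superset (mem_interior_iff_mem_nhds.1 hi) (hρ i).symm)

/-- A maximal trajectory extends every trajectory with the same germ. -/
lemma IsMaxTrajectory.extends {d : ℝ × ℝ} (hd : d ≠ 0) {I J : Set ℝ} {τ σ : ℝ → Surface s}
    (hτ : IsMaxTrajectory s d I τ) (hσ : IsTrajectory s d J σ) {t₀ : ℝ} (h0 : t₀ ∈ interior I)
    (h0' : t₀ ∈ interior J) (e : τ =ᶠ[𝓝 t₀] σ) : J ⊆ I ∧ EqOn τ σ J := by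
  obtain ⟨ρ, h1, h2⟩ := exists_glued_trajectory hd (ι := Bool) (J := fun b => cond b I J)
    (σ := fun b => cond b τ σ) (t₀ := t₀) (by rintro (_ | _); exacts [hσ, hτ.toIsTrajectory])
    (by rintro (_ | _); exacts [h0', h0])
    (by rintro (_ | _) (_ | _); exacts [EventuallyEq.rfl, e.symm, e, EventuallyEq.rfl])
  have h3 := hτ.maximal _ ρ h1 (subset_iUnion (fun b => cond b I J) true) (h2 true)
  have h4 : J ⊆ I := h3 ▸ subset_iUnion (fun b => cond b I J) false
  exact ⟨h4, fun t ht => (h2 true (h4 ht)).symm.trans (h2 false ht)⟩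

/-- Unique continuation makes all trajectories with the given germ compatible, so their union is
already the maximal one. -/
lemma IsTrajectory.exists_max {d : ℝ × ℝ} (hd : d ≠ 0) {J : Set ℝ} {σ : ℝ → Surface s}
    (hσ : IsTrajectory s d J σ) : ∃ I τ, IsMaxTrajectory s d I τ ∧ J ⊆ I ∧ EqOn τ σ J := by
  obtain ⟨t₀, h0⟩ := hσ.nondegenerate
  let ι := {p : Set ℝ × (ℝ → Surface s) //
    IsTrajectory s d p.1 p.2 ∧ t₀ ∈ interior p.1 ∧ p.2 =ᶠ[𝓝 t₀] σ}
  have : Nonempty ι := ⟨⟨(J, σ), hσ, h0, EventuallyEq.rfl⟩⟩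
  obtain ⟨ρ, h1, h2⟩ := exists_glued_trajectory hd (ι := ι) (J := fun i => i.1.1)
    (σ := fun i => i.1.2) (t₀ := t₀) (fun i => i.2.1) (fun i => i.2.2.1)
    (fun i j => i.2.2.2.trans j.2.2.2.symm)
  have hJ : J ⊆ ⋃ i : ι, i.1.1 :=
    subset_iUnion (fun i : ι => i.1.1) ⟨(J, σ), hσ, h0, EventuallyEq.rfl⟩
  have hE : EqOn ρ σ J := h2 ⟨(J, σ), hσ, h0, EventuallyEq.rfl⟩
  refine ⟨_, ρ, ⟨h1, ?_⟩, hJ, hE⟩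
  intro K φ hφ hK hφρ
  refine Subset.antisymm ?_ hK
  have hg : φ =ᶠ[𝓝 t₀] σ := mem_of_superset (mem_interior_iff_mem_nhds.1 h0)
    fun t ht => (hφρ (hJ ht)).trans (hE ht)
  exact subset_iUnion (fun i : ι => i.1.1)
    ⟨(K, φ), hφ, interior_mono (hJ.trans hK) h0, hg⟩

end


/-! ### The rotation of the surface by `π` -/

section
variable {s : ℝ} [hs : Fact (s ∈ Ioo (0 : ℝ) 1)]

/-- The rotation of the octagon about its centre. -/
def planeRot (s : ℝ) (w : ℝ × ℝ) : ℝ × ℝ := (-w.1, 1 + s - w.2)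

lemma planeRot_mem {w : ℝ × ℝ} (h : w ∈ polygon s) : planeRot s w ∈ polygon s := by
  obtain ⟨x, y⟩ := w
  rw [mem_polygon] at h
  rw [planeRot, mem_polygon]
  grind

lemma planeRot_planeRot (w : ℝ × ℝ) : planeRot s (planeRot s w) = w := by
  ext <;> simp [planeRot]

lemma continuous_planeRot : Continuous (planeRot s) := by
  unfold planeRot; fun_prop

/-- The rotation of the octagon induces an involution of the surface. -/
noncomputable def rot : Surface s → Surface s :=
  Quot.lift (fun p : polygon s => proj s (planeRot s p)) (by
    rintro p q h
    rcases h with ⟨y, hy, hp, hq⟩ | ⟨x, hx, hp, hq⟩ | ⟨y, hy, hp, hq⟩ | ⟨x, hx, hp, hq⟩ <;>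
    simp only [hp, hq, planeRot]
    · have := proj_glue_C (s := s) (y := 1 - y) (by linarith [hy.2]) (by linarith [hy.1])
      convert this using 2 <;> ext <;> simp <;> ring
    · have := proj_glue_D (s := s) (x := -x) (by linarith [hx.2]) (by linarith [hx.1])
      convert this.symm using 2 <;> ext <;> simp
    · have := proj_glue_A (s := s) (y := 1 - y) (by linarith [hy.2]) (by linarith [hy.1])
      convert this using 2 <;> ext <;> simp <;> ring
    · have := proj_glue_B (s := s) (x := -x) (by linarith [hx.2]) (by linarith [hx.1])
      convert this.symm using 2 <;> ext <;> simp)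

lemma rot_proj {w : ℝ × ℝ} (h : w ∈ polygon s) : rot (proj s w) = proj s (planeRot s w) := by
  rw [proj_of_mem h]; rfl

lemma rot_rot (q : Surface s) : rot (rot q) = q := by
  obtain ⟨w, hw, rfl⟩ := exists_proj_eq q
  rw [rot_proj hw, rot_proj (planeRot_mem hw), planeRot_planeRot]

lemma rot_injective : Function.Injective (rot (s := s)) :=
  Function.LeftInverse.injective rot_rot

lemma continuous_rot : Continuous (rot (s := s)) := by
  refine continuous_quot_lift _ ?_
  exact continuousOn_proj.comp_continuous (continuous_planeRot.comp continuous_subtype_val)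
    fun p => planeRot_mem p.2

/-- The rotation as a homeomorphism. -/
noncomputable def rotHomeo : Surface s ≃ₜ Surface s where
  toFun := rot
  invFun := rot
  left_inv := rot_rot
  right_inv := rot_rot
  continuous_toFun := continuous_rot
  continuous_invFun := continuous_rot

lemma image_rot_eq_preimage (A : Set (Surface s)) : rot '' A = rot ⁻¹' A :=
  congrFun (image_eq_preimage_of_inverse rot_rot rot_rot) A

lemma image_rot_image_rot (A : Set (Surface s)) : rot '' (rot '' A) = A := by
  rw [image_image]; simp [rot_rot]

lemma closure_image_rot (A : Set (Surface s)) : closure (rot '' A) = rot '' closure A :=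
  (rotHomeo.image_closure A).symm

lemma rot_mem_singularSet {q : Surface s} : rot q ∈ singularSet s ↔ q ∈ singularSet s := by
  have key : ∀ q : Surface s, q ∈ singularSet s → rot q ∈ singularSet s := by
    intro q h
    rw [singularSet_eq, mem_singleton_iff] at h
    have h0 : ((0 : ℝ), (0 : ℝ)) ∈ polygon s := zero_mem_polygon
    rw [h, rot_proj h0, proj_mem_singularSet (planeRot_mem h0), planeRot, mem_vertices]
    grind
  exact ⟨fun h => rot_rot q ▸ key _ h, key q⟩

lemma image_rot_singularSet : rot '' singularSet s = singularSet s := by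
  rw [image_rot_eq_preimage]; ext q; exact rot_mem_singularSet

/-- The rotation permutes the local parametrizations. -/
def rotIndex : ChartIndex → ChartIndex
  | .interior => .interior
  | .A => .C
  | .B => .D
  | .C => .A
  | .D => .B

/-- Twice the centre of the rotation that matches two local parametrizations. -/
def rotCentre (s : ℝ) : ChartIndex → ℝ × ℝ
  | .interior => (0, 1 + s)
  | .A => (0, 1 + s)
  | .B => (0, 2 + s)
  | .C => (0, 1 + s)
  | .D => (0, 2 + s)

lemma rot_param {c : ChartIndex} {z : ℝ × ℝ} (h : z ∈ chartDomain s c) :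
    rotCentre s c - z ∈ chartDomain s (rotIndex c) ∧
      rot (param s c z) = param s (rotIndex c) (rotCentre s c - z) := by
  have p0 := s_pos (s := s)
  have p1 := s_lt_one (s := s)
  have hm := chartFold_mem h
  obtain ⟨x, y⟩ := z
  rw [param, param, rot_proj hm]
  cases c with
  | interior =>
    rw [mem_chartI] at h
    simp only [rotIndex, rotCentre, Prod.mk_sub_mk, zero_sub]
    refine ⟨?_, rfl⟩
    rw [mem_chartI]; grind
  | A =>
    rw [mem_chartA] at h
    simp only [rotIndex, rotCentre, Prod.mk_sub_mk, zero_sub]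
    refine ⟨by rw [mem_chartC]; grind, ?_⟩
    simp only [chartFold, neg_le_neg_iff]
    split_ifs
    · rfl
    · congr 1; ext <;> simp [planeRot] <;> ring
  | B =>
    rw [mem_chartB] at h
    simp only [rotIndex, rotCentre, Prod.mk_sub_mk, zero_sub]
    refine ⟨by rw [mem_chartD]; grind, ?_⟩
    rcases lt_trichotomy y 1 with hy | rfl | hy
    · have h2 : ¬ 2 + s - y ≤ 1 + s := by linarith
      simp only [chartFold, hy.le, h2, if_true, if_false, planeRot]
      congr 2; ring
    · have h2 : 2 + s - 1 ≤ 1 + s := by linarith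
      simp only [chartFold, le_refl, h2, if_true, planeRot]
      convert proj_glue_D (s := s) (x := -x) (by linarith) (by linarith) using 3 <;> ring
    · have h2 : 2 + s - y ≤ 1 + s := by linarith
      simp only [chartFold, not_le.2 hy, h2, if_true, if_false, planeRot]
      congr 2; ring
  | C =>
    rw [mem_chartC] at h
    simp only [rotIndex, rotCentre, Prod.mk_sub_mk, zero_sub]
    refine ⟨by rw [mem_chartA]; grind, ?_⟩
    simp only [chartFold]
    by_cases hx : -s ≤ x
    · have h2 : -x ≤ s := by linarith
      simp only [hx, h2, if_true]; rfl
    · have h2 : ¬ -x ≤ s := by linarith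
      simp only [hx, h2, if_false]
      congr 1; ext <;> simp [planeRot] <;> ring
  | D =>
    rw [mem_chartD] at h
    simp only [rotIndex, rotCentre, Prod.mk_sub_mk, zero_sub]
    refine ⟨by rw [mem_chartB]; grind, ?_⟩
    rcases lt_trichotomy y (1 + s) with hy | rfl | hy
    · have h2 : ¬ 2 + s - y ≤ 1 := by linarith
      simp only [chartFold, hy.le, h2, if_true, if_false, planeRot]
      congr 2; ring
    · have h2 : 2 + s - (1 + s) ≤ 1 := by linarith
      simp only [chartFold, le_refl, h2, if_true, planeRot]
      convert proj_glue_B (s := s) (x := -x) (by linarith) (by linarith) using 3 <;> ring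
    · have h2 : 2 + s - y ≤ 1 := by linarith
      simp only [chartFold, not_le.2 hy, h2, if_true, if_false, planeRot]
      congr 2; ring

/-! ### Symmetries of trajectories -/

protected lemma StraightAt.rot {d : ℝ × ℝ} {τ : ℝ → Surface s} {t : ℝ} (h : StraightAt s d τ t) :
    StraightAt s (-d) (fun u => rot (τ u)) t := by
  obtain ⟨c, z, v, hv, h1⟩ := straightAt_iff.1 h
  refine straightAt_iff.2 ⟨rotIndex c, rotCentre s c - z, v, hv, ?_⟩
  filter_upwards [h1] with u hu
  have := rot_param hu.1
  rw [hu.2, show rotCentre s c - z + (v * (u - t)) • -d =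
    rotCentre s c - (z + (v * (u - t)) • d) by rw [smul_neg]; abel]
  exact this

protected lemma StraightAt.neg {d : ℝ × ℝ} {τ : ℝ → Surface s} {t : ℝ} (h : StraightAt s d τ t) :
    StraightAt s (-d) (fun u => τ (-u)) (-t) := by
  obtain ⟨c, z, v, hv, h1⟩ := h
  refine ⟨c, z, v, hv, ?_⟩
  have h2 : Tendsto (fun u : ℝ => -u) (𝓝 (-t)) (𝓝 t) := by
    simpa using (continuous_neg (G := ℝ)).tendsto (-t)
  filter_upwards [h2.eventually h1] with u hu
  rwa [show (v * (u - -t)) • -d = (v * (-u - t)) • d by rw [smul_neg, ← neg_smul]; ring_nf]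

protected lemma IsTrajectory.rot {d : ℝ × ℝ} {I : Set ℝ} {τ : ℝ → Surface s} (h : IsTrajectory s d I τ) :
    IsTrajectory s (-d) I (fun u => rot (τ u)) :=
  ⟨h.interval, h.nondegenerate, continuous_rot.comp_continuousOn h.continuous,
    fun t ht => fun h' => h.regular t ht (rot_mem_singularSet.1 h'),
    fun t ht => (h.straight t ht).rot⟩

lemma interior_neg_set (I : Set ℝ) : interior (-I) = -interior I := by
  have := (Homeomorph.neg ℝ).preimage_interior I
  simpa using this.symm

protected lemma IsTrajectory.neg {d : ℝ × ℝ} {I : Set ℝ} {τ : ℝ → Surface s} (h : IsTrajectory s d I τ) :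
    IsTrajectory s (-d) (-I) (fun u => τ (-u)) := by
  refine ⟨?_, ?_, ?_, ?_, ?_⟩
  · exact ⟨fun a ha b hb t ht => h.interval.out hb ha ⟨neg_le_neg ht.2, neg_le_neg ht.1⟩⟩
  · rw [interior_neg_set]; exact h.nondegenerate.neg
  · exact h.continuous.comp continuous_neg.continuousOn fun t ht => ht
  · intro t ht; rw [interior_neg_set] at ht; exact h.regular _ ht
  · intro t ht; rw [interior_neg_set] at ht
    have := (h.straight _ ht).neg
    rwa [neg_neg] at this

protected lemma IsMaxTrajectory.rot {d : ℝ × ℝ} {I : Set ℝ} {τ : ℝ → Surface s}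
    (h : IsMaxTrajectory s d I τ) : IsMaxTrajectory s (-d) I (fun u => rot (τ u)) := by
  refine ⟨h.toIsTrajectory.rot, fun J σ hσ hIJ he => ?_⟩
  have := hσ.rot
  rw [neg_neg] at this
  exact h.maximal J _ this hIJ fun t ht => by
    show rot (σ t) = τ t
    rw [he ht, rot_rot]

protected lemma IsMaxTrajectory.neg {d : ℝ × ℝ} {I : Set ℝ} {τ : ℝ → Surface s}
    (h : IsMaxTrajectory s d I τ) : IsMaxTrajectory s (-d) (-I) (fun u => τ (-u)) := by
  refine ⟨h.toIsTrajectory.neg, fun J σ hσ hIJ he => ?_⟩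
  have := hσ.neg
  rw [neg_neg] at this
  rw [← h.maximal (-J) _ this (fun t ht => hIJ (by simpa using ht)) (fun t ht => by
    have : -t ∈ -I := by simpa using ht
    simp [he this]), neg_neg]

/-- Rotation and time reversal together preserve the direction. -/
protected lemma IsMaxTrajectory.rotNeg {d : ℝ × ℝ} {I : Set ℝ} {τ : ℝ → Surface s}
    (h : IsMaxTrajectory s d I τ) : IsMaxTrajectory s d (-I) (fun u => rot (τ (-u))) := by
  simpa using h.neg.rot

protected lemma IsTrajectory.rotNeg {d : ℝ × ℝ} {I : Set ℝ} {τ : ℝ → Surface s}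
    (h : IsTrajectory s d I τ) : IsTrajectory s d (-I) (fun u => rot (τ (-u))) := by
  simpa using h.neg.rot

/-! ### Symmetries of attractors -/

protected lemma Attracts.rot {d : ℝ × ℝ} {U L : Set (Surface s)} (h : Attracts s d U L) :
    Attracts s (-d) (rot '' U) (rot '' L) := by
  intro V hV hLV I τ hτ h0 hU
  have hτ' := hτ.rot
  rw [neg_neg] at hτ'
  obtain ⟨t₀, ht₀, h1⟩ := h (rot ⁻¹' V) (hV.preimage continuous_rot) (by
    rw [closure_image_rot] at hLV; exact image_subset_iff.1 hLV) I _ hτ' h0 (by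
    rw [image_rot_eq_preimage] at hU; exact hU)
  exact ⟨t₀, ht₀, fun t ht htt => by have := h1 t ht htt; rwa [mem_preimage, rot_rot] at this⟩

protected lemma IsAttractor.rot {d : ℝ × ℝ} {L : Set (Surface s)} (h : IsAttractor s d L) :
    IsAttractor s (-d) (rot '' L) := by
  have hcl : ∀ A : Set (Surface s), closure (rot '' A) \ singularSet s =
      rot '' (closure A \ singularSet s) := fun A => by
    rw [closure_image_rot, image_sdiff rot_injective, image_rot_singularSet]
  refine ⟨?_, ?_, ?_, ?_, ?_⟩
  · rw [← image_rot_singularSet]; exact (disjoint_image_iff rot_injective).2 h.regular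
  · rw [hcl, h.closed]
  · intro I τ hτ h0 hL t ht h0t
    have hτ' := hτ.rot
    rw [neg_neg] at hτ'
    rw [image_rot_eq_preimage] at hL
    have := h.invariant I _ hτ' h0 hL t ht h0t
    rcases this with h1 | h1
    · left; rw [image_rot_eq_preimage]; exact h1
    · right; exact rot_mem_singularSet.1 h1
  · obtain ⟨U, h1, h2, h3⟩ := h.attracts
    exact ⟨_, rotHomeo.isOpenMap U h1, image_mono h2, h3.rot⟩
  · obtain ⟨I, τ, hτ, h0, h1, h2⟩ := h.generated
    refine ⟨I, _, hτ.rot, h0, h1, ?_⟩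
    rw [show (fun u => rot (τ u)) '' (I ∩ Ici 0) =
      rot '' (τ '' (I ∩ Ici 0)) from (image_image _ _ _).symm, hcl, ← h2]

lemma image_rot_basin_subset (d : ℝ × ℝ) (L : Set (Surface s)) :
    rot '' basin s d L ⊆ basin s (-d) (rot '' L) := by
  rintro _ ⟨q, ⟨U, ⟨h1, h2, h3⟩, hq⟩, rfl⟩
  exact ⟨_, ⟨rotHomeo.isOpenMap U h1, image_mono h2, h3.rot⟩, mem_image_of_mem _ hq⟩

lemma dense_image_rot {A : Set (Surface s)} (h : Dense A) : Dense (rot '' A) := by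
  rw [dense_iff_closure_eq, closure_image_rot, h.closure_eq, image_univ,
    (Function.RightInverse.surjective rot_rot).range_eq]

end


/-! ### The cylinder `R⁺` -/

section
variable {s : ℝ} [hs : Fact (s ∈ Ioo (0 : ℝ) 1)]

/-- The map from a strip onto the image of `R⁺` in the surface: the second coordinate is taken
modulo `1`. -/
noncomputable def cyl (s : ℝ) [Fact (s ∈ Ioo (0 : ℝ) 1)] (x y : ℝ) : Surface s :=
  proj s (max 0 (min x s), Int.fract y)

/-- Continuity across integer heights is exactly the gluing `B`. -/
lemma continuous_cyl : Continuous fun p : ℝ × ℝ => cyl s p.1 p.2 := by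
  have p0 := s_pos (s := s)
  have p1 := s_lt_one (s := s)
  have hx : ∀ x : ℝ, 0 ≤ max 0 (min x s) ∧ max 0 (min x s) ≤ s := fun x =>
    ⟨le_max_left _ _, max_le p0.le (min_le_right _ _)⟩
  refine ContinuousOn.comp_fract (f := fun (p : ℝ × ℝ) y => proj s (max 0 (min p.1 s), y))
    (s := fun p : ℝ × ℝ => p.2) ?_ continuous_snd ?_
  · refine continuousOn_proj.comp (Continuous.continuousOn (by fun_prop)) ?_
    rintro ⟨⟨x, y'⟩, y⟩ ⟨-, hy⟩
    simp only [mem_polygon]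
    exact Or.inl ⟨hx x, hy⟩
  · rintro ⟨x, -⟩
    exact proj_glue_B (hx x).1 (hx x).2

lemma cyl_add_int (x y : ℝ) (n : ℤ) : cyl s x (y + n) = cyl s x y := by
  rw [cyl, cyl, Int.fract_add_intCast]

lemma clamp_eq {x : ℝ} (hx : x ∈ Icc 0 s) : max 0 (min x s) = x := by
  rw [min_eq_left hx.2, max_eq_right hx.1]

lemma mem_polygon_right {x y : ℝ} (hx : x ∈ Icc 0 s) (hy : y ∈ Icc (0 : ℝ) 1) :
    (x, y) ∈ polygon s := Or.inl ⟨hx, hy⟩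

lemma cyl_eq {x y : ℝ} (hx : x ∈ Icc 0 s) (hy : y ∈ Icc (0 : ℝ) 1) : cyl s x y = proj s (x, y) := by
  rw [cyl, clamp_eq hx]
  rcases hy.2.lt_or_eq with h | rfl
  · rw [Int.fract_eq_self.2 ⟨hy.1, h⟩]
  · rw [Int.fract_one, proj_glue_B hx.1 hx.2]

lemma cyl_eq_fract {x : ℝ} (hx : x ∈ Icc 0 s) (y : ℝ) : cyl s x y = proj s (x, Int.fract y) := by
  rw [cyl, clamp_eq hx]

/-- The right side of `R⁺` is glued to the lower part of its left side. -/
lemma cyl_right (y : ℝ) : cyl s s y = cyl s 0 (s * Int.fract y) := by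
  have p0 := s_pos (s := s)
  have p1 := s_lt_one (s := s)
  have h0 := Int.fract_nonneg y
  have h1 := (Int.fract_lt_one y).le
  rw [cyl_eq_fract ⟨p0.le, le_rfl⟩, proj_glue_A h0 h1, cyl_eq ⟨le_rfl, p0.le⟩]
  exact ⟨by positivity, by nlinarith⟩

lemma cyl_mem_singularSet {x : ℝ} (hx : x ∈ Icc 0 s) (y : ℝ) :
    cyl s x y ∈ singularSet s ↔
      (x = 0 ∧ Int.fract y = 0) ∨ (x = 0 ∧ Int.fract y = s) ∨ (x = s ∧ Int.fract y = 0) := by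
  have p0 := s_pos (s := s)
  have p1 := s_lt_one (s := s)
  have h0 := Int.fract_nonneg y
  have h1 := Int.fract_lt_one y
  rw [cyl_eq_fract hx, proj_mem_singularSet (mem_polygon_right hx ⟨h0, h1.le⟩), mem_vertices]
  obtain ⟨hx0, hx1⟩ := hx
  grind

lemma cyl_notMem_singularSet {x : ℝ} (hx : x ∈ Ioo 0 s) (y : ℝ) : cyl s x y ∉ singularSet s := by
  rw [cyl_mem_singularSet ⟨hx.1.le, hx.2.le⟩]
  rintro (⟨h, -⟩ | ⟨h, -⟩ | ⟨h, -⟩)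
  exacts [hx.1.ne' h, hx.1.ne' h, hx.2.ne h]

/-- Over the open strip the coordinates `(x, y)` are chart coordinates up to a translation: chart
`B` is used at integer heights and the interior chart elsewhere. -/
lemma exists_chart_cyl {x : ℝ} (hx : x ∈ Ioo 0 s) (y : ℝ) : ∃ c w, w ∈ chartDomain s c ∧
    ∀ᶠ p in 𝓝 (0 : ℝ × ℝ), cyl s (x + p.1) (y + p.2) = param s c (w + p) := by
  have p0 := s_pos (s := s)
  have p1 := s_lt_one (s := s)
  have h0 := Int.fract_nonneg y
  have h1 := Int.fract_lt_one y
  have hper : ∀ x' u : ℝ, cyl s x' (y + u) = cyl s x' (Int.fract y + u) := fun x' u => by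
    conv_lhs => rw [← Int.fract_add_floor y, add_right_comm, cyl_add_int]
  have e1 : ∀ {a : ℝ}, 0 < a → ∀ᶠ p : ℝ × ℝ in 𝓝 0, -a < p.1 ∧ p.1 < a := fun ha =>
    (continuous_fst.tendsto _).eventually (Ioo_mem_nhds (by simpa using ha) (by simpa using ha))
  have e2 : ∀ {a : ℝ}, 0 < a → ∀ᶠ p : ℝ × ℝ in 𝓝 0, -a < p.2 ∧ p.2 < a := fun ha =>
    (continuous_snd.tendsto _).eventually (Ioo_mem_nhds (by simpa using ha) (by simpa using ha))
  obtain ⟨hx0, hx1⟩ := hx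
  rcases h0.eq_or_lt with h | h
  · refine ⟨.B, (x, 1), by rw [mem_chartB]; grind, ?_⟩
    filter_upwards [e1 hx0, e1 (sub_pos.2 hx1), e2 (show (0 : ℝ) < 1 / 2 by norm_num)]
      with p k1 k2 k3
    have hxp : x + p.1 ∈ Icc 0 s := ⟨by linarith, by linarith⟩
    rw [hper, ← h, zero_add, param]
    simp only [chartFold, Prod.fst_add, Prod.snd_add]
    split_ifs with hp
    · rw [show ((x, 1) : ℝ × ℝ) + p = (x + p.1, 1 + p.2) from rfl, ← cyl_eq hxp ⟨by linarith, hp⟩]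
      have := cyl_add_int (s := s) (x + p.1) p.2 1
      rw [← this]; congr 1; push_cast; ring
    · rw [cyl_eq hxp ⟨by linarith, by linarith⟩]
      congr 2; simp
  · refine ⟨.interior, (x, Int.fract y), by rw [mem_chartI]; grind, ?_⟩
    filter_upwards [e1 hx0, e1 (sub_pos.2 hx1), e2 h, e2 (sub_pos.2 h1)] with p k1 k2 k3 k4
    rw [hper, cyl_eq ⟨by linarith, by linarith⟩ ⟨by linarith, by linarith⟩]
    rfl

/-- The straight line of slope `m` on the cylinder that starts at height `z`, run through with
speed `v` from time `a` on. -/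
noncomputable def segment (s : ℝ) [Fact (s ∈ Ioo (0 : ℝ) 1)] (m a v z t : ℝ) : Surface s :=
  cyl s (v * (t - a)) (z + m * (v * (t - a)))

lemma continuous_segment (m a v z : ℝ) : Continuous (segment s m a v z) :=
  continuous_cyl.comp (f := fun t : ℝ => (v * (t - a), z + m * (v * (t - a)))) (by fun_prop)

lemma segment_fract (m a v z t : ℝ) : segment s m a v (Int.fract z) t = segment s m a v z t := by
  unfold segment
  conv_rhs => rw [← Int.fract_add_floor z, add_right_comm, cyl_add_int]

lemma mul_sub_mem_Icc {a v t : ℝ} (hv : 0 < v) (ht : t ∈ Icc a (a + s / v)) :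
    v * (t - a) ∈ Icc 0 s := by
  refine ⟨mul_nonneg hv.le (by linarith [ht.1]), ?_⟩
  have : t - a ≤ s / v := by linarith [ht.2]
  rw [le_div_iff₀ hv] at this; linarith

lemma mul_sub_mem_Ioo {a v t : ℝ} (hv : 0 < v) (ht : t ∈ Ioo a (a + s / v)) :
    v * (t - a) ∈ Ioo 0 s := by
  refine ⟨mul_pos hv (by linarith [ht.1]), ?_⟩
  have : t - a < s / v := by linarith [ht.2]
  rw [lt_div_iff₀ hv] at this; linarith

lemma lt_add_div (s : ℝ) [Fact (s ∈ Ioo (0 : ℝ) 1)] (a : ℝ) {v : ℝ} (hv : 0 < v) :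
    a < a + s / v := by
  have := div_pos (s_pos (s := s)) hv
  linarith

lemma straightAt_segment {m a v z t : ℝ} (hv : 0 < v) (ht : t ∈ Ioo a (a + s / v)) :
    StraightAt s (1, m) (segment s m a v z) t := by
  obtain ⟨c, w, hw, h⟩ := exists_chart_cyl (mul_sub_mem_Ioo hv ht) (z + m * (v * (t - a)))
  refine straightAt_iff.2 ⟨c, w, v, hv, ?_⟩
  filter_upwards [(tendsto_line w (1, m) v t).eventually ((isOpen_chartDomain c).mem_nhds hw),
    (tendsto_line 0 (1, m) v t).eventually h] with u h1 h2
  refine ⟨h1, ?_⟩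
  rw [zero_add] at h2
  rw [← h2, segment]
  simp only [Prod.smul_mk, smul_eq_mul]
  congr 1 <;> ring

lemma segment_notMem {m a v z t : ℝ} (hv : 0 < v) (ht : t ∈ Ioo a (a + s / v)) :
    segment s m a v z t ∉ singularSet s := cyl_notMem_singularSet (mul_sub_mem_Ioo hv ht) _

lemma isTrajectory_segment (m a z : ℝ) {v : ℝ} (hv : 0 < v) :
    IsTrajectory s (1, m) (Icc a (a + s / v)) (segment s m a v z) := by
  refine ⟨ordConnected_Icc, ?_, (continuous_segment m a v z).continuousOn, ?_, ?_⟩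
  · rw [interior_Icc]; exact nonempty_Ioo.2 (lt_add_div s a hv)
  · intro t ht; rw [interior_Icc] at ht; exact segment_notMem hv ht
  · intro t ht; rw [interior_Icc] at ht; exact straightAt_segment hv ht

/-- A junction is straight if one chart shows both pieces as the same line run through with the same
speed. -/
lemma isTrajectory_concat {d : ℝ × ℝ} {a b c : ℝ} {σ₁ σ₂ : ℝ → Surface s} (hab : a < b) (hbc : b < c)
    (c1 : Continuous σ₁) (c2 : Continuous σ₂) (r1 : ∀ t ∈ Ioo a b, σ₁ t ∉ singularSet s)
    (r2 : ∀ t ∈ Ioo b c, σ₂ t ∉ singularSet s) (l1 : ∀ t ∈ Ioo a b, StraightAt s d σ₁ t)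
    (l2 : ∀ t ∈ Ioo b c, StraightAt s d σ₂ t) (heq : σ₁ b = σ₂ b)
    {i : ChartIndex} {w : ℝ × ℝ} {v : ℝ} (hv : 0 < v) (hw : w ∈ chartDomain s i)
    (h1 : ∀ᶠ u in 𝓝 b, u ≤ b → σ₁ u = param s i (w + (v * (u - b)) • d))
    (h2 : ∀ᶠ u in 𝓝 b, b < u → σ₂ u = param s i (w + (v * (u - b)) • d)) :
    IsTrajectory s d (Icc a c) (fun t => if t ≤ b then σ₁ t else σ₂ t) := by
  have hl : ∀ t < b, σ₁ =ᶠ[𝓝 t] fun t => if t ≤ b then σ₁ t else σ₂ t := fun t ht => by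
    filter_upwards [Iio_mem_nhds ht] with u hu
    rw [if_pos (le_of_lt hu)]
  have hr : ∀ t > b, σ₂ =ᶠ[𝓝 t] fun t => if t ≤ b then σ₁ t else σ₂ t := fun t ht => by
    filter_upwards [Ioi_mem_nhds ht] with u hu
    rw [if_neg (not_le.2 hu)]
  have hb : LineGerm s d (fun t => if t ≤ b then σ₁ t else σ₂ t) b i w v := by
    filter_upwards [h1, h2, (tendsto_line w d v b).eventually ((isOpen_chartDomain i).mem_nhds hw)]
      with u k1 k2 k3
    refine ⟨k3, ?_⟩
    split_ifs with hu
    · exact k1 hu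
    · exact k2 (not_le.1 hu)
  refine ⟨ordConnected_Icc, ?_, ?_, ?_, ?_⟩
  · rw [interior_Icc]; exact nonempty_Ioo.2 (hab.trans hbc)
  · exact (Continuous.if_le c1 c2 continuous_id continuous_const
      (fun x hx => by rw [show x = b from hx, heq])).continuousOn
  · intro t ht
    rw [interior_Icc] at ht
    rcases lt_trichotomy t b with h | rfl | h
    · rw [← EventuallyEq.eq_of_nhds (hl t h)]; exact r1 t ⟨ht.1, h⟩
    · rw [hb.self.2]; exact param_notMem hw
    · rw [← EventuallyEq.eq_of_nhds (hr t h)]; exact r2 t ⟨h, ht.2⟩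
  · intro t ht
    rw [interior_Icc] at ht
    rcases lt_trichotomy t b with h | rfl | h
    · exact (l1 t ⟨ht.1, h⟩).congr (hl t h)
    · exact straightAt_iff.2 ⟨i, w, v, hv, hb⟩
    · exact (l2 t ⟨h, ht.2⟩).congr (hr t h)

/-! ### Crossings of the cylinder by a trajectory -/

/-- From time `a` to time `a + s / v` the curve `τ` crosses `R⁺` with speed `v`, entering it at
height `z`. -/
structure Crosses (s : ℝ) [Fact (s ∈ Ioo (0 : ℝ) 1)] (m : ℝ) (I : Set ℝ) (τ : ℝ → Surface s)
    (a v z : ℝ) : Prop where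
  pos : 0 < v
  subset : Icc a (a + s / v) ⊆ I
  eqOn : EqOn τ (segment s m a v z) (Icc a (a + s / v))

variable {m : ℝ} {I : Set ℝ} {τ : ℝ → Surface s} {a v z : ℝ}

lemma dir_ne_zero (m : ℝ) : ((1 : ℝ), m) ≠ 0 := fun h => one_ne_zero (congrArg Prod.fst h)

/-- A maximal trajectory that follows a segment near one time contains the whole crossing of `R⁺`.
-/
lemma IsMaxTrajectory.crosses (hτ : IsMaxTrajectory s (1, m) I τ) (hv : 0 < v) {t : ℝ}
    (ht : t ∈ interior I) (ht' : t ∈ Ioo a (a + s / v)) (e : τ =ᶠ[𝓝 t] segment s m a v z) :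
    Crosses s m I τ a v z := by
  obtain ⟨h1, h2⟩ := hτ.extends (dir_ne_zero m) (isTrajectory_segment m a z hv) ht
    (by rwa [interior_Icc]) e
  exact ⟨hv, h1, h2⟩

lemma Crosses.fract (h : Crosses s m I τ a v z) : Crosses s m I τ a v (Int.fract z) :=
  ⟨h.pos, h.subset, fun t ht => (h.eqOn ht).trans (segment_fract m a v z t).symm⟩

lemma Crosses.congr_height (h : Crosses s m I τ a v z) {z' : ℝ} {k : ℤ} (hz : z' = z + k) :
    Crosses s m I τ a v z' :=
  ⟨h.pos, h.subset, fun t ht => by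
    rw [h.eqOn ht, ← segment_fract m a v z, ← segment_fract m a v z', hz, Int.fract_add_intCast]⟩

lemma Crosses.mid_mem_interior (h : Crosses s m I τ a v z) {t : ℝ} (ht : t ∈ Ioo a (a + s / v)) :
    t ∈ interior I := by
  have := interior_mono h.subset
  rw [interior_Icc] at this
  exact this ht

lemma Crosses.eventuallyEq (h : Crosses s m I τ a v z) {t : ℝ} (ht : t ∈ Ioo a (a + s / v)) :
    τ =ᶠ[𝓝 t] segment s m a v z :=
  mem_of_superset (Icc_mem_nhds ht.1 ht.2) h.eqOn

lemma Crosses.apply_left (h : Crosses s m I τ a v z) : τ a = cyl s 0 z := by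
  rw [h.eqOn ⟨le_rfl, (lt_add_div s a h.pos).le⟩]; simp [segment]

lemma Crosses.apply_right (h : Crosses s m I τ a v z) : τ (a + s / v) = cyl s s (z + m * s) := by
  rw [h.eqOn ⟨(lt_add_div s a h.pos).le, le_rfl⟩, segment, add_sub_cancel_left,
    mul_div_cancel₀ _ h.pos.ne']

/-- Interior times are regular, so a time mapped to `Z` must be an end of the domain. -/
lemma IsTrajectory.isLeast_of_singular {d : ℝ × ℝ} (hτ : IsTrajectory s d I τ) {b : ℝ} (hab : a < b)
    (ha : a ∈ I) (hb : b ∈ I) (hZ : τ a ∈ singularSet s) : IsLeast I a := by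
  refine ⟨ha, fun t ht => ?_⟩
  by_contra! hlt
  exact hτ.regular a (mem_interior_iff_mem_nhds.2
    (mem_of_superset (Icc_mem_nhds hlt hab) (hτ.interval.out ht hb))) hZ

lemma IsTrajectory.isGreatest_of_singular {d : ℝ × ℝ} (hτ : IsTrajectory s d I τ) {b : ℝ}
    (hab : a < b) (ha : a ∈ I) (hb : b ∈ I) (hZ : τ b ∈ singularSet s) : IsGreatest I b := by
  refine ⟨hb, fun t ht => ?_⟩
  by_contra! hlt
  exact hτ.regular b (mem_interior_iff_mem_nhds.2
    (mem_of_superset (Icc_mem_nhds hab hlt) (hτ.interval.out ha ht))) hZ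

lemma Crosses.left_mem (h : Crosses s m I τ a v z) : a ∈ I :=
  h.subset ⟨le_rfl, (lt_add_div s a h.pos).le⟩

lemma Crosses.right_mem (h : Crosses s m I τ a v z) : a + s / v ∈ I :=
  h.subset ⟨(lt_add_div s a h.pos).le, le_rfl⟩

lemma Crosses.isGreatest (h : Crosses s m I τ a v z) (hτ : IsMaxTrajectory s (1, m) I τ) {k : ℤ}
    (hk : z + m * s = k) : IsGreatest I (a + s / v) ∧ τ (a + s / v) ∈ singularSet s := by
  have p0 := s_pos (s := s)
  have hZ : τ (a + s / v) ∈ singularSet s := by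
    rw [h.apply_right, cyl_mem_singularSet ⟨p0.le, le_rfl⟩]
    exact Or.inr (Or.inr ⟨rfl, by rw [hk, Int.fract_intCast]⟩)
  exact ⟨hτ.isGreatest_of_singular (lt_add_div s a h.pos) h.left_mem h.right_mem hZ, hZ⟩

lemma Crosses.isLeast (h : Crosses s m I τ a v z) (hτ : IsMaxTrajectory s (1, m) I τ)
    (hz : z = 0 ∨ z = s) : IsLeast I a ∧ τ a ∈ singularSet s := by
  have p0 := s_pos (s := s)
  have hZ : τ a ∈ singularSet s := by
    rw [h.apply_left, cyl_mem_singularSet ⟨le_rfl, p0.le⟩]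
    rcases hz with rfl | rfl
    · simp
    · exact Or.inr (Or.inl ⟨rfl, Int.fract_eq_self.2 ⟨p0.le, s_lt_one⟩⟩)
  exact ⟨hτ.isLeast_of_singular (lt_add_div s a h.pos) h.left_mem h.right_mem hZ, hZ⟩

/-- Two consecutive crossings form a trajectory. -/
lemma isTrajectory_two_crossings (m a z : ℝ) {v : ℝ} (hv : 0 < v)
    (hz : Int.fract (z + m * s) ≠ 0) :
    IsTrajectory s (1, m) (Icc a (a + s / v + s / (s * v))) (fun t => if t ≤ a + s / v then
      segment s m a v z t else
      segment s m (a + s / v) (s * v) (s * Int.fract (z + m * s)) t) := by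
  have p0 := s_pos (s := s)
  have p1 := s_lt_one (s := s)
  have hsv : 0 < s * v := mul_pos p0 hv
  have h0 : 0 < Int.fract (z + m * s) := lt_of_le_of_ne (Int.fract_nonneg _) hz.symm
  have h1 := Int.fract_lt_one (z + m * s)
  set y := Int.fract (z + m * s) with hy
  set b := a + s / v with hb
  have hb' : v * (b - a) = s := by rw [hb, add_sub_cancel_left, mul_div_cancel₀ _ hv.ne']
  -- Near the junction both crossings are one line in chart `A`. Beyond its seam the chart is a
  -- homothety of ratio `s`, so speed `v` in the chart is speed `s * v` on the cylinder, and height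
  -- `y` becomes `s * y`.
  have hw : (s, y) ∈ chartDomain s .A := by rw [mem_chartA]; grind
  have hbase : ∀ t, segment s m a v z t = cyl s (s + v * (t - b)) (y + m * (v * (t - b))) := by
    intro t
    rw [segment]
    have e1 : v * (t - a) = s + v * (t - b) := by linear_combination hb'
    rw [e1]
    have e2 : z + m * (s + v * (t - b)) = y + m * (v * (t - b)) + ⌊z + m * s⌋ := by
      rw [hy, Int.fract]; ring
    rw [e2, cyl_add_int]
  have hcont : ∀ C : ℝ, Tendsto (fun u : ℝ => C * (u - b)) (𝓝 b) (𝓝 0) := fun C => by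
    have : Tendsto (fun u : ℝ => C * (u - b)) (𝓝 b) (𝓝 (C * (b - b))) :=
      Continuous.tendsto (by fun_prop) b
    simpa using this
  refine isTrajectory_concat (i := .A) (w := (s, y)) (lt_add_div s a hv) (lt_add_div s b hsv)
    (continuous_segment ..) (continuous_segment ..) (fun t ht => segment_notMem hv ht)
    (fun t ht => segment_notMem hsv ht) (fun t ht => straightAt_segment hv ht)
    (fun t ht => straightAt_segment hsv ht) ?_ hv hw ?_ ?_
  · rw [hbase, segment]
    simp only [sub_self, mul_zero, add_zero]
    rw [cyl_right, hy, Int.fract_fract]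
  · filter_upwards [(hcont v).eventually (eventually_gt_nhds (show -s < 0 by linarith)),
      (hcont (m * v)).eventually (eventually_gt_nhds (show -y < 0 by linarith)),
      (hcont (m * v)).eventually (eventually_lt_nhds (show 0 < 1 - y by linarith))] with u k1 k2 k3 hu
    have hu' : v * (u - b) ≤ 0 := mul_nonpos_of_nonneg_of_nonpos hv.le (by linarith)
    rw [hbase, cyl_eq ⟨by linarith, by linarith⟩ ⟨by linarith, by linarith⟩, param]
    have : s + v * (u - b) ≤ s := by linarith
    simp only [chartFold, Prod.smul_mk, Prod.mk_add_mk, smul_eq_mul, mul_one, this, if_true]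
    congr 2; ring
  · filter_upwards [(hcont v).eventually (eventually_lt_nhds (show (0 : ℝ) < 1 by linarith)),
      (hcont (m * v)).eventually (eventually_gt_nhds (show -y < 0 by linarith)),
      (hcont (m * v)).eventually (eventually_lt_nhds (show 0 < 1 - y by linarith))] with u k1 k2 k3 hu
    have hu' : 0 < v * (u - b) := mul_pos hv (by linarith)
    have e : s * y + m * (s * v * (u - b)) = s * (y + m * v * (u - b)) := by ring
    have g1 : 0 < s * (y + m * v * (u - b)) := mul_pos p0 (by linarith)
    have g2 : s * (y + m * v * (u - b)) < s * 1 := mul_lt_mul_of_pos_left (by linarith) p0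
    have e' : s * v * (u - b) = s * (v * (u - b)) := by ring
    have g3 : 0 < s * (v * (u - b)) := mul_pos p0 hu'
    have g4 : s * (v * (u - b)) < s * 1 := mul_lt_mul_of_pos_left k1 p0
    rw [segment, e, e', cyl_eq ⟨by linarith, by linarith⟩ ⟨by linarith, by linarith⟩, param]
    have : ¬ s + v * (u - b) ≤ s := by linarith
    simp only [chartFold, Prod.smul_mk, Prod.mk_add_mk, smul_eq_mul, mul_one, this, if_false]
    congr 2 <;> ring

/-- One step of the contracted rotation. The condition `y ∈ (0,1)` says that the right side is not
reached at a vertex. -/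
lemma Crosses.next (h : Crosses s m I τ a v z) (hτ : IsMaxTrajectory s (1, m) I τ) {y : ℝ}
    (hy : y ∈ Ioo (0 : ℝ) 1) {k : ℤ} (hk : z + m * s = y + k) :
    Crosses s m I τ (a + s / v) (s * v) (s * y) := by
  have p0 := s_pos (s := s)
  have hf : Int.fract (z + m * s) = y := by
    rw [hk, Int.fract_add_intCast, Int.fract_eq_self.2 ⟨hy.1.le, hy.2⟩]
  have hsv := mul_pos p0 h.pos
  obtain ⟨t, ht⟩ := nonempty_Ioo.2 (lt_add_div s a h.pos)
  have hlt := lt_add_div s (a + s / v) hsv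
  obtain ⟨h1, h2⟩ := hτ.extends (dir_ne_zero m) (isTrajectory_two_crossings m a z h.pos
    (by rw [hf]; exact hy.1.ne')) (h.mid_mem_interior ht)
    (by rw [interior_Icc]; exact ⟨ht.1, ht.2.trans hlt⟩) (by
      filter_upwards [h.eventuallyEq ht, Iio_mem_nhds ht.2] with u hu hu'
      rw [if_pos (le_of_lt hu'), hu])
  have hle := (lt_add_div s a h.pos).le
  refine ⟨hsv, fun u hu => h1 ⟨hle.trans hu.1, hu.2⟩, fun u hu => ?_⟩
  rw [h2 ⟨hle.trans hu.1, hu.2⟩]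
  simp only
  split_ifs with hu'
  · obtain rfl := le_antisymm hu' hu.1
    rw [← h.eqOn ⟨hle, le_rfl⟩, h.apply_right, cyl_right, hf, segment]
    simp
  · rw [hf]

/-- The backward step is available only from the lower part of the left side, the image of the
gluing `A`; it divides the speed by `s`. -/
lemma Crosses.prev (h : Crosses s m I τ a v (s * z)) (hτ : IsMaxTrajectory s (1, m) I τ)
    (hz : z ∈ Ioo (0 : ℝ) 1) {z' : ℝ} {k : ℤ} (hk : z' + m * s = z + k) :
    Crosses s m I τ (a - s / (v / s)) (v / s) z' := by
  have p0 := s_pos (s := s)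
  have hf : Int.fract (z' + m * s) = z := by
    rw [hk, Int.fract_add_intCast, Int.fract_eq_self.2 ⟨hz.1.le, hz.2⟩]
  have hsv := div_pos h.pos p0
  obtain ⟨t, ht⟩ := nonempty_Ioo.2 (lt_add_div s a h.pos)
  have key := isTrajectory_two_crossings m (a - s / (v / s)) z' hsv (by rw [hf]; exact hz.1.ne')
  rw [hf, sub_add_cancel, mul_div_cancel₀ _ p0.ne'] at key
  have hlt : a - s / (v / s) < a := sub_lt_self _ (div_pos p0 hsv)
  obtain ⟨h1, h2⟩ := hτ.extends (dir_ne_zero m) key (h.mid_mem_interior ht)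
    (by rw [interior_Icc]; exact ⟨hlt.trans ht.1, ht.2⟩) (by
      filter_upwards [h.eventuallyEq ht, Ioi_mem_nhds ht.1] with u hu hu'
      rw [if_neg (not_le.2 hu'), hu])
  have hle := (lt_add_div s a h.pos).le
  refine ⟨hsv, ?_, ?_⟩
  · rw [sub_add_cancel]; exact fun u hu => h1 ⟨hu.1, hu.2.trans hle⟩
  · rw [sub_add_cancel]
    intro u hu
    rw [h2 ⟨hu.1, hu.2.trans hle⟩]
    simp only [hu.2, if_true]

/-- The edge `E` between `R⁺` and `R⁻`: near it the surface is the plane. -/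
lemma isTrajectory_across (m a : ℝ) {v z : ℝ} (hv : 0 < v) (hz : z ∈ Ioo s 1) :
    IsTrajectory s (1, m) (Icc (a - s / v) (a + s / v)) (fun t => if t ≤ a then
      rot (segment s m (-a) v (1 + s - z) (-t)) else segment s m a v z t) := by
  have p0 := s_pos (s := s)
  have p1 := s_lt_one (s := s)
  obtain ⟨hz0, hz1⟩ := hz
  -- The edge `E` lies inside the octagon, so no change of scale occurs. The piece in `R⁻` is
  -- written as the rotated and time-reversed image of a segment in `R⁺`.
  have hw : ((0 : ℝ), z) ∈ chartDomain s .interior := by rw [mem_chartI]; grind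
  have hmem : ∀ t ∈ Ioo (a - s / v) a, -t ∈ Ioo (-a) (-a + s / v) := fun t ht =>
    ⟨by linarith [ht.2], by linarith [ht.1]⟩
  have hcont : ∀ C : ℝ, Tendsto (fun u : ℝ => C * (u - a)) (𝓝 a) (𝓝 0) := fun C => by
    have : Tendsto (fun u : ℝ => C * (u - a)) (𝓝 a) (𝓝 (C * (a - a))) :=
      Continuous.tendsto (by fun_prop) a
    simpa using this
  have hd := div_pos p0 hv
  refine isTrajectory_concat (i := .interior) (w := (0, z)) (by linarith) (lt_add_div s a hv)
    (continuous_rot.comp ((continuous_segment ..).comp continuous_neg)) (continuous_segment ..)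
    (fun t ht h => segment_notMem hv (hmem t ht) (rot_mem_singularSet.1 h))
    (fun t ht => segment_notMem hv ht) (fun t ht => ?_)
    (fun t ht => straightAt_segment hv ht) ?_ hv hw ?_ ?_
  · have h1 := (straightAt_segment (m := m) (z := 1 + s - z) hv (hmem t ht)).rot.neg
    simpa using h1
  · simp only [segment, sub_self, mul_zero, add_zero]
    rw [cyl_eq ⟨le_rfl, p0.le⟩ ⟨by linarith, by linarith⟩,
      cyl_eq ⟨le_rfl, p0.le⟩ ⟨by linarith, by linarith⟩,
      rot_proj (mem_polygon_right ⟨le_rfl, p0.le⟩ ⟨by linarith, by linarith⟩)]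
    simp [planeRot]
  · filter_upwards [(hcont v).eventually (eventually_gt_nhds (show -s < 0 by linarith)),
      (hcont (m * v)).eventually (eventually_gt_nhds (show s - z < 0 by linarith)),
      (hcont (m * v)).eventually (eventually_lt_nhds (show 0 < 1 - z by linarith))] with u k1 k2 k3 hu
    have hu' : v * (u - a) ≤ 0 := mul_nonpos_of_nonneg_of_nonpos hv.le (by linarith)
    have e1 : v * (-u - -a) = - (v * (u - a)) := by ring
    have e2 : 1 + s - z + m * -(v * (u - a)) = 1 + s - z - m * v * (u - a) := by ring
    have hx : -(v * (u - a)) ∈ Icc 0 s := ⟨by linarith, by linarith⟩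
    have hy : 1 + s - z - m * v * (u - a) ∈ Icc (0 : ℝ) 1 := ⟨by linarith, by linarith⟩
    rw [segment, e1, e2, cyl_eq hx hy, rot_proj (mem_polygon_right hx hy), param]
    simp only [planeRot, chartFold, Prod.smul_mk, Prod.mk_add_mk, smul_eq_mul]
    congr 2 <;> ring
  · filter_upwards [(hcont v).eventually (eventually_lt_nhds (show 0 < s by linarith)),
      (hcont (m * v)).eventually (eventually_gt_nhds (show s - z < 0 by linarith)),
      (hcont (m * v)).eventually (eventually_lt_nhds (show 0 < 1 - z by linarith))] with u k1 k2 k3 hu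
    have hu' : 0 < v * (u - a) := mul_pos hv (by linarith)
    have e2 : z + m * (v * (u - a)) = z + m * v * (u - a) := by ring
    rw [segment, e2, cyl_eq ⟨by linarith, by linarith⟩ ⟨by linarith, by linarith⟩, param]
    simp only [chartFold, Prod.smul_mk, Prod.mk_add_mk, smul_eq_mul]
    congr 2 <;> ring

/-- A crossing that enters `R⁺` through `E` comes from a crossing of `R⁻`, which rotation and time
reversal turn into a crossing of `R⁺` again. -/
lemma Crosses.across (h : Crosses s m I τ a v z) (hτ : IsMaxTrajectory s (1, m) I τ)
    (hz : z ∈ Ioo s 1) : Crosses s m (-I) (fun u => rot (τ (-u))) (-a) v (1 + s - z) := by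
  have p0 := s_pos (s := s)
  obtain ⟨t, ht⟩ := nonempty_Ioo.2 (lt_add_div s a h.pos)
  have hd := div_pos p0 h.pos
  obtain ⟨h1, h2⟩ := hτ.extends (dir_ne_zero m) (isTrajectory_across m a h.pos hz)
    (h.mid_mem_interior ht) (by rw [interior_Icc]; exact ⟨by linarith [ht.1], ht.2⟩) (by
      filter_upwards [h.eventuallyEq ht, Ioi_mem_nhds ht.1] with u hu hu'
      rw [if_neg (not_le.2 hu'), hu])
  have hmem : ∀ u ∈ Icc (-a) (-a + s / v), -u ∈ Icc (a - s / v) (a + s / v) ∧ -u ≤ a := fun u hu =>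
    ⟨⟨by linarith [hu.2], by linarith [hu.1]⟩, by linarith [hu.1]⟩
  refine ⟨h.pos, fun u hu => h1 (hmem u hu).1, fun u hu => ?_⟩
  rw [h2 (hmem u hu).1]
  simp only [(hmem u hu).2, if_true]
  rw [rot_rot, neg_neg]

end


/-! ### Sequences of crossings -/

section
variable {s : ℝ} [hs : Fact (s ∈ Ioo (0 : ℝ) 1)]
variable {m : ℝ} {I : Set ℝ} {τ : ℝ → Surface s} {a v z : ℝ}

/-- The starting times of consecutive crossings. -/
noncomputable def crossTime (s a v : ℝ) : ℕ → ℝ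
  | 0 => a
  | n + 1 => crossTime s a v n + s / (s ^ n * v)

/-- The trajectory `τ` crosses `R⁺` infinitely often in succession, at the heights `s * y n`. -/
structure ForwardChain (s : ℝ) [Fact (s ∈ Ioo (0 : ℝ) 1)] (m : ℝ) (I : Set ℝ) (τ : ℝ → Surface s)
    (a v : ℝ) (y : ℕ → ℝ) : Prop where
  mem : ∀ n, y (n + 1) ∈ Ioo (0 : ℝ) 1
  step : ∀ n, ∃ k : ℤ, s * y n + s * m = y (n + 1) + k
  crosses : ∀ n, Crosses s m I τ (crossTime s a v n) (s ^ n * v) (s * y n)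

lemma Crosses.chain (h : Crosses s m I τ a v z) (hτ : IsMaxTrajectory s (1, m) I τ) {y : ℕ → ℝ}
    (h0 : z = s * y 0) {N : ℕ} (hy : ∀ n < N, y (n + 1) ∈ Ioo (0 : ℝ) 1)
    (hstep : ∀ n < N, ∃ k : ℤ, s * y n + s * m = y (n + 1) + k) :
    ∀ n ≤ N, Crosses s m I τ (crossTime s a v n) (s ^ n * v) (s * y n) := by
  intro n
  induction n with
  | zero => intro _; rw [pow_zero, one_mul, ← h0]; exact h
  | succ n ih =>
    intro hn
    obtain ⟨k, hk⟩ := hstep n hn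
    have := (ih (by omega)).next hτ (hy n hn) (k := k) (by rw [← hk]; ring)
    rw [← mul_assoc, ← pow_succ'] at this
    exact this

/-- A crossing is followed by further ones, unless the trajectory runs into the singularity. -/
lemma Crosses.forward (h : Crosses s m I τ a v z) (hτ : IsMaxTrajectory s (1, m) I τ) :
    (∃ a' v' z', Crosses s m I τ a' v' z' ∧ IsGreatest I (a' + s / v') ∧
      τ (a' + s / v') ∈ singularSet s) ∨
    ∃ y : ℕ → ℝ, y 0 = z / s ∧ ForwardChain s m I τ a v y := by
  have p0 := s_pos (s := s)
  by_contra! hcon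
  obtain ⟨h1, h2⟩ := hcon
  let y : ℕ → ℝ := fun n => Nat.rec (z / s) (fun _ y => Int.fract (s * y + s * m)) n
  have hz : z = s * y 0 := (mul_div_cancel₀ z p0.ne').symm
  have hstep : ∀ n, ∃ k : ℤ, s * y n + s * m = y (n + 1) + k := fun n =>
    ⟨⌊s * y n + s * m⌋, (Int.fract_add_floor _).symm⟩
  have key : ∀ n, Crosses s m I τ (crossTime s a v n) (s ^ n * v) (s * y n) ∧
      y (n + 1) ∈ Ioo (0 : ℝ) 1 := by
    intro n
    induction n using Nat.strong_induction_on with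
    | _ n ih =>
      have hc := h.chain hτ hz (N := n) (fun j hj => (ih j hj).2) (fun j _ => hstep j) n le_rfl
      refine ⟨hc, lt_of_le_of_ne (Int.fract_nonneg _) fun h0 => ?_, Int.fract_lt_one _⟩
      have h3 := hc.isGreatest hτ (k := ⌊s * y n + s * m⌋) (by
        have := Int.fract_add_floor (s * y n + s * m)
        have e0 : 0 = Int.fract (s * y n + s * m) := h0
        rw [← e0, zero_add] at this
        rw [this]; ring)
      exact h1 _ _ _ hc h3.1 h3.2
  exact h2 y rfl ⟨fun n => (key n).2, hstep, fun n => (key n).1⟩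

/-- The speeds `s ^ n * v` decrease, so every crossing lasts at least as long as the first and the
starting times tend to infinity. -/
lemma crossTime_ge {v : ℝ} (hv : 0 < v) (a : ℝ) (n : ℕ) :
    a + n * (s / v) ≤ crossTime s a v n := by
  have p0 := s_pos (s := s)
  induction n with
  | zero => simp [crossTime]
  | succ n ih =>
    have h1 : s / v ≤ s / (s ^ n * v) :=
      div_le_div_of_nonneg_left p0.le (by positivity)
        (mul_le_of_le_one_left hv.le (pow_le_one₀ p0.le s_lt_one.le))
    rw [crossTime]; push_cast; linarith

lemma exists_crossTime_gt {v : ℝ} (hv : 0 < v) (a T : ℝ) : ∃ n : ℕ, T < crossTime s a v n := by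
  have h0 := div_pos (s_pos (s := s)) hv
  obtain ⟨n, hn⟩ := exists_nat_gt ((T - a) / (s / v))
  refine ⟨n, lt_of_lt_of_le ?_ (crossTime_ge hv a n)⟩
  rw [div_lt_iff₀ h0] at hn; linarith

lemma ForwardChain.pos {y : ℕ → ℝ} (h : ForwardChain s m I τ a v y) : 0 < v := by
  simpa using (h.crosses 0).pos

lemma ForwardChain.exists_mem {y : ℕ → ℝ} (h : ForwardChain s m I τ a v y) (N : ℕ) {t : ℝ}
    (ht : crossTime s a v N ≤ t) : ∃ n ≥ N, t ∈ Icc (crossTime s a v n)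
      (crossTime s a v n + s / (s ^ n * v)) := by
  by_contra! hcon
  have : ∀ n ≥ N, crossTime s a v n ≤ t := by
    intro n hn
    induction n, hn using Nat.le_induction with
    | base => exact ht
    | succ n hn ih =>
      by_contra! hlt
      exact hcon n hn ⟨ih, hlt.le⟩
  obtain ⟨n, hn⟩ := exists_crossTime_gt (s := s) h.pos a t
  rcases le_total N n with h1 | h1
  · exact absurd (this n h1) (not_le.2 hn)
  · have hmono : Monotone (crossTime s a v) := monotone_nat_of_le_succ fun n => by
      have := lt_add_div s (crossTime s a v n) (mul_pos (pow_pos (s_pos (s := s)) n) h.pos)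
      exact this.le
    exact absurd ((hmono h1).trans ht) (not_le.2 hn)

lemma ForwardChain.unbounded {y : ℕ → ℝ} (h : ForwardChain s m I τ a v y) (T : ℝ) :
    ∃ n, T < crossTime s a v n ∧ crossTime s a v n ∈ I := by
  obtain ⟨n, hn⟩ := exists_crossTime_gt (s := s) h.pos a T
  exact ⟨n, hn, (h.crosses n).left_mem⟩

lemma ForwardChain.not_isGreatest {y : ℕ → ℝ} (h : ForwardChain s m I τ a v y) (t : ℝ) :
    ¬ IsGreatest I t := fun ht => by
  obtain ⟨n, h1, h2⟩ := h.unbounded t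
  exact absurd (ht.2 h2) (not_le.2 h1)

/-- The trajectory `τ` has crossed `R⁺` infinitely often in succession, at the heights
`s * y n`. -/
structure BackwardChain (s : ℝ) [Fact (s ∈ Ioo (0 : ℝ) 1)] (m : ℝ) (I : Set ℝ) (τ : ℝ → Surface s)
    (b : ℕ → ℝ) (v : ℝ) (y : ℕ → ℝ) : Prop where
  mem : ∀ n, y n ∈ Ioo (0 : ℝ) 1
  step : ∀ n, ∃ k : ℤ, s * y (n + 1) + s * m = y n + k
  crosses : ∀ n, Crosses s m I τ (b n) (v / s ^ n) (s * y n)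
  time : ∀ n, b (n + 1) + s / (v / s ^ (n + 1)) = b n

/-- A crossing is preceded by other ones until the trajectory is found to come from the
singularity or from `R⁻`. -/
lemma Crosses.backward (h : Crosses s m I τ a v z) (hτ : IsMaxTrajectory s (1, m) I τ) :
    (∃ a' v' z', Crosses s m I τ a' v' z' ∧ IsLeast I a' ∧ τ a' ∈ singularSet s) ∨
    (∃ a' v', ∃ z' ∈ Ioo s 1, Crosses s m I τ a' v' z') ∨
    ∃ b y, b 0 = a ∧ BackwardChain s m I τ b v y := by
  have p0 := s_pos (s := s)
  by_contra! hcon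
  obtain ⟨h1, h2, h3⟩ := hcon
  -- A height `ζ < s` on the left side is glued to `ζ / s` on the right side, and the segment of
  -- slope `m` ending there began at `ζ / s - m * s`.
  let ζ : ℕ → ℝ := fun n => Nat.rec (Int.fract z) (fun _ z => Int.fract (z / s - m * s)) n
  let b : ℕ → ℝ := fun n => Nat.rec a (fun n b => b - s / (v / s ^ (n + 1))) n
  have hf : ∀ n, 0 ≤ ζ n ∧ ζ n < 1 := by
    rintro (_ | n)
    exacts [⟨Int.fract_nonneg _, Int.fract_lt_one _⟩, ⟨Int.fract_nonneg _, Int.fract_lt_one _⟩]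
  have hζ : ∀ n, Crosses s m I τ (b n) (v / s ^ n) (ζ n) → ζ n / s ∈ Ioo (0 : ℝ) 1 := by
    intro n hn
    obtain ⟨k1, k2⟩ := hf n
    have k3 : ζ n ≠ 0 := fun h0 => by
      have := hn.isLeast hτ (Or.inl h0); exact h1 _ _ _ hn this.1 this.2
    have k4 : ζ n ≠ s := fun h0 => by
      have := hn.isLeast hτ (Or.inr h0); exact h1 _ _ _ hn this.1 this.2
    have k5 : ¬ s < ζ n := fun h0 => h2 _ _ _ ⟨h0, k2⟩ hn
    have k6 : ζ n < s := lt_of_le_of_ne (not_lt.1 k5) k4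
    exact ⟨div_pos (lt_of_le_of_ne k1 k3.symm) p0, (div_lt_one p0).2 k6⟩
  have hsz : ∀ n, s * (ζ n / s) = ζ n := fun n => mul_div_cancel₀ _ p0.ne'
  have key : ∀ n, Crosses s m I τ (b n) (v / s ^ n) (ζ n) := by
    intro n
    induction n with
    | zero => rw [pow_zero, div_one]; exact h.fract
    | succ n ih =>
      have h4 := hζ n ih
      rw [← hsz n] at ih
      have := (ih.prev hτ h4 (z' := ζ n / s - m * s) (k := 0) (by simp)).fract
      rw [div_div, ← pow_succ] at this
      exact this
  refine h3 b (fun n => ζ n / s) rfl ⟨fun n => hζ n (key n), fun n => ?_, fun n => ?_, fun n => ?_⟩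
  · refine ⟨-⌊ζ n / s - m * s⌋, ?_⟩
    simp only [hsz]
    have := Int.fract_add_floor (ζ n / s - m * s)
    have e : ζ (n + 1) = Int.fract (ζ n / s - m * s) := rfl
    rw [e]; push_cast; linarith
  · simp only [hsz]; exact key n
  · show b n - s / (v / s ^ (n + 1)) + _ = _
    ring

/-- A function on the surface that vanishes exactly outside the interior of `R⁺`. -/
noncomputable def bump : Surface s → ℝ :=
  Quot.lift (fun p : polygon s => max (p : ℝ × ℝ).1 0 * (s - (p : ℝ × ℝ).1)) (by
    have p0 := s_pos (s := s)
    rintro p q h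
    rcases h with ⟨y, hy, hp, hq⟩ | ⟨x, hx, hp, hq⟩ | ⟨y, hy, hp, hq⟩ | ⟨x, hx, hp, hq⟩ <;>
    simp only [hp, hq]
    · simp
    · simp [p0.le])

lemma continuous_bump : Continuous (bump (s := s)) :=
  continuous_quot_lift _ (by fun_prop)

lemma bump_proj {w : ℝ × ℝ} (h : w ∈ polygon s) : bump (proj s w) = max w.1 0 * (s - w.1) := by
  rw [proj_of_mem h]; rfl

lemma bump_cyl {x : ℝ} (hx : x ∈ Icc 0 s) (y : ℝ) : bump (cyl s x y) = x * (s - x) := by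
  rw [cyl_eq_fract hx, bump_proj (mem_polygon_right hx ⟨Int.fract_nonneg _,
    (Int.fract_lt_one _).le⟩), max_eq_left hx.1]

lemma bump_rot_cyl {x : ℝ} (hx : x ∈ Icc 0 s) (y : ℝ) : bump (rot (cyl s x y)) = 0 := by
  have h := mem_polygon_right hx ⟨Int.fract_nonneg y, (Int.fract_lt_one y).le⟩
  rw [cyl_eq_fract hx, rot_proj h, bump_proj (planeRot_mem h), planeRot,
    max_eq_right (by simpa using hx.1), zero_mul]

lemma Crosses.bump_left (h : Crosses s m I τ a v z) : bump (τ a) = 0 := by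
  rw [h.apply_left, bump_cyl ⟨le_rfl, s_pos.le⟩, zero_mul]

lemma Crosses.bump_mid (h : Crosses s m I τ a v z) : bump (τ (a + s / v / 2)) = s ^ 2 / 4 := by
  have p0 := s_pos (s := s)
  have h0 := div_pos p0 h.pos
  rw [h.eqOn ⟨by linarith, by linarith⟩, segment, add_sub_cancel_left,
    show v * (s / v / 2) = s / 2 by field_simp [h.pos.ne'], bump_cyl ⟨by linarith, by linarith⟩]
  ring

/-- Backwards the speeds grow, so the starting times may converge in finite time. At a limit time in
the domain `bump` would have to be continuous, but it is 0 at the starts of the crossings and `s ^ 2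
/ 4` at their midpoints. Maximality is not needed, which permits application to a truncated domain.
-/
lemma BackwardChain.not_isLeast {b : ℕ → ℝ} {y : ℕ → ℝ} (h : BackwardChain s m I τ b v y)
    (hτ : IsTrajectory s (1, m) I τ) (t : ℝ) : ¬ IsLeast I t := by
  intro ht
  have p0 := s_pos (s := s)
  have hmem : ∀ n, b n ∈ I := fun n => (h.crosses n).left_mem
  have hanti : Antitone b := antitone_nat_of_succ_le fun n => by
    rw [← h.time n]; exact (lt_add_div s _ (h.crosses (n + 1)).pos).le
  have hlim := tendsto_atTop_ciInf hanti ⟨t, by rintro _ ⟨n, rfl⟩; exact ht.2 (hmem n)⟩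
  set L := ⨅ n, b n
  have hLt : t ≤ L := le_ciInf fun n => ht.2 (hmem n)
  have hLI : L ∈ I := hτ.interval.out ht.1 (hmem 0)
    ⟨hLt, ciInf_le ⟨t, by rintro _ ⟨n, rfl⟩; exact ht.2 (hmem n)⟩ 0⟩
  have hmid : Tendsto (fun n => b (n + 1) + s / (v / s ^ (n + 1)) / 2) atTop (𝓝 L) := by
    refine tendsto_of_tendsto_of_tendsto_of_le_of_le (hlim.comp (tendsto_add_atTop_nat 1)) hlim
      (fun n => ?_) (fun n => ?_)
    · have := div_pos p0 (h.crosses (n + 1)).pos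
      simp only [Function.comp]; linarith
    · have := div_pos p0 (h.crosses (n + 1)).pos
      simp only; rw [← h.time n]; linarith
  have hmidI : ∀ n, b (n + 1) + s / (v / s ^ (n + 1)) / 2 ∈ I := fun n => by
    have := div_pos p0 (h.crosses (n + 1)).pos
    exact (h.crosses (n + 1)).subset ⟨by linarith, by linarith⟩
  have hcont : ContinuousWithinAt (fun u => bump (τ u)) I L :=
    (continuous_bump.comp_continuousOn hτ.continuous) L hLI
  have l1 := hcont.tendsto.comp
    (tendsto_nhdsWithin_iff.2 ⟨hlim, Eventually.of_forall hmem⟩)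
  have l2 := hcont.tendsto.comp
    (tendsto_nhdsWithin_iff.2 ⟨hmid, Eventually.of_forall hmidI⟩)
  have e1 : ((fun u => bump (τ u)) ∘ b) = fun _ => 0 := funext fun n => (h.crosses n).bump_left
  have e2 : ((fun u => bump (τ u)) ∘ fun n => b (n + 1) + s / (v / s ^ (n + 1)) / 2) =
      fun _ => s ^ 2 / 4 := funext fun n => (h.crosses (n + 1)).bump_mid
  rw [e1] at l1
  rw [e2] at l2
  have := tendsto_nhds_unique l1 tendsto_const_nhds
  have := tendsto_nhds_unique l2 tendsto_const_nhds
  have := pow_pos p0 2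
  linarith

/-! ### Every trajectory consists of crossings of `R⁺` and of `R⁻` -/

/-- The time `t` belongs to a crossing of `R⁺`. -/
def CrossesAt (s : ℝ) [Fact (s ∈ Ioo (0 : ℝ) 1)] (m : ℝ) (I : Set ℝ) (τ : ℝ → Surface s)
    (t : ℝ) : Prop := ∃ a v z, Crosses s m I τ a v z ∧ t ∈ Icc a (a + s / v)

lemma rotNeg_rotNeg (τ : ℝ → Surface s) : (fun u => rot ((fun u => rot (τ (-u))) (-u))) = τ := by
  funext u; simp [rot_rot]

/-- At a boundary point of `R⁺` the curve follows a segment on one side only; moving to a nearby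
time on that side gives a two-sided germ. -/
lemma IsMaxTrajectory.crosses_of_eventually (hτ : IsMaxTrajectory s (1, m) I τ) {t : ℝ}
    (ht : t ∈ interior I) (hv : 0 < v) (hta : t ∈ Icc a (a + s / v))
    (h : (t < a + s / v ∧ ∀ᶠ u in 𝓝 t, t < u → τ u = segment s m a v z u) ∨
      (a < t ∧ ∀ᶠ u in 𝓝 t, u < t → τ u = segment s m a v z u)) : Crosses s m I τ a v z := by
  rcases h with ⟨h0, h⟩ | ⟨h0, h⟩
  · have h1 : ∀ᶠ u in 𝓝[>] t, (∀ᶠ w in 𝓝 u, t < w → τ w = segment s m a v z w) ∧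
        u ∈ interior I ∧ u < a + s / v ∧ t < u :=
      (h.eventually_nhds.filter_mono nhdsWithin_le_nhds).and
        (((isOpen_interior.eventually_mem ht).filter_mono nhdsWithin_le_nhds).and
          (((eventually_lt_nhds h0).filter_mono nhdsWithin_le_nhds).and self_mem_nhdsWithin))
    obtain ⟨u, k1, k2, k3, k4⟩ := h1.exists
    exact hτ.crosses hv k2 ⟨hta.1.trans_lt k4, k3⟩
      (by filter_upwards [k1, Ioi_mem_nhds k4] with w w1 w2 using w1 w2)
  · have h1 : ∀ᶠ u in 𝓝[<] t, (∀ᶠ w in 𝓝 u, w < t → τ w = segment s m a v z w) ∧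
        u ∈ interior I ∧ a < u ∧ u < t :=
      (h.eventually_nhds.filter_mono nhdsWithin_le_nhds).and
        (((isOpen_interior.eventually_mem ht).filter_mono nhdsWithin_le_nhds).and
          (((eventually_gt_nhds h0).filter_mono nhdsWithin_le_nhds).and self_mem_nhdsWithin))
    obtain ⟨u, k1, k2, k3, k4⟩ := h1.exists
    exact hτ.crosses hv k2 ⟨k3, k4.trans_le hta.2⟩
      (by filter_upwards [k1, Iio_mem_nhds k4] with w w1 w2 using w1 w2)

/-- The position decides which part of a crossing is met: on `E` it is the start, on the right side,
or the lower left side glued to it, the end, and otherwise a middle point. -/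
lemma IsMaxTrajectory.crossesAt_right (hτ : IsMaxTrajectory s (1, m) I τ) {t : ℝ}
    (ht : t ∈ interior I) {x y : ℝ} (hx : x ∈ Icc 0 s) (hy : y ∈ Icc (0 : ℝ) 1)
    (e : τ t = proj s (x, y)) : CrossesAt s m I τ t := by
  have p0 := s_pos (s := s)
  have p1 := s_lt_one (s := s)
  have hcont : ∀ C : ℝ, Tendsto (fun u : ℝ => C * (u - t)) (𝓝 t) (𝓝 0) := fun C => by
    have : Tendsto (fun u : ℝ => C * (u - t)) (𝓝 t) (𝓝 (C * (t - t))) :=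
      Continuous.tendsto (by fun_prop) t
    simpa using this
  have hreg := hτ.regular t ht
  rw [e, proj_mem_singularSet (mem_polygon_right hx hy), mem_vertices] at hreg
  have hstr := hτ.straight t ht
  have hside : ∀ y ∈ Ioo (0 : ℝ) 1, τ t = proj s (s, y) → CrossesAt s m I τ t := by
    intro y hy e
    have hw : (s, y) ∈ chartDomain s .A := by rw [mem_chartA]; grind
    obtain ⟨v, hv, h⟩ := hstr.lineGerm hw (by rw [e, param]; simp [chartFold])
    have hd := div_pos p0 hv
    have hta : t ∈ Icc (t - s / v) (t - s / v + s / v) := ⟨by linarith, by linarith⟩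
    refine ⟨t - s / v, v, y - m * s, hτ.crosses_of_eventually ht hv hta
      (Or.inr ⟨by linarith, ?_⟩), hta⟩
    filter_upwards [h, (hcont v).eventually (eventually_gt_nhds (show -s < 0 by linarith)),
      (hcont (m * v)).eventually (eventually_gt_nhds (show -y < 0 by linarith [hy.1])),
      (hcont (m * v)).eventually (eventually_lt_nhds (show 0 < 1 - y by linarith [hy.2]))]
      with u hu k1 k2 k3 hut
    have hu' : v * (u - t) ≤ 0 := mul_nonpos_of_nonneg_of_nonpos hv.le (by linarith)
    have e1 : v * (u - (t - s / v)) = s + v * (u - t) := by field_simp [hv.ne']; ring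
    have e2 : y - m * s + m * (s + v * (u - t)) = y + m * v * (u - t) := by ring
    rw [hu.2, segment, e1, e2, cyl_eq ⟨by linarith, by linarith⟩ ⟨by linarith, by linarith⟩, param]
    have : s + v * (u - t) ≤ s := by linarith
    simp only [chartFold, Prod.smul_mk, Prod.mk_add_mk, smul_eq_mul, mul_one, this, if_true]
    congr 2; ring
  rcases hx.1.eq_or_lt with h | h
  · subst h
    rcases lt_trichotomy y s with h | h | h
    · have hy0 : 0 < y := lt_of_le_of_ne hy.1 (by grind)
      refine hside (y / s) ⟨div_pos hy0 p0, (div_lt_one p0).2 h⟩ ?_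
      rw [e, proj_glue_A (div_pos hy0 p0).le ((div_lt_one p0).2 h).le, mul_div_cancel₀ _ p0.ne']
    · grind
    · have hy1 : y < 1 := lt_of_le_of_ne hy.2 (by grind)
      have hw : ((0 : ℝ), y) ∈ chartDomain s .interior := by rw [mem_chartI]; grind
      obtain ⟨v, hv, hg⟩ := hstr.lineGerm hw e
      have hta : t ∈ Icc t (t + s / v) := ⟨le_rfl, (lt_add_div s t hv).le⟩
      refine ⟨t, v, y, hτ.crosses_of_eventually ht hv hta
        (Or.inl ⟨lt_add_div s t hv, ?_⟩), hta⟩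
      filter_upwards [hg, (hcont v).eventually (eventually_lt_nhds (show 0 < s by linarith)),
        (hcont (m * v)).eventually (eventually_gt_nhds (show -y < 0 by linarith [hy.1])),
        (hcont (m * v)).eventually (eventually_lt_nhds (show 0 < 1 - y by linarith [hy.2]))]
        with u hu k1 k2 k3 hut
      have hu' : 0 < v * (u - t) := mul_pos hv (by linarith)
      have e2 : y + m * (v * (u - t)) = y + m * v * (u - t) := by ring
      rw [hu.2, segment, e2, cyl_eq ⟨by linarith, by linarith⟩ ⟨by linarith, by linarith⟩, param]
      simp only [chartFold, Prod.smul_mk, Prod.mk_add_mk, smul_eq_mul]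
      congr 2 <;> ring
  · rcases hx.2.eq_or_lt with h' | h'
    · subst h'
      exact hside y ⟨lt_of_le_of_ne hy.1 (by grind), lt_of_le_of_ne hy.2 (by grind)⟩ e
    · obtain ⟨c, w, hw, hc⟩ := exists_chart_cyl (s := s) ⟨h, h'⟩ y
      have hself := hc.self_of_nhds
      simp only [Prod.fst_zero, Prod.snd_zero, add_zero] at hself
      obtain ⟨v, hv, hg⟩ := hstr.lineGerm hw (by rw [e, ← hself, cyl_eq hx hy])
      have hta : t ∈ Ioo (t - x / v) (t - x / v + s / v) := by
        have := div_pos h hv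
        have := div_lt_div_of_pos_right h' hv
        constructor <;> linarith
      refine ⟨t - x / v, v, y - m * x, hτ.crosses hv ht hta ?_, ⟨hta.1.le, hta.2.le⟩⟩
      filter_upwards [hg, (tendsto_line 0 (1, m) v t).eventually hc] with u hu hu'
      rw [zero_add] at hu'
      rw [hu.2, ← hu', segment]
      have e1 : v * (u - (t - x / v)) = x + v * (u - t) := by field_simp [hv.ne']; ring
      rw [e1]
      simp only [Prod.smul_mk, smul_eq_mul]
      congr 1 <;> ring

lemma IsMaxTrajectory.crossesAt_of_interior (hτ : IsMaxTrajectory s (1, m) I τ) {t : ℝ}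
    (ht : t ∈ interior I) :
    CrossesAt s m I τ t ∨ CrossesAt s m (-I) (fun u => rot (τ (-u))) (-t) := by
  obtain ⟨⟨x, y⟩, hw, e⟩ := exists_proj_eq (τ t)
  rcases hw with hw | hw
  · exact Or.inl (hτ.crossesAt_right ht hw.1 hw.2 e.symm)
  · right
    refine hτ.rotNeg.crossesAt_right (x := -x) (y := 1 + s - y) (by
      rw [interior_neg_set]; simpa using ht) ?_ ?_ ?_
    · exact ⟨by linarith [hw.1.2], by linarith [hw.1.1]⟩
    · exact ⟨by linarith [hw.2.2], by linarith [hw.2.1]⟩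
    · simp only [neg_neg]
      rw [← e, rot_proj (Or.inr hw)]; rfl

lemma Crosses.crossesAt_isGreatest (h : Crosses s m I τ a v z)
    (hτ : IsMaxTrajectory s (1, m) I τ) {t : ℝ} (ht : IsGreatest I t) : CrossesAt s m I τ t := by
  rcases h.forward hτ with ⟨a', v', z', h1, h2, -⟩ | ⟨y, -, h1⟩
  · rw [ht.unique h2]
    exact ⟨a', v', z', h1, (lt_add_div s a' h1.pos).le, le_rfl⟩
  · exact absurd ht (h1.not_isGreatest t)

lemma IsMaxTrajectory.crossesAt_of_isGreatest (hτ : IsMaxTrajectory s (1, m) I τ) {t : ℝ}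
    (ht : IsGreatest I t) :
    CrossesAt s m I τ t ∨ CrossesAt s m (-I) (fun u => rot (τ (-u))) (-t) := by
  obtain ⟨u, hu⟩ := hτ.nondegenerate
  rcases hτ.crossesAt_of_interior hu with ⟨a, v, z, h, -⟩ | ⟨a, v, z, h, -⟩
  · exact Or.inl (h.crossesAt_isGreatest hτ ht)
  · have hl : IsLeast (-I) (-t) := ⟨by simpa using ht.1, fun w hw => by
      have := ht.2 hw; linarith⟩
    rcases h.backward hτ.rotNeg with ⟨a', v', z', h1, h2, -⟩ | ⟨a', v', z', hz, h1⟩ | ⟨b, y, -, h1⟩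
    · right
      rw [hl.unique h2]
      exact ⟨a', v', z', h1, le_rfl, (lt_add_div s a' h1.pos).le⟩
    · left
      have h2 := h1.across hτ.rotNeg hz
      rw [neg_neg, rotNeg_rotNeg] at h2
      exact h2.crossesAt_isGreatest hτ ht
    · exact absurd hl (h1.not_isLeast hτ.rotNeg.toIsTrajectory _)

lemma IsTrajectory.mem_interior_or {d : ℝ × ℝ} (hτ : IsTrajectory s d I τ) {t : ℝ} (ht : t ∈ I) :
    t ∈ interior I ∨ IsGreatest I t ∨ IsLeast I t := by
  by_contra! hcon
  obtain ⟨h1, h2, h3⟩ := hcon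
  have h4 : ∃ u ∈ I, t < u := by
    by_contra! h; exact h2 ⟨ht, h⟩
  have h5 : ∃ u ∈ I, u < t := by
    by_contra! h; exact h3 ⟨ht, h⟩
  obtain ⟨u, hu, htu⟩ := h4
  obtain ⟨w, hw, hwt⟩ := h5
  exact h1 (mem_interior_iff_mem_nhds.2 (mem_of_superset (Icc_mem_nhds hwt htu)
    (hτ.interval.out hw hu)))

lemma IsMaxTrajectory.crossesAt (hτ : IsMaxTrajectory s (1, m) I τ) {t : ℝ} (ht : t ∈ I) :
    CrossesAt s m I τ t ∨ CrossesAt s m (-I) (fun u => rot (τ (-u))) (-t) := by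
  rcases hτ.mem_interior_or ht with h | h | h
  · exact hτ.crossesAt_of_interior h
  · exact hτ.crossesAt_of_isGreatest h
  · have := hτ.rotNeg.crossesAt_of_isGreatest (t := -t) ⟨by simpa using ht, fun w hw => by
      have := h.2 hw; linarith⟩
    rw [neg_neg, neg_neg, rotNeg_rotNeg] at this
    exact this.symm

/-- At a non-singular end of a crossing the curve continues, by the next crossing, by the previous
one, or across `E`. So a point of the domain outside its interior is mapped to `Z`. -/
lemma Crosses.mem_interior (h : Crosses s m I τ a v z) (hτ : IsMaxTrajectory s (1, m) I τ) {t : ℝ}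
    (ht : t ∈ Icc a (a + s / v)) (hZ : τ t ∉ singularSet s) : t ∈ interior I := by
  have p0 := s_pos (s := s)
  have hlt := lt_add_div s a h.pos
  rcases hτ.mem_interior_or (h.subset ht) with h1 | h1 | h1
  · exact h1
  · exfalso
    obtain rfl : t = a + s / v := le_antisymm ht.2 (h1.2 h.right_mem)
    by_cases hy : Int.fract (z + m * s) = 0
    · refine hZ (h.isGreatest hτ (k := ⌊z + m * s⌋) ?_).2
      have := Int.fract_add_floor (z + m * s)
      rw [← this, hy, zero_add, Int.floor_intCast]
    · have h2 := h.next hτ (y := Int.fract (z + m * s))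
        ⟨lt_of_le_of_ne (Int.fract_nonneg _) (Ne.symm hy), Int.fract_lt_one _⟩
        (k := ⌊z + m * s⌋) (Int.fract_add_floor _).symm
      exact absurd (h1.2 h2.right_mem) (not_le.2 (lt_add_div s _ h2.pos))
  · exfalso
    obtain rfl : t = a := le_antisymm (h1.2 h.left_mem) ht.1
    have h2 := h.fract
    have k1 := Int.fract_nonneg z
    have k2 := Int.fract_lt_one z
    set ζ := Int.fract z
    by_cases e0 : ζ = 0 ∨ ζ = s
    · exact hZ (h2.isLeast hτ e0).2
    · push Not at e0
      rcases lt_or_ge ζ s with h3 | h3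
      · rw [← mul_div_cancel₀ ζ p0.ne'] at h2
        have h4 := h2.prev hτ ⟨div_pos (lt_of_le_of_ne k1 e0.1.symm) p0, (div_lt_one p0).2 h3⟩
          (z' := ζ / s - m * s) (k := 0) (by simp)
        have := lt_add_div s (t - s / (v / s)) h4.pos
        rw [sub_add_cancel] at this
        exact absurd (h1.2 h4.left_mem) (not_le.2 this)
      · have h4 := h2.across hτ ⟨lt_of_le_of_ne h3 e0.2.symm, k2⟩
        have h5 := h1.2 h4.right_mem
        have := lt_add_div s (-t) h4.pos
        linarith

lemma IsMaxTrajectory.mem_interior (hτ : IsMaxTrajectory s (1, m) I τ) {t : ℝ} (ht : t ∈ I)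
    (hZ : τ t ∉ singularSet s) : t ∈ interior I := by
  rcases hτ.crossesAt ht with ⟨a, v, z, h, h1⟩ | ⟨a, v, z, h, h1⟩
  · exact h.mem_interior hτ h1 hZ
  · have := h.mem_interior hτ.rotNeg h1 (by
      rw [rot_mem_singularSet, neg_neg]; exact hZ)
    rw [interior_neg_set] at this
    simpa using this

end


/-! ### The invariant set over a set of heights -/

section
variable {s : ℝ} [hs : Fact (s ∈ Ioo (0 : ℝ) 1)]

/-- Since `bump` vanishes only on the two ends of the cylinder, the other point also lies over the
open strip, where points equal their normal forms. -/
lemma cyl_inj {x x' y y' : ℝ} (hx : x ∈ Ioo 0 s) (hx' : x' ∈ Icc 0 s)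
    (e : cyl s x y = cyl s x' y') : x = x' ∧ ∃ k : ℤ, y = y' + k := by
  have p0 := s_pos (s := s)
  have hxc : x ∈ Icc 0 s := ⟨hx.1.le, hx.2.le⟩
  have hb := congrArg bump e
  rw [bump_cyl hxc, bump_cyl hx'] at hb
  have hpos : 0 < x * (s - x) := mul_pos hx.1 (by linarith [hx.2])
  have h0 : x' ≠ 0 := fun h => by rw [h] at hb; linarith
  have h1 : x' ≠ s := fun h => by rw [h] at hb; linarith
  have hxo : x' ∈ Ioo 0 s := ⟨lt_of_le_of_ne hx'.1 h0.symm, lt_of_le_of_ne hx'.2 h1⟩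
  have key : ∀ u ∈ Ioo 0 s, ∀ w, (u, Int.fract w) ∈ polygon s ∧
      normalForm s (u, Int.fract w) = (u, Int.fract w) := by
    intro u hu w
    have k1 := Int.fract_lt_one w
    have hm := mem_polygon_right (s := s) (x := u) ⟨hu.1.le, hu.2.le⟩
      ⟨Int.fract_nonneg w, k1.le⟩
    refine ⟨hm, normalForm_self hm (fun hv => ?_) (fun h => absurd h hu.1.ne') (fun _ => k1.ne)
      (fun h => absurd h hu.1.not_gt)⟩
    rw [mem_vertices] at hv
    obtain ⟨hu1, hu2⟩ := hu
    grind
  rw [cyl_eq_fract hxc, cyl_eq_fract hx', proj_eq_iff (key x hx y).1 (key x' hxo y').1,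
    (key x hx y).2, (key x' hxo y').2, Prod.mk.injEq] at e
  refine ⟨e.1, ⌊y⌋ - ⌊y'⌋, ?_⟩
  have h2 := Int.fract_add_floor y
  have h3 := Int.fract_add_floor y'
  push_cast; linarith [e.2]

lemma left_low_mem {y : ℝ} (hy : y ∈ Icc (0 : ℝ) 1) : s * y ∈ Icc (0 : ℝ) s :=
  ⟨mul_nonneg s_pos.le hy.1, mul_le_of_le_one_right s_pos.le hy.2⟩

lemma cyl_left_low {y : ℝ} (hy : y ∈ Icc (0 : ℝ) 1) : cyl s 0 (s * y) = proj s (0, s * y) := by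
  have p0 := s_pos (s := s)
  have p1 := s_lt_one (s := s)
  have := left_low_mem (s := s) hy
  exact cyl_eq ⟨le_rfl, p0.le⟩ ⟨this.1, this.2.trans p1.le⟩

lemma left_low_mem_polygon {y : ℝ} (hy : y ∈ Icc (0 : ℝ) 1) : (0, s * y) ∈ polygon s := by
  have p0 := s_pos (s := s)
  have p1 := s_lt_one (s := s)
  have := left_low_mem (s := s) hy
  exact mem_polygon_right ⟨le_rfl, p0.le⟩ ⟨this.1, this.2.trans p1.le⟩

lemma normalForm_left_low' {y : ℝ} (hy : y ∈ Ioo (0 : ℝ) 1) :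
    normalForm s (0, s * y) = (s, y) := by
  have p0 := s_pos (s := s)
  rw [normalForm_left_low (mul_pos p0 hy.1) (mul_lt_of_lt_one_right p0 hy.2),
    mul_div_cancel_left₀ _ p0.ne']

lemma cyl_left_low_mem_singularSet {y : ℝ} (hy : y ∈ Icc (0 : ℝ) 1) :
    cyl s 0 (s * y) ∈ singularSet s ↔ y = 0 ∨ y = 1 := by
  have p0 := s_pos (s := s)
  have p1 := s_lt_one (s := s)
  have h1 := left_low_mem (s := s) hy
  rw [cyl_mem_singularSet ⟨le_rfl, p0.le⟩, Int.fract_eq_self.2 ⟨h1.1, h1.2.trans_lt p1⟩]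
  have e1 : s * y = 0 ↔ y = 0 := by simp [p0.ne']
  have e2 : s * y = s ↔ y = 1 := by
    rw [mul_eq_left₀ p0.ne']
  rw [e1, e2]
  have := p0.ne
  simp [this]

lemma normalForm_left_low_end {y : ℝ} (hy : y = 0 ∨ y = 1) : normalForm s (0, s * y) = (0, 0) := by
  apply normalForm_vertex
  rw [mem_vertices]
  rcases hy with rfl | rfl <;> simp

lemma cyl_left_low_inj {y y' : ℝ} (hy : y ∈ Ioo (0 : ℝ) 1) (hy' : y' ∈ Icc (0 : ℝ) 1)
    (e : cyl s 0 (s * y) = cyl s 0 (s * y')) : y = y' := by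
  have p0 := s_pos (s := s)
  have hyc : y ∈ Icc (0 : ℝ) 1 := ⟨hy.1.le, hy.2.le⟩
  rw [cyl_left_low hyc, cyl_left_low hy',
    proj_eq_iff (left_low_mem_polygon hyc) (left_low_mem_polygon hy'), normalForm_left_low' hy] at e
  rcases hy'.1.eq_or_lt with h | h
  · rw [normalForm_left_low_end (Or.inl h.symm)] at e
    exact absurd (congrArg Prod.fst e) p0.ne'
  · rcases hy'.2.eq_or_lt with h1 | h1
    · rw [normalForm_left_low_end (Or.inr h1)] at e
      exact absurd (congrArg Prod.fst e) p0.ne'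
    · rw [normalForm_left_low' ⟨h, h1⟩] at e
      exact congrArg Prod.snd e

lemma normalForm_left_low_fst {y : ℝ} (hy : y ∈ Icc (0 : ℝ) 1) :
    normalForm s (0, s * y) = (0, 0) ∨ (normalForm s (0, s * y)).1 = s := by
  rcases hy.1.eq_or_lt with h | h
  · exact Or.inl (normalForm_left_low_end (Or.inl h.symm))
  · rcases hy.2.eq_or_lt with h1 | h1
    · exact Or.inl (normalForm_left_low_end (Or.inr h1))
    · exact Or.inr (by rw [normalForm_left_low' ⟨h, h1⟩])

lemma cyl_edge_ne {z y : ℝ} (hz : z ∈ Ioo s 1) (hy : y ∈ Icc (0 : ℝ) 1) :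
    cyl s 0 z ≠ cyl s 0 (s * y) := by
  have p0 := s_pos (s := s)
  obtain ⟨hz0, hz1⟩ := hz
  have hm := mem_polygon_right (s := s) (x := 0) (y := z) ⟨le_rfl, p0.le⟩ ⟨by linarith, hz1.le⟩
  rw [cyl_eq ⟨le_rfl, p0.le⟩ ⟨by linarith, hz1.le⟩, cyl_left_low hy, Ne,
    proj_eq_iff hm (left_low_mem_polygon hy), normalForm_self hm (by
      rw [mem_vertices]; grind) (fun _ => ⟨hz0, hz1⟩) (fun h => absurd h (lt_irrefl _))
      (fun h => absurd h (lt_irrefl _))]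
  intro e
  rcases normalForm_left_low_fst (s := s) hy with h | h
  · rw [h] at e
    have := congrArg Prod.snd e
    simp only at this; linarith
  · rw [← e] at h; exact p0.ne h

lemma rot_left_low_mem_singularSet {y y' : ℝ} (hy : y ∈ Icc (0 : ℝ) 1) (hy' : y' ∈ Icc (0 : ℝ) 1)
    (e : rot (cyl s 0 (s * y')) = cyl s 0 (s * y)) : cyl s 0 (s * y) ∈ singularSet s := by
  have p0 := s_pos (s := s)
  by_contra hZ
  have h1 : ¬ (y' = 0 ∨ y' = 1) := by
    rwa [← cyl_left_low_mem_singularSet (s := s) hy', ← rot_mem_singularSet, e]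
  push Not at h1
  have h2 := mul_pos p0 (lt_of_le_of_ne hy'.1 h1.1.symm)
  have h3 := mul_lt_of_lt_one_right p0 (lt_of_le_of_ne hy'.2 h1.2)
  have hm := left_low_mem_polygon (s := s) hy'
  have hm' := planeRot_mem hm
  have e1 : planeRot s (0, s * y') = (0, 1 + s - s * y') := by simp [planeRot]
  rw [cyl_left_low hy, cyl_left_low hy', rot_proj hm,
    proj_eq_iff hm' (left_low_mem_polygon hy), e1,
    normalForm_right_high (by linarith) (by linarith)] at e
  rcases normalForm_left_low_fst (s := s) hy with h | h
  · rw [h] at e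
    have := congrArg Prod.fst e
    simp only at this; linarith
  · rw [← e] at h
    simp only at h; linarith

/-- The union of the segments of slope `m` that cross `R⁺` from the heights `s * κ`, `κ ∈ K`. -/
noncomputable def sheet (s : ℝ) [Fact (s ∈ Ioo (0 : ℝ) 1)] (m : ℝ) (K : Set ℝ) : Set (Surface s) :=
  (fun p : ℝ × ℝ => cyl s p.1 (s * p.2 + m * p.1)) '' (Icc 0 s ×ˢ K)

variable {m : ℝ} {I : Set ℝ} {τ : ℝ → Surface s} {a v z : ℝ} {K : Set ℝ}

lemma continuous_sheet_map (m : ℝ) :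
    Continuous fun p : ℝ × ℝ => cyl s p.1 (s * p.2 + m * p.1) :=
  continuous_cyl.comp (f := fun p : ℝ × ℝ => (p.1, s * p.2 + m * p.1)) (by fun_prop)

lemma cyl_mem_sheet {x κ : ℝ} (hx : x ∈ Icc 0 s) (hκ : κ ∈ K) :
    cyl s x (s * κ + m * x) ∈ sheet s m K := ⟨(x, κ), ⟨hx, hκ⟩, rfl⟩

lemma left_mem_sheet {κ : ℝ} (hκ : κ ∈ K) : cyl s 0 (s * κ) ∈ sheet s m K := by
  simpa using cyl_mem_sheet (s := s) (m := m) ⟨le_rfl, s_pos.le⟩ hκ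

lemma isCompact_sheet (m : ℝ) (hK : IsCompact K) : IsCompact (sheet s m K) :=
  (isCompact_Icc.prod hK).image (continuous_sheet_map m)

lemma isClosed_sheet (m : ℝ) (hK : IsCompact K) : IsClosed (sheet s m K) :=
  (isCompact_sheet m hK).isClosed

lemma cyl_mem_sheet_iff {x y : ℝ} (hx : x ∈ Ioo 0 s) :
    cyl s x y ∈ sheet s m K ↔ ∃ κ ∈ K, ∃ k : ℤ, y = s * κ + m * x + k := by
  constructor
  · rintro ⟨⟨x', κ⟩, ⟨hx', hκ⟩, e⟩
    obtain ⟨rfl, k, hk⟩ := cyl_inj hx hx' e.symm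
    exact ⟨κ, hκ, k, hk⟩
  · rintro ⟨κ, hκ, k, rfl⟩
    rw [cyl_add_int]
    exact cyl_mem_sheet ⟨hx.1.le, hx.2.le⟩ hκ

lemma bump_eq_zero_iff {x : ℝ} (hx : x ∈ Icc 0 s) (y : ℝ) :
    bump (cyl s x y) = 0 ↔ x = 0 ∨ x = s := by
  rw [bump_cyl hx, mul_eq_zero, sub_eq_zero, eq_comm (a := s)]

/-- The points of the sheet on the left side of `R⁺`. -/
lemma exists_left_of_mem_sheet {q : Surface s} (hA : IsCircleAttractor s (s * m) K)
    (hq : q ∈ sheet s m K) (hb : bump q = 0) : q ∈ singularSet s ∨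
      ∃ y ∈ K, q = cyl s 0 (s * y) := by
  have p0 := s_pos (s := s)
  by_cases hZ : q ∈ singularSet s
  · exact Or.inl hZ
  right
  obtain ⟨⟨x, κ⟩, ⟨hx, hκ⟩, rfl⟩ := hq
  simp only at hx hκ hb hZ ⊢
  rcases (bump_eq_zero_iff hx _).1 hb with rfl | rfl
  · exact ⟨κ, hκ, by simp⟩
  · rw [cyl_right] at hZ ⊢
    refine ⟨_, ?_, rfl⟩
    rw [mul_comm m]
    refine hA.forward κ hκ fun n hn => hZ ?_
    rw [mul_comm m, hn, Int.fract_intCast, mul_zero,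
      cyl_mem_singularSet ⟨le_rfl, p0.le⟩]
    simp

lemma left_mem_sheet_iff {y : ℝ} (hA : IsCircleAttractor s (s * m) K) (hy : y ∈ Ioo (0 : ℝ) 1) :
    cyl s 0 (s * y) ∈ sheet s m K ↔ y ∈ K := by
  refine ⟨fun h => ?_, left_mem_sheet⟩
  rcases exists_left_of_mem_sheet hA h ((bump_eq_zero_iff ⟨le_rfl, s_pos.le⟩ _).2 (Or.inl rfl))
    with h1 | ⟨y', h1, h2⟩
  · rw [cyl_left_low_mem_singularSet ⟨hy.1.le, hy.2.le⟩] at h1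
    rcases h1 with h1 | h1
    exacts [absurd h1 hy.1.ne', absurd h1 hy.2.ne]
  · rwa [cyl_left_low_inj hy (hA.subset h1) h2]

lemma edge_notMem_sheet (hA : IsCircleAttractor s (s * m) K) (hz : z ∈ Ioo s 1) :
    cyl s 0 z ∉ sheet s m K := by
  have p0 := s_pos (s := s)
  intro h
  rcases exists_left_of_mem_sheet hA h ((bump_eq_zero_iff ⟨le_rfl, p0.le⟩ _).2 (Or.inl rfl))
    with h1 | ⟨y', h1, h2⟩
  · rw [cyl_mem_singularSet ⟨le_rfl, p0.le⟩,
      Int.fract_eq_self.2 ⟨by linarith [hz.1], hz.2⟩] at h1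
    obtain ⟨hz0, hz1⟩ := hz
    grind
  · exact cyl_edge_ne hz (hA.subset h1) h2

/-- Common points lie on the lower left side of `R⁺` and on its rotated copy. These sides are
different in the surface and meet only in `Z`. -/
lemma sheet_inter_rot (hA : IsCircleAttractor s (s * m) K) {K' : Set ℝ}
    (hA' : IsCircleAttractor s (s * m) K') :
    sheet s m K ∩ rot '' sheet s m K' ⊆ singularSet s := by
  rintro q ⟨h1, q', h2, rfl⟩
  have hb : ∀ {K : Set ℝ} {q : Surface s}, q ∈ sheet s m K → bump (rot q) = 0 := by
    rintro K _ ⟨⟨x, κ⟩, ⟨hx, hκ⟩, rfl⟩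
    exact bump_rot_cyl hx _
  have hb' := hb h1
  rw [rot_rot] at hb'
  rcases exists_left_of_mem_sheet hA h1 (hb h2) with h3 | ⟨y, h3, h4⟩
  · exact h3
  rcases exists_left_of_mem_sheet hA' h2 hb' with h5 | ⟨y', h5, h6⟩
  · exact rot_mem_singularSet.2 h5
  rw [h6] at h4
  rw [h6, h4]
  exact rot_left_low_mem_singularSet (hA.subset h3) (hA'.subset h5) h4

lemma bump_rot_of_mem_sheet {q : Surface s} (hq : q ∈ sheet s m K) : bump (rot q) = 0 := by
  obtain ⟨⟨x, κ⟩, ⟨hx, hκ⟩, rfl⟩ := hq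
  exact bump_rot_cyl hx _

lemma Crosses.mem_sheet {κ : ℝ} (h : Crosses s m I τ a v (s * κ)) (hκ : κ ∈ K) {t : ℝ}
    (ht : t ∈ Icc a (a + s / v)) : τ t ∈ sheet s m K := by
  rw [h.eqOn ht, segment]
  exact cyl_mem_sheet (mul_sub_mem_Icc h.pos ht) hκ

/-- The half-open interval counts an end of a crossing as the start of the next one, so each
non-singular point of the sheet belongs to a crossing whose height is given by a point of `K`. -/
lemma IsMaxTrajectory.crosses_of_mem_sheet (hτ : IsMaxTrajectory s (1, m) I τ)
    (hA : IsCircleAttractor s (s * m) K) {t : ℝ} (ht : t ∈ I) (hZ : τ t ∉ singularSet s)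
    (hS : τ t ∈ sheet s m K) : ∃ a v, ∃ κ ∈ K, Crosses s m I τ a v (s * κ) ∧
      t ∈ Ico a (a + s / v) ∧ (t = a → κ ∈ Ioo (0 : ℝ) 1) := by
  have p0 := s_pos (s := s)
  have hti := hτ.mem_interior ht hZ
  obtain ⟨a, v, z, h, hta⟩ : CrossesAt s m I τ t := by
    obtain ⟨⟨x, κ⟩, ⟨hx, hκ⟩, e⟩ := hS
    refine hτ.crossesAt_right hti hx (y := Int.fract (s * κ + m * x))
      ⟨Int.fract_nonneg _, (Int.fract_lt_one _).le⟩ ?_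
    rw [← e]; exact cyl_eq_fract hx _
  have hleft : ∀ a v y, Crosses s m I τ a v (s * y) → t = a → y ∈ Ioo (0 : ℝ) 1 →
      ∃ a v, ∃ κ ∈ K, Crosses s m I τ a v (s * κ) ∧
      t ∈ Ico a (a + s / v) ∧ (t = a → κ ∈ Ioo (0 : ℝ) 1) := by
    rintro a v y h rfl hy
    refine ⟨t, v, y, ?_, h, ⟨le_rfl, lt_add_div s t h.pos⟩, fun _ => hy⟩
    rwa [h.apply_left, left_mem_sheet_iff hA hy] at hS
  rcases hta.1.eq_or_lt with h1 | h1
  · subst h1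
    have h2 := h.fract
    have k1 := Int.fract_nonneg z
    have k2 := Int.fract_lt_one z
    set ζ := Int.fract z
    rw [h2.apply_left] at hS
    have hZ' := hZ
    rw [h2.apply_left, cyl_mem_singularSet ⟨le_rfl, p0.le⟩, Int.fract_eq_self.2 ⟨k1, k2⟩] at hZ'
    have h0 : ζ ≠ 0 := by grind
    have h3 : ζ ≠ s := by grind
    have h4 : ¬ s < ζ := fun h => edge_notMem_sheet hA ⟨h, k2⟩ hS
    have h5 : ζ < s := lt_of_le_of_ne (not_lt.1 h4) h3
    rw [← mul_div_cancel₀ ζ p0.ne'] at h2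
    exact hleft a v _ h2 rfl ⟨div_pos (lt_of_le_of_ne k1 h0.symm) p0, (div_lt_one p0).2 h5⟩
  rcases hta.2.eq_or_lt with h2 | h2
  · by_cases hy : Int.fract (z + m * s) = 0
    · refine absurd (h.isGreatest hτ (k := ⌊z + m * s⌋) ?_).2 (h2 ▸ hZ)
      have := Int.fract_add_floor (z + m * s)
      rw [← this, hy, zero_add, Int.floor_intCast]
    · have hy' : Int.fract (z + m * s) ∈ Ioo (0 : ℝ) 1 :=
        ⟨lt_of_le_of_ne (Int.fract_nonneg _) (Ne.symm hy), Int.fract_lt_one _⟩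
      exact hleft _ _ _ (h.next hτ hy' (k := ⌊z + m * s⌋) (Int.fract_add_floor _).symm) h2 hy'
  · have hS' := hS
    rw [h.eqOn hta, segment, cyl_mem_sheet_iff (mul_sub_mem_Ioo h.pos ⟨h1, h2⟩)] at hS'
    obtain ⟨κ, hκ, k, hk⟩ := hS'
    exact ⟨a, v, κ, hκ, h.congr_height (k := -k) (by push_cast; linarith), ⟨h1.le, h2⟩,
      fun h => absurd h h1.ne'⟩

/-- The sheet over an invariant set is a union of maximal trajectories. -/
lemma IsMaxTrajectory.mem_sheet (hτ : IsMaxTrajectory s (1, m) I τ)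
    (hA : IsCircleAttractor s (s * m) K) {t : ℝ} (ht : t ∈ I) (hZ : τ t ∉ singularSet s)
    (hS : τ t ∈ sheet s m K) : ∀ u ∈ I, τ u ∈ sheet s m K := by
  have hcl := isClosed_sheet (s := s) m hA.compact
  have hti := hτ.mem_interior ht hZ
  have hci : ContinuousOn τ (interior I) := hτ.continuous.mono interior_subset
  -- At the start of a crossing backward invariance of `K` puts the preceding crossing in the sheet
  -- as well, so times in the sheet form an open set; closedness of the sheet and connectedness
  -- finish the argument.
  have hop : ∀ u ∈ interior I, τ u ∈ sheet s m K → u ∈ interior (τ ⁻¹' sheet s m K) := by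
    intro u hu huS
    obtain ⟨a, v, κ, hκ, h, hua, hκ'⟩ := hτ.crosses_of_mem_sheet hA (interior_subset hu)
      (hτ.regular u hu) huS
    rw [mem_interior_iff_mem_nhds]
    rcases hua.1.eq_or_lt with h1 | h1
    · obtain ⟨κ', h2, n, h3⟩ := hA.backward κ hκ (hκ' h1.symm)
      have h4 := h.prev hτ (hκ' h1.symm) (z' := s * κ') (k := n) (by rw [← h3]; ring)
      have h5 : a - s / (v / s) < a := by
        have := lt_add_div s (a - s / (v / s)) h4.pos
        rwa [sub_add_cancel] at this
      refine mem_of_superset (Ioo_mem_nhds (h5.trans_eq h1) hua.2) fun w hw => ?_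
      rcases le_total w a with h6 | h6
      · exact h4.mem_sheet h2 ⟨hw.1.le, by rwa [sub_add_cancel]⟩
      · exact h.mem_sheet hκ ⟨h6, hw.2.le⟩
    · exact mem_of_superset (Ioo_mem_nhds h1 hua.2) fun w hw => h.mem_sheet hκ ⟨hw.1.le, hw.2.le⟩
  have key : interior I ⊆ interior (τ ⁻¹' sheet s m K) := by
    refine (hτ.interval.convex (𝕜 := ℝ)).interior.isPreconnected.subset_of_closure_inter_subset
      isOpen_interior ⟨t, hti, hop t hti hS⟩ ?_
    rintro u ⟨hu, hui⟩
    refine hop u hui ?_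
    have h1 : ContinuousAt τ u := hci.continuousAt (isOpen_interior.mem_nhds hui)
    by_contra hcon
    have h2 := h1.eventually (hcl.isOpen_compl.mem_nhds hcon)
    obtain ⟨w, hw, hw'⟩ := ((mem_closure_iff_frequently.1 hu).and_eventually h2).exists
    exact hw' (interior_subset (s := τ ⁻¹' sheet s m K) hw)
  have h1 : MapsTo τ (interior I) (sheet s m K) := fun u hu =>
    interior_subset (s := τ ⁻¹' sheet s m K) (key hu)
  intro u hu
  have h2 : I ⊆ closure (interior I) := by
    rw [(hτ.interval.convex (𝕜 := ℝ)).closure_interior_eq_closure_of_nonempty_interior ⟨t, hti⟩]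
    exact subset_closure
  have h3 : τ u ∈ closure (τ '' interior I) :=
    ((hτ.continuous u hu).mono interior_subset).mem_closure_image (h2 hu)
  exact hcl.closure_subset_iff.2 h1.image_subset h3

lemma exists_crosses (m a z : ℝ) {v : ℝ} (hv : 0 < v) :
    ∃ I τ, IsMaxTrajectory s (1, m) I τ ∧ Crosses s m I τ a v z := by
  obtain ⟨I, τ, h1, h2, h3⟩ :=
    (isTrajectory_segment (s := s) m a z hv).exists_max (dir_ne_zero m)
  exact ⟨I, τ, h1, hv, h2, h3⟩

lemma Crosses.mid (h : Crosses s m I τ a v z) : a + s / v / 2 ∈ Ioo a (a + s / v) := by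
  have := div_pos (s_pos (s := s)) h.pos
  constructor <;> linarith

lemma Crosses.mid_notMem (h : Crosses s m I τ a v z) : τ (a + s / v / 2) ∉ singularSet s := by
  rw [h.eqOn ⟨h.mid.1.le, h.mid.2.le⟩]
  exact segment_notMem h.pos h.mid

lemma Crosses.image_subset_sheet {κ : ℝ} (h : Crosses s m I τ a v (s * κ)) (hκ : κ ∈ K)
    (hτ : IsMaxTrajectory s (1, m) I τ) (hA : IsCircleAttractor s (s * m) K) :
    ∀ u ∈ I, τ u ∈ sheet s m K :=
  hτ.mem_sheet hA (h.subset ⟨h.mid.1.le, h.mid.2.le⟩) h.mid_notMem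
    (h.mem_sheet hκ ⟨h.mid.1.le, h.mid.2.le⟩)

/-- To approximate a sheet it suffices to approximate the heights in `K` and to use points over the
open strip, where no singularity occurs. -/
lemma closure_subset_sheet {A : Set ℝ} (m : ℝ) {W : Set (Surface s)}
    (hKA : K ⊆ closure A)
    (hW : ∀ x ∈ Ioo 0 s, ∀ y ∈ A, cyl s x (s * y + m * x) ∈ W) : sheet s m K ⊆ closure W := by
  have p0 := s_pos (s := s)
  have h1 : Icc 0 s ×ˢ K ⊆ closure (Ioo 0 s ×ˢ A) := by
    rw [closure_prod_eq, closure_Ioo p0.ne]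
    exact prod_mono le_rfl hKA
  refine (image_mono h1).trans ((image_closure_subset_closure_image
    (continuous_sheet_map m)).trans (closure_mono ?_))
  rintro _ ⟨⟨x, y⟩, ⟨hx, hy⟩, rfl⟩
  exact hW x hx y hy

lemma closure_sheet_diff (m : ℝ) (hK : IsCompact K) :
    closure (sheet s m K \ singularSet s) = sheet s m K := by
  refine Subset.antisymm ((isClosed_sheet m hK).closure_subset_iff.2 sdiff_subset) ?_
  exact closure_subset_sheet m subset_closure fun x hx y hy =>
    ⟨cyl_mem_sheet ⟨hx.1.le, hx.2.le⟩ hy, cyl_notMem_singularSet hx _⟩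

/-! ### Attraction -/

/-- The tube lemma turns a neighbourhood of the sheet into a uniform tolerance in the initial
height. -/
lemma exists_pos_of_sheet_subset (hA : IsCircleAttractor s (s * m) K) {V : Set (Surface s)}
    (hV : IsOpen V) (hKV : sheet s m K ⊆ V) : ∃ ε > 0, ∀ y, Metric.infDist y K < ε →
      ∀ x ∈ Icc 0 s, cyl s x (s * y + m * x) ∈ V := by
  obtain ⟨u, w, -, h2, h3, h4, h5⟩ := generalized_tube_lemma isCompact_Icc hA.compact
    (hV.preimage (continuous_sheet_map m)) (image_subset_iff.1 hKV)
  obtain ⟨ε, hε, h6⟩ := hA.compact.exists_thickening_subset_open h2 h4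
  refine ⟨ε, hε, fun y hy x hx => ?_⟩
  have : y ∈ w := h6 ((Metric.mem_thickening_iff_infDist_lt hA.nonempty).2 hy)
  exact h5 (show (x, y) ∈ u ×ˢ w from ⟨h3 hx, this⟩)

lemma ForwardChain.infDist_le {y : ℕ → ℝ} (h : ForwardChain s m I τ a v y)
    (hA : IsCircleAttractor s (s * m) K) (n : ℕ) : Metric.infDist (y (n + 1)) K ≤ s ^ n :=
  hA.attracts n (fun j => y (j + 1)) (fun j _ => h.mem j) (fun j _ => h.step (j + 1))

lemma ForwardChain.eventuallyIn {y : ℕ → ℝ} (h : ForwardChain s m I τ a v y)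
    (hA : IsCircleAttractor s (s * m) K) {V : Set (Surface s)} (hV : IsOpen V)
    (hKV : sheet s m K ⊆ V) : EventuallyIn I τ V := by
  obtain ⟨ε, hε, h1⟩ := exists_pos_of_sheet_subset hA hV hKV
  obtain ⟨N, hN⟩ := exists_pow_lt_of_lt_one hε (s_lt_one (s := s))
  refine ⟨crossTime s a v (N + 1), (h.crosses _).left_mem, fun t ht htt => ?_⟩
  obtain ⟨n, hn, htn⟩ := h.exists_mem (N + 1) htt.le
  obtain ⟨n, rfl⟩ := Nat.exists_eq_add_of_le' (show 1 ≤ n by omega)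
  rw [(h.crosses _).eqOn htn, segment]
  refine h1 _ ((h.infDist_le hA n).trans_lt (lt_of_le_of_lt ?_ hN)) _
    (mul_sub_mem_Icc (h.crosses _).pos htn)
  exact pow_le_pow_of_le_one s_pos.le s_lt_one.le (by omega)

/-- A height with regular predecessors of every order `N` is within `s ^ N` of the attractor. -/
lemma BackwardChain.mem_attractor {b y : ℕ → ℝ} (h : BackwardChain s m I τ b v y)
    (hA : IsCircleAttractor s (s * m) K) (n : ℕ) : y n ∈ K := by
  have h1 : ∀ N, Metric.infDist (y n) K ≤ s ^ N := fun N => by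
    have := hA.attracts N (fun j => y (n + (N - j))) (fun j _ => h.mem _) (fun j hj => by
      have := h.step (n + (N - (j + 1)))
      rwa [show n + (N - (j + 1)) + 1 = n + (N - j) by omega] at this)
    simpa using this
  have h2 : Metric.infDist (y n) K ≤ 0 :=
    ge_of_tendsto (tendsto_pow_atTop_nhds_zero_of_lt_one s_pos.le s_lt_one)
      (Eventually.of_forall h1)
  rw [← hA.compact.isClosed.closure_eq, Metric.mem_closure_iff_infDist_zero hA.nonempty]
  exact le_antisymm h2 Metric.infDist_nonneg

/-- The future of a trajectory: it ends in the singularity, or crosses `R⁺` for ever, or stays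
in `R⁻` for ever. -/
lemma IsMaxTrajectory.future (hτ : IsMaxTrajectory s (1, m) I τ) {t : ℝ} (ht : t ∈ I) :
    (∃ u, IsGreatest I u ∧ τ u ∈ singularSet s) ∨
    (∃ a v y, ForwardChain s m I τ a v y) ∨
    ∃ b v y, BackwardChain s m (-I) (fun u => rot (τ (-u))) b v y ∧
      -t ∈ Icc (b 0) (b 0 + s / v) := by
  have hR : ∀ {a v z}, Crosses s m I τ a v z → (∃ u, IsGreatest I u ∧ τ u ∈ singularSet s) ∨
    (∃ a v y, ForwardChain s m I τ a v y) ∨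
    ∃ b v y, BackwardChain s m (-I) (fun u => rot (τ (-u))) b v y ∧
      -t ∈ Icc (b 0) (b 0 + s / v) := by
    intro a v z h
    rcases h.forward hτ with ⟨a', v', z', -, h1, h2⟩ | ⟨y, -, h1⟩
    · exact Or.inl ⟨_, h1, h2⟩
    · exact Or.inr (Or.inl ⟨_, _, _, h1⟩)
  rcases hτ.crossesAt ht with ⟨a, v, z, h, -⟩ | ⟨a, v, z, h, h0⟩
  · exact hR h
  · rcases h.backward hτ.rotNeg with ⟨a', v', z', h1, h2, h3⟩ | ⟨a', v', z', hz, h1⟩ | ⟨b, y, e, h1⟩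
    · refine Or.inl ⟨-a', ⟨h2.1, fun w hw => ?_⟩, rot_mem_singularSet.1 h3⟩
      have := h2.2 (show -w ∈ -I by simpa using hw)
      linarith
    · have h2 := h1.across hτ.rotNeg hz
      rw [neg_neg, rotNeg_rotNeg] at h2
      exact hR h2
    · exact Or.inr (Or.inr ⟨b, v, y, h1, e ▸ h0⟩)

lemma eventuallyIn_of_isGreatest {u : ℝ} (hu : IsGreatest I u) (V : Set (Surface s)) :
    EventuallyIn I τ V := ⟨u, hu.1, fun _ ht h => absurd (hu.2 ht) (not_le.2 h)⟩

/-- A trajectory that neither ends in `Z` nor crosses `R⁺` for ever stays in `R⁻`. Rotated and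
reversed it is an infinite backward chain, whose heights lie in `K`, so its starting point lies in
the rotated sheet. -/
lemma attracts_sheet (hA : IsCircleAttractor s (s * m) K) :
    Attracts s (1, m) (rot '' sheet s m K)ᶜ (sheet s m K \ singularSet s) := by
  intro V hV hKV I τ hτ h0 hU
  rw [closure_sheet_diff m hA.compact] at hKV
  rcases hτ.future h0 with ⟨u, hu, -⟩ | ⟨a, v, y, h⟩ | ⟨b, v, y, h, hm⟩
  · exact eventuallyIn_of_isGreatest hu V
  · exact h.eventuallyIn hA hV hKV
  · exfalso
    refine hU ?_
    have h1 := h.crosses 0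
    rw [pow_zero, div_one] at h1
    have h2 := h1.mem_sheet (h.mem_attractor hA 0) hm
    simp only [neg_neg] at h2
    exact ⟨_, h2, rot_rot _⟩

lemma isOpen_compl_rot_sheet (hA : IsCircleAttractor s (s * m) K) :
    IsOpen (rot '' sheet s m K)ᶜ :=
  ((isCompact_sheet m hA.compact).image continuous_rot).isClosed.isOpen_compl

lemma sheet_diff_subset (hA : IsCircleAttractor s (s * m) K) :
    sheet s m K \ singularSet s ⊆ (rot '' sheet s m K)ᶜ :=
  fun _ hq hq' => hq.2 (sheet_inter_rot hA hA ⟨hq.1, hq'⟩)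

/-- The generating trajectory is the one over a dense orbit of `K` that avoids the discontinuity. -/
theorem isAttractor_sheet (hA : IsCircleAttractor s (s * m) K) (hD : HasDenseOrbit s (s * m) K) :
    IsAttractor s (1, m) (sheet s m K \ singularSet s) := by
  have p0 := s_pos (s := s)
  have hcl := closure_sheet_diff (s := s) m hA.compact
  refine ⟨disjoint_sdiff_left, by rw [hcl], ?_, ?_, ?_⟩
  · intro I τ hτ h0 hL t ht _
    by_cases hZ : τ t ∈ singularSet s
    · exact Or.inr hZ
    · exact Or.inl ⟨hτ.mem_sheet hA h0 hL.2 hL.1 t ht, hZ⟩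
  · exact ⟨_, isOpen_compl_rot_sheet hA, sheet_diff_subset hA, attracts_sheet hA⟩
  · obtain ⟨y, hy, hyK, hstep, hdense⟩ := hD
    obtain ⟨I, τ, hτ, h⟩ := exists_crosses (s := s) m 0 (s * y 0) one_pos
    have hsub := h.image_subset_sheet (hyK 0) hτ hA
    have hch : ∀ n : ℕ, Crosses s m I τ (crossTime s 0 1 n) (s ^ n * 1) (s * y n) := fun n =>
      h.chain hτ (y := fun n : ℕ => y n) (by simp) (N := n) (fun j _ => hy _)
        (fun j _ => by simpa using hstep j) n le_rfl
    refine ⟨I, τ, hτ, h.left_mem, ⟨_, h.right_mem, lt_add_div s 0 one_pos⟩, ?_⟩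
    congr 1
    refine Subset.antisymm ?_ ((isClosed_sheet m hA.compact).closure_subset_iff.2 ?_)
    · refine closure_subset_sheet m (hdense 0) ?_
      rintro x hx _ ⟨n, hn, rfl⟩
      obtain ⟨n, rfl⟩ := Int.eq_ofNat_of_zero_le hn
      have hc := hch n
      have h0 : 0 ≤ crossTime s 0 1 n := by
        have := crossTime_ge (s := s) one_pos 0 n
        have h1 : (0 : ℝ) ≤ n * (s / 1) := by positivity
        linarith
      have ht : crossTime s 0 1 n + x / (s ^ n * 1) ∈
          Icc (crossTime s 0 1 n) (crossTime s 0 1 n + s / (s ^ n * 1)) := by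
        have h1 := div_pos hx.1 hc.pos
        have h2 := div_le_div_of_nonneg_right hx.2.le hc.pos.le
        exact ⟨by linarith, by linarith⟩
      refine ⟨_, ⟨hc.subset ht, h0.trans ht.1⟩, ?_⟩
      rw [hc.eqOn ht, segment, add_sub_cancel_left, mul_div_cancel₀ _ hc.pos.ne']
    · rintro _ ⟨t, ⟨ht, -⟩, rfl⟩
      exact hsub t ht

end


/-! ### Density of basins, cycles -/

section
variable {s : ℝ} [hs : Fact (s ∈ Ioo (0 : ℝ) 1)]
variable {m : ℝ} {I : Set ℝ} {τ : ℝ → Surface s} {a v z : ℝ} {K : Set ℝ}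

/-- A vertical slice of the sheet consists of translates of the null set `K`, so it contains no
nonempty open set. -/
lemma interior_sheet (h0 : volume K = 0) :
    interior (sheet s m K) = ∅ := by
  by_contra hne
  have p0 := s_pos (s := s)
  obtain ⟨q, hq⟩ := nonempty_iff_ne_empty.2 hne
  have h1 : sheet s m K ⊆ closure ((fun p : ℝ × ℝ => cyl s p.1 (s * p.2 + m * p.1)) ''
      (Ioo 0 s ×ˢ K)) :=
    closure_subset_sheet m subset_closure fun x hx y hy => ⟨(x, y), ⟨hx, hy⟩, rfl⟩
  obtain ⟨_, hq1, ⟨⟨x, κ⟩, ⟨hx, hκ⟩, rfl⟩⟩ :=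
    mem_closure_iff.1 (h1 (interior_subset hq)) _ isOpen_interior hq
  simp only at hx hκ hq1
  have hc : Continuous fun y : ℝ => cyl s x (s * y + m * x) :=
    (continuous_sheet_map m).comp (f := fun y : ℝ => (x, y)) (by fun_prop)
  have hU := (isOpen_interior (s := sheet s m K)).preimage hc
  have hsub : (fun y : ℝ => cyl s x (s * y + m * x)) ⁻¹' interior (sheet s m K) ⊆
      ⋃ k : ℤ, (fun y : ℝ => y + -(k / s)) ⁻¹' K := by
    intro y hy
    obtain ⟨κ', hκ', k, hk⟩ := (cyl_mem_sheet_iff hx).1 (interior_subset hy)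
    refine mem_iUnion.2 ⟨k, ?_⟩
    have : y + -(k / s) = κ' := by
      field_simp [p0.ne']
      linarith
    rw [mem_preimage, this]
    exact hκ'
  have hnull : volume ((fun y : ℝ => cyl s x (s * y + m * x)) ⁻¹' interior (sheet s m K)) = 0 := by
    refine measure_mono_null hsub (measure_iUnion_null fun k => ?_)
    rw [measure_preimage_add_right, h0]
  have := (hU.measure_eq_zero_iff volume).1 hnull
  rw [eq_empty_iff_forall_notMem] at this
  exact this κ hq1

lemma compl_subset_basin (hA : IsCircleAttractor s (s * m) K) :
    (rot '' sheet s m K)ᶜ ⊆ basin s (1, m) (sheet s m K \ singularSet s) :=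
  subset_sUnion_of_mem ⟨isOpen_compl_rot_sheet hA, sheet_diff_subset hA, attracts_sheet hA⟩

lemma interior_image_rot (A : Set (Surface s)) : interior (rot '' A) = rot '' interior A :=
  (rotHomeo.image_interior A).symm

lemma dense_basin (hA : IsCircleAttractor s (s * m) K) (h0 : volume K = 0) :
    Dense (basin s (1, m) (sheet s m K \ singularSet s)) := by
  refine Dense.mono (compl_subset_basin hA) ?_
  rw [← interior_eq_empty_iff_dense_compl, interior_image_rot, interior_sheet h0, image_empty]

lemma dense_basin_rot (hA : IsCircleAttractor s (s * m) K) (h0 : volume K = 0) :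
    Dense (basin s (-(1, m)) (rot '' (sheet s m K \ singularSet s))) :=
  (dense_image_rot (dense_basin hA h0)).mono (image_rot_basin_subset _ _)

lemma image_rotNeg (I : Set ℝ) (τ : ℝ → Surface s) :
    (fun u => rot (τ (-u))) '' (-I) = rot '' (τ '' I) := by
  ext q
  constructor
  · rintro ⟨t, ht, rfl⟩
    exact ⟨_, ⟨-t, ht, rfl⟩, rfl⟩
  · rintro ⟨_, ⟨t, ht, rfl⟩, rfl⟩
    exact ⟨-t, by simpa using ht, by simp⟩

protected lemma IsSaddleConnection.rotNeg {d : ℝ × ℝ} (h : IsSaddleConnection s d I τ) :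
    IsSaddleConnection s d (-I) (fun u => rot (τ (-u))) := by
  obtain ⟨h1, a, b, hab, rfl, ha, hb⟩ := h
  refine ⟨h1.rotNeg, -b, -a, neg_lt_neg hab, ?_, ?_, ?_⟩
  · ext t; simp only [Set.mem_neg, mem_Icc]; constructor <;> rintro ⟨h1, h2⟩ <;> constructor <;> linarith
  · rw [rot_mem_singularSet, neg_neg]; exact hb
  · rw [rot_mem_singularSet, neg_neg]; exact ha

protected lemma IsCycle.rot {d : ℝ × ℝ} {L : Set (Surface s)} (h : IsCycle s d L) :
    IsCycle s d (rot '' L) := by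
  obtain ⟨I, τ, hτ, hsc, rfl, ⟨e⟩⟩ := h
  refine ⟨-I, _, hτ.rotNeg, fun h => hsc ?_, image_rotNeg I τ, ⟨?_⟩⟩
  · have := h.rotNeg
    rwa [neg_neg, rotNeg_rotNeg] at this
  · exact (rotHomeo.image (τ '' I)).symm.trans e

lemma sheet_disjoint_singularSet (hA : IsCircleAttractor s (s * m) K) (hK : K ⊆ Ioo 0 1)
    (hr : ∀ κ ∈ K, ∀ n : ℤ, s * κ + s * m ≠ n) : Disjoint (sheet s m K) (singularSet s) := by
  have p0 := s_pos (s := s)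
  have p1 := s_lt_one (s := s)
  rw [disjoint_left]
  rintro _ ⟨⟨x, κ⟩, ⟨hx, hκ⟩, rfl⟩
  have h1 := hK hκ
  simp only at hx hκ h1 ⊢
  rcases hx.1.eq_or_lt with h | h
  · subst h
    simp only [mul_zero, add_zero]
    rw [cyl_left_low_mem_singularSet ⟨h1.1.le, h1.2.le⟩]
    rintro (h | h)
    exacts [h1.1.ne' h, h1.2.ne h]
  · rcases hx.2.eq_or_lt with h2 | h2
    · subst h2
      rw [cyl_mem_singularSet hx]
      have h3 : Int.fract (x * κ + m * x) ≠ 0 := fun h3 => by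
        have := Int.fract_add_floor (x * κ + m * x)
        rw [h3, zero_add] at this
        exact hr κ hκ _ (by rw [mul_comm x m]; exact this.symm)
      grind
    · exact cyl_notMem_singularSet ⟨h, h2⟩ _

/-- The closed curve that runs through the segments starting at the heights `s * y n`. -/
noncomputable def cycleCurve (s : ℝ) [Fact (s ∈ Ioo (0 : ℝ) 1)] (m : ℝ) (y : ℤ → ℝ) (u : ℝ) :
    Surface s := cyl s (s * Int.fract u) (s * y ⌊u⌋ + m * (s * Int.fract u))

lemma cyl_right_eq {y y' : ℝ} {k : ℤ} (hy' : y' ∈ Ioo (0 : ℝ) 1) (hk : s * y + s * m = y' + k) :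
    cyl s s (s * y + m * s) = cyl s 0 (s * y') := by
  rw [cyl_right, mul_comm m, hk, Int.fract_add_intCast, Int.fract_eq_self.2 ⟨hy'.1.le, hy'.2⟩]

lemma continuous_cycleCurve {y : ℤ → ℝ} (hy : ∀ n, y n ∈ Ioo (0 : ℝ) 1)
    (hstep : ∀ n, ∃ k : ℤ, s * y n + s * m = y (n + 1) + k) : Continuous (cycleCurve s m y) := by
  have hfl : ∀ (n : ℤ) (u : ℝ), u ∈ Ico (n : ℝ) (n + 1) →
      cycleCurve s m y u = cyl s (s * (u - n)) (s * y n + m * (s * (u - n))) := by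
    intro n u hu
    have h1 : ⌊u⌋ = n := Int.floor_eq_iff.2 hu
    rw [cycleCurve, Int.fract, h1]
  have hc : ∀ n : ℤ, Continuous fun u : ℝ => cyl s (s * (u - n)) (s * y n + m * (s * (u - n))) :=
    fun n => (continuous_sheet_map m).comp (f := fun u : ℝ => (s * (u - n), y n)) (by fun_prop)
  rw [continuous_iff_continuousAt]
  intro u₀
  obtain ⟨n, hn⟩ : ∃ n : ℤ, ⌊u₀⌋ = n + 1 := ⟨⌊u₀⌋ - 1, by ring⟩
  have h0 : (n : ℝ) + 1 ≤ u₀ := by have := Int.floor_le u₀; rw [hn] at this; exact_mod_cast this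
  have h1 : u₀ < n + 1 + 1 := by
    have := Int.lt_floor_add_one u₀; rw [hn] at this; exact_mod_cast this
  have hglue : Continuous fun u : ℝ => if u ≤ n + 1 then
      cyl s (s * (u - n)) (s * y n + m * (s * (u - n))) else
      cyl s (s * (u - (n + 1 : ℤ))) (s * y (n + 1) + m * (s * (u - (n + 1 : ℤ)))) := by
    refine Continuous.if_le (hc n) (hc (n + 1)) continuous_id continuous_const fun u hu => ?_
    have hu' : u = n + 1 := hu
    obtain ⟨k, hk⟩ := hstep n
    rw [hu']
    push_cast
    simp only [add_sub_cancel_left, mul_one, sub_self, mul_zero, add_zero]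
    exact cyl_right_eq (hy _) hk
  refine hglue.continuousAt.congr ?_
  filter_upwards [Ioo_mem_nhds (show (n : ℝ) < u₀ by linarith) h1] with u hu
  split_ifs with h2
  · rcases h2.eq_or_lt with h3 | h3
    · have h4 := hfl (n + 1) u ⟨by push_cast; exact h3.ge, by push_cast; linarith⟩
      rw [h4, h3]
      obtain ⟨k, hk⟩ := hstep n
      push_cast
      simp only [add_sub_cancel_left, mul_one, sub_self, mul_zero, add_zero]
      exact cyl_right_eq (hy _) hk
    · exact (hfl n u ⟨hu.1.le, h3⟩).symm
  · exact (hfl (n + 1) u ⟨by push_cast; linarith, by push_cast; exact hu.2⟩).symm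

lemma range_cycleCurve {y : ℤ → ℝ} (hy : ∀ n, y n ∈ Ioo (0 : ℝ) 1)
    (hstep : ∀ n, ∃ k : ℤ, s * y n + s * m = y (n + 1) + k) :
    range (cycleCurve s m y) = sheet s m (range y) := by
  have p0 := s_pos (s := s)
  refine Subset.antisymm ?_ ?_
  · rintro _ ⟨u, rfl⟩
    have h0 := Int.fract_nonneg u
    have h1 := Int.fract_lt_one u
    exact cyl_mem_sheet ⟨by positivity, by nlinarith⟩ (mem_range_self _)
  · rintro _ ⟨⟨x, _⟩, ⟨hx, n, rfl⟩, rfl⟩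
    simp only at hx ⊢
    rcases hx.2.eq_or_lt with h | h
    · obtain ⟨k, hk⟩ := hstep n
      refine ⟨(n + 1 : ℤ), ?_⟩
      rw [cycleCurve, Int.fract_intCast, Int.floor_intCast]
      simp only [mul_zero, add_zero]
      rw [h, cyl_right_eq (hy _) hk]
    · have h2 : x / s ∈ Ico (0 : ℝ) 1 := ⟨div_nonneg hx.1 p0.le, (div_lt_one p0).2 h⟩
      refine ⟨n + x / s, ?_⟩
      rw [cycleCurve, Int.fract_intCast_add, Int.floor_intCast_add, Int.fract_eq_self.2 h2,
        Int.floor_eq_zero_iff.2 h2, add_zero, mul_div_cancel₀ _ p0.ne']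

/-- One unit of the parameter is spent on each segment, so `q` segments close up the curve, and
distinct points of the cycle give disjoint half-open segments. -/
lemma cycleCurve_eq_iff {q : ℕ} {y : ℤ → ℝ} (hy : ∀ n, y n ∈ Ioo (0 : ℝ) 1)
    (hq : ∀ i j, y i = y j ↔ (q : ℤ) ∣ i - j) {u w : ℝ} :
    cycleCurve s m y u = cycleCurve s m y w ↔ ∃ k : ℤ, u = w + k * q := by
  have p0 := s_pos (s := s)
  have p1 := s_lt_one (s := s)
  constructor
  · intro e
    have key : Int.fract u = Int.fract w ∧ y ⌊u⌋ = y ⌊w⌋ := by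
      have hf : ∀ u : ℝ, s * Int.fract u ∈ Ico 0 s := fun u =>
        ⟨mul_nonneg p0.le (Int.fract_nonneg u), mul_lt_of_lt_one_right p0 (Int.fract_lt_one u)⟩
      have hu := hf u
      have hw := hf w
      have hyu := hy ⌊u⌋
      have hyw := hy ⌊w⌋
      rcases hu.1.eq_or_lt with h | h
      · have hb := congrArg bump e
        rw [cycleCurve, cycleCurve, ← h, bump_cyl ⟨le_rfl, p0.le⟩, zero_mul, eq_comm,
          bump_eq_zero_iff ⟨hw.1, hw.2.le⟩] at hb
        have hb' := hb.resolve_right hw.2.ne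
        refine ⟨mul_left_cancel₀ p0.ne' (h.symm.trans hb'.symm), ?_⟩
        rw [cycleCurve, cycleCurve, ← h, hb'] at e
        simp only [mul_zero, add_zero] at e
        exact cyl_left_low_inj hyu ⟨hyw.1.le, hyw.2.le⟩ e
      · obtain ⟨h1, k, hk⟩ := cyl_inj ⟨h, hu.2⟩ ⟨hw.1, hw.2.le⟩ e
        refine ⟨mul_left_cancel₀ p0.ne' h1, ?_⟩
        rw [h1] at hk
        have h2 : s * y ⌊u⌋ = s * y ⌊w⌋ + k := by linarith
        have a1 := mul_pos p0 hyu.1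
        have a2 := mul_pos p0 hyw.1
        have a3 := mul_lt_of_lt_one_right p0 hyu.2
        have a4 := mul_lt_of_lt_one_right p0 hyw.2
        have k1 : (k : ℝ) < 1 := by linarith
        have k2 : (-1 : ℝ) < k := by linarith
        have k0 : k = 0 := by
          have : k < 1 := by exact_mod_cast k1
          have : -1 < k := by exact_mod_cast k2
          omega
        rw [k0, Int.cast_zero, add_zero] at h2
        exact mul_left_cancel₀ p0.ne' h2
    obtain ⟨k, hk⟩ := (hq _ _).1 key.2
    refine ⟨k, ?_⟩
    have h1 := Int.fract_add_floor u
    have h2 := Int.fract_add_floor w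
    have h3 : (⌊u⌋ : ℝ) - ⌊w⌋ = q * k := by exact_mod_cast hk
    linarith [key.1]
  · rintro ⟨k, rfl⟩
    have h1 : w + k * q = w + ((k * q : ℤ) : ℝ) := by push_cast; ring
    have h2 : y (⌊w⌋ + k * q) = y ⌊w⌋ := (hq _ _).2 ⟨k, by ring⟩
    rw [h1, cycleCurve, cycleCurve, Int.fract_add_intCast, Int.floor_add_intCast, h2]

/-- The maximal trajectory runs through the sheet again and again, slowed by the factor `s` at each
crossing. The circle is therefore exhibited with `cycleCurve`, periodic with period `q`, and not
with the trajectory's own time. -/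
theorem isCycle_sheet (hA : IsCircleAttractor s (s * m) K) (hR : IsRegularCycle s (s * m) K) :
    IsCycle s (1, m) (sheet s m K \ singularSet s) := by
  have p0 := s_pos (s := s)
  obtain ⟨q, y, hq0, hy, rfl, hstep, hq⟩ := hR
  have hdisj : Disjoint (sheet s m (range y)) (singularSet s) := by
    refine sheet_disjoint_singularSet hA (range_subset_iff.2 hy) ?_
    rintro _ ⟨n, rfl⟩ k hk
    obtain ⟨j, hj⟩ := hstep n
    have h1 : y (n + 1) = ((k - j : ℤ) : ℝ) := by push_cast; linarith
    have h2 := hy (n + 1)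
    rw [h1] at h2
    have h3 : 0 < k - j := by exact_mod_cast h2.1
    have h4 : k - j < 1 := by exact_mod_cast h2.2
    omega
  rw [hdisj.sdiff_eq_left]
  obtain ⟨I, τ, hτ, h⟩ := exists_crosses (s := s) m 0 (s * y 0) one_pos
  have hch : ForwardChain s m I τ 0 1 (fun n : ℕ => y n) :=
    ⟨fun n => hy _, fun n => by simpa using hstep n, fun n =>
      h.chain hτ (y := fun n : ℕ => y n) (by simp) (N := n) (fun j _ => hy _)
        (fun j _ => by simpa using hstep j) n le_rfl⟩
  refine ⟨I, τ, hτ, ?_, ?_, ?_⟩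
  · rintro ⟨-, a, b, hab, rfl, -⟩
    exact hch.not_isGreatest b (isGreatest_Icc hab.le)
  · refine Subset.antisymm
      (image_subset_iff.2 (h.image_subset_sheet (mem_range_self _) hτ hA)) ?_
    rintro _ ⟨⟨x, _⟩, ⟨hx, n, rfl⟩, rfl⟩
    obtain ⟨j, hj⟩ : ∃ j : ℕ, y n = y j := by
      -- The forward chain only supplies nonnegative indices; periodicity reaches every point of the
      -- cycle with them.
      refine ⟨(n % q).toNat, (hq _ _).2 ?_⟩
      rw [Int.toNat_of_nonneg (Int.emod_nonneg _ (by omega))]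
      exact Int.dvd_self_sub_emod
    have hc := hch.crosses j
    simp only at hx ⊢
    rw [hj]
    refine ⟨crossTime s 0 1 j + x / (s ^ j * 1), hc.subset ?_, ?_⟩
    · have h1 := div_nonneg hx.1 hc.pos.le
      have h2 := div_le_div_of_nonneg_right hx.2 hc.pos.le
      exact ⟨by linarith, by linarith⟩
    · rw [hc.eqOn, segment, add_sub_cancel_left, mul_div_cancel₀ _ hc.pos.ne']
      have h1 := div_nonneg hx.1 hc.pos.le
      have h2 := div_le_div_of_nonneg_right hx.2 hc.pos.le
      exact ⟨by linarith, by linarith⟩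
  · have hq1 : (0 : ℝ) < q := by exact_mod_cast hq0
    have : Fact ((0 : ℝ) < q) := ⟨hq1⟩
    have hper : Function.Periodic (cycleCurve s m y) (q : ℝ) := fun u =>
      (cycleCurve_eq_iff hy hq).2 ⟨1, by simp⟩
    have hrange := range_cycleCurve (m := m) hy hstep
    let g : AddCircle (q : ℝ) → sheet s m (range y) := fun x => ⟨hper.lift x, by
      induction x using QuotientAddGroup.induction_on with
      | H u => rw [← hrange]; exact mem_range_self u⟩
    have hg : Continuous g := by
      refine Continuous.subtype_mk ?_ _
      exact continuous_quot_lift _ (continuous_cycleCurve hy hstep)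
    have hbij : Function.Bijective g := by
      constructor
      · intro x x' e
        induction x using QuotientAddGroup.induction_on with
        | H u =>
          induction x' using QuotientAddGroup.induction_on with
          | H w =>
            obtain ⟨k, hk⟩ := (cycleCurve_eq_iff hy hq).1 (congrArg Subtype.val e)
            refine (QuotientAddGroup.eq_iff_sub_mem.2 ?_)
            exact AddSubgroup.mem_zmultiples_iff.2 ⟨k, by rw [hk]; simp⟩
      · rintro ⟨p, hp⟩
        rw [← hrange] at hp
        obtain ⟨u, rfl⟩ := hp
        exact ⟨(u : AddCircle (q : ℝ)), rfl⟩
    exact ⟨((Continuous.homeoOfEquivCompactToT2 (f := Equiv.ofBijective g hbij) hg).symm).trans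
      (AddCircle.homeomorphCircle hq1.ne')⟩

end


/-! ### Laminations -/

section
variable {s : ℝ} [hs : Fact (s ∈ Ioo (0 : ℝ) 1)]
variable {m : ℝ} {I : Set ℝ} {τ : ℝ → Surface s} {a v z : ℝ} {K : Set ℝ}

lemma Crosses.exists_time (h : Crosses s m I τ a v z) {x : ℝ} (hx : x ∈ Icc 0 s) :
    ∃ t ∈ Icc a (a + s / v), τ t = cyl s x (z + m * x) := by
  have h1 := div_nonneg hx.1 h.pos.le
  have h2 := div_le_div_of_nonneg_right hx.2 h.pos.le
  have ht : a + x / v ∈ Icc a (a + s / v) := ⟨by linarith, by linarith⟩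
  refine ⟨_, ht, ?_⟩
  rw [h.eqOn ht, segment, add_sub_cancel_left, mul_div_cancel₀ _ h.pos.ne']

lemma Crosses.exists_backwardChain {y : ℕ → ℝ} (h : Crosses s m I τ a v (s * y 0))
    (hτ : IsMaxTrajectory s (1, m) I τ) (hy : ∀ n, y n ∈ Ioo (0 : ℝ) 1)
    (hstep : ∀ n, ∃ k : ℤ, s * y (n + 1) + s * m = y n + k) :
    ∃ b, b 0 = a ∧ BackwardChain s m I τ b v y := by
  let b : ℕ → ℝ := fun n => Nat.rec a (fun n b => b - s / (v / s ^ (n + 1))) n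
  refine ⟨b, rfl, hy, hstep, fun n => ?_, fun n => ?_⟩
  · induction n with
    | zero => rw [pow_zero, div_one]; exact h
    | succ n ih =>
      obtain ⟨k, hk⟩ := hstep n
      have := ih.prev hτ (hy n) (z' := s * y (n + 1)) (k := k) (by rw [← hk]; ring)
      rw [div_div, ← pow_succ] at this
      exact this
  · show b n - s / (v / s ^ (n + 1)) + _ = _
    ring

theorem isLamination_sheet (hA : IsCircleAttractor s (s * m) K) (h0 : volume K = 0) :
    IsLamination s (1, m) (sheet s m K \ singularSet s) := by
  have hcl := closure_sheet_diff (s := s) m hA.compact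
  refine ⟨disjoint_sdiff_left, by rw [hcl], ?_, ?_⟩
  · rw [IsNowhereDense, hcl, interior_sheet h0]
  · refine ⟨{l | l ⊆ sheet s m K \ singularSet s ∧ ∃ (I : Set ℝ) (τ : ℝ → Surface s),
      IsMaxTrajectory s (1, m) I τ ∧ l = τ '' I \ singularSet s}, ?_, fun l hl => hl.2⟩
    refine Subset.antisymm ?_ (sUnion_subset fun l hl => hl.1)
    rintro q ⟨⟨⟨x, κ⟩, ⟨hx, hκ⟩, rfl⟩, hZ⟩
    obtain ⟨I, τ, hτ, h⟩ := exists_crosses (s := s) m 0 (s * κ) one_pos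
    obtain ⟨t, ht, e⟩ := h.exists_time hx
    refine ⟨τ '' I \ singularSet s, ⟨?_, I, τ, hτ, rfl⟩, ⟨⟨t, h.subset ht, e⟩, hZ⟩⟩
    exact sdiff_subset_sdiff_left (image_subset_iff.2 (h.image_subset_sheet hκ hτ hA))

protected lemma IsLamination.rot {d : ℝ × ℝ} {L : Set (Surface s)} (h : IsLamination s d L) :
    IsLamination s d (rot '' L) := by
  refine ⟨?_, ?_, ?_, ?_⟩
  · rw [← image_rot_singularSet]; exact (disjoint_image_iff rot_injective).2 h.regular
  · rw [closure_image_rot]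
    conv_lhs => rw [← image_rot_singularSet, ← image_sdiff rot_injective, h.closed]
  · rw [IsNowhereDense, closure_image_rot, interior_image_rot, show interior (closure L) = ∅ from h.nowhereDense,
      image_empty]
  · obtain ⟨F, rfl, hF⟩ := h.leaves
    refine ⟨image rot '' F, by rw [image_sUnion, sUnion_image], ?_⟩
    rintro _ ⟨l, hl, rfl⟩
    obtain ⟨I, τ, hτ, rfl⟩ := hF l hl
    refine ⟨-I, _, hτ.rotNeg, ?_⟩
    rw [image_rotNeg, image_sdiff rot_injective, image_rot_singularSet]

/-! ### Cross-sections -/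

lemma proj_right {y : ℝ} (hy : y ∈ Icc (0 : ℝ) 1) : proj s (s, y) = cyl s 0 (s * y) := by
  rw [proj_glue_A hy.1 hy.2, cyl_left_low hy]

/-- Both ends of the side represent the singular point, which lies in the closed sheet as soon as 0
is in `K`. Hence both 0 and 1 must be in `K` for equality. -/
lemma crossSection_sheet (hA : IsCircleAttractor s (s * m) K) (h0 : (0 : ℝ) ∈ K)
    (h1 : (1 : ℝ) ∈ K) : crossSection s (sideA s) (sheet s m K \ singularSet s) = K := by
  have p0 := s_pos (s := s)
  ext y
  rw [crossSection, closure_sheet_diff m hA.compact]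
  simp only [sideA, rep_iff, mem_ofPred_eq]
  constructor
  · rintro ⟨hy, q, hq, -, rfl⟩
    rw [proj_right hy] at hq
    rcases hy.1.eq_or_lt with h | h
    · rwa [← h]
    · rcases hy.2.eq_or_lt with h' | h'
      · rwa [h']
      · exact (left_mem_sheet_iff hA ⟨h, h'⟩).1 hq
  · intro hy
    have hy' := hA.subset hy
    refine ⟨hy', _, ?_, mem_polygon_right ⟨p0.le, le_rfl⟩ hy', rfl⟩
    rw [proj_right hy']
    exact left_mem_sheet hy

/-- A leaf cannot cross `R⁻`, because `bump` after rotation vanishes on the sheet. So it crosses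
`R⁺` and reaches the right side. -/
lemma hasCantorCrossSection_sheet (hA : IsCircleAttractor s (s * m) K) (h0 : (0 : ℝ) ∈ K)
    (h1 : (1 : ℝ) ∈ K) (hP : Preperfect K) (hd : dimH K = 0) :
    HasCantorCrossSection s (1, m) (sideA s) (sheet s m K \ singularSet s) := by
  have p0 := s_pos (s := s)
  refine ⟨?_, ?_⟩
  · intro I τ hτ hsub
    obtain ⟨u, hu⟩ := hτ.nondegenerate
    rcases hτ.crossesAt_of_interior hu with ⟨a, v, z, h, -⟩ | ⟨a, v, z, h, -⟩
    · refine ⟨_, h.right_mem, Int.fract (z + m * s), ⟨Int.fract_nonneg _, (Int.fract_lt_one _).le⟩,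
        rep_iff.2 ⟨mem_polygon_right ⟨p0.le, le_rfl⟩ ⟨Int.fract_nonneg _, (Int.fract_lt_one _).le⟩,
        ?_⟩⟩
      rw [h.apply_right, cyl_eq_fract ⟨p0.le, le_rfl⟩]; rfl
    · exfalso
      have h2 := h.mid_notMem
      rw [rot_mem_singularSet] at h2
      have h3 := hsub ⟨⟨_, h.subset ⟨h.mid.1.le, h.mid.2.le⟩, rfl⟩, h2⟩
      have h4 := bump_rot_of_mem_sheet h3.1
      rw [h.bump_mid] at h4
      have := pow_pos p0 2
      linarith
  · rw [crossSection_sheet hA h0 h1]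
    exact ⟨⟨hA.nonempty, hA.compact, hP, isTotallyDisconnected_of_volume
      (volume_eq_zero_of_dimH hd)⟩, hd⟩

lemma rep_rot {w : ℝ × ℝ} {q : Surface s} (h : Rep s w q) : Rep s (planeRot s w) (rot q) := by
  obtain ⟨h1, rfl⟩ := rep_iff.1 h
  exact rep_iff.2 ⟨planeRot_mem h1, (rot_proj h1).symm⟩

lemma planeRot_sideA (y : ℝ) : planeRot s (sideA s y) = sideC s (1 - y) := by
  simp only [planeRot, sideA, sideC]; congr 1; ring

lemma planeRot_sideC (y : ℝ) : planeRot s (sideC s y) = sideA s (1 - y) := by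
  simp only [planeRot, sideA, sideC, neg_neg]; congr 1; ring

lemma IsCantorSet.image_isometryEquiv (e : ℝ ≃ᵢ ℝ) (h : IsCantorSet K) (h0 : volume (e '' K) = 0) :
    IsCantorSet (e '' K) := by
  refine ⟨h.1.image e, h.2.1.image e.continuous, ?_, isTotallyDisconnected_of_volume h0⟩
  rintro _ ⟨x, hx, rfl⟩
  rw [accPt_iff_nhds]
  intro U hU
  obtain ⟨y, ⟨hyU, hyK⟩, hne⟩ := accPt_iff_nhds.1 (h.2.2.1 x hx) _
    (e.continuous.continuousAt.preimage_mem_nhds hU)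
  exact ⟨e y, ⟨hyU, mem_image_of_mem e hyK⟩, fun h => hne (e.injective h)⟩

lemma crossSection_rot (L : Set (Surface s)) :
    crossSection s (sideC s) (rot '' L) = IsometryEquiv.subLeft 1 '' crossSection s (sideA s) L := by
  ext y
  rw [crossSection, closure_image_rot]
  constructor
  · rintro ⟨hy, _, ⟨q, hq, rfl⟩, hr⟩
    refine ⟨1 - y, ⟨⟨by linarith [hy.2], by linarith [hy.1]⟩, q, hq, ?_⟩, by simp⟩
    have := rep_rot hr
    rwa [rot_rot, planeRot_sideC] at this
  · rintro ⟨y', ⟨hy, q, hq, hr⟩, rfl⟩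
    have := rep_rot hr
    rw [planeRot_sideA] at this
    exact ⟨⟨by simpa using hy.2, by simpa using hy.1⟩, _, mem_image_of_mem _ hq, by simpa using this⟩

protected lemma HasCantorCrossSection.rot {d : ℝ × ℝ} {L : Set (Surface s)}
    (h : HasCantorCrossSection s d (sideA s) L) :
    HasCantorCrossSection s d (sideC s) (rot '' L) := by
  obtain ⟨h1, h2, h3⟩ := h
  have hd : dimH (IsometryEquiv.subLeft 1 '' crossSection s (sideA s) L) = 0 := by
    rw [IsometryEquiv.dimH_image, h3]
  refine ⟨?_, ?_, ?_⟩
  · intro I τ hτ hsub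
    obtain ⟨t, ht, y, hy, hr⟩ := h1 (-I) _ hτ.rotNeg (by
      rw [image_rotNeg]
      nth_rewrite 1 [← image_rot_singularSet]
      rw [← image_sdiff rot_injective, ← image_rot_image_rot L]
      exact image_mono hsub)
    have := rep_rot hr
    rw [rot_rot, planeRot_sideA] at this
    exact ⟨-t, ht, 1 - y, ⟨by linarith [hy.2], by linarith [hy.1]⟩, this⟩
  · rw [crossSection_rot]
    exact h2.image_isometryEquiv _ (volume_eq_zero_of_dimH hd)
  · rw [crossSection_rot, hd]

/-! ### The basin of the lamination -/

/-- Otherwise the chain would survive truncation of the domain at `t`, where `t` becomes the least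
time, against `BackwardChain.not_isLeast`. -/
lemma BackwardChain.exists_lt {b y : ℕ → ℝ} (h : BackwardChain s m I τ b v y)
    (hτ : IsMaxTrajectory s (1, m) I τ) {t : ℝ} (ht : t ∈ I) : ∃ n, b n < t := by
  by_contra! hcon
  have hlb : ∀ n, b n ∈ I ∩ Ici t := fun n => ⟨(h.crosses n).left_mem, hcon n⟩
  have key : ∀ u ∈ I, u < t → False := by
    intro u hu hut
    have ht' : t ∈ interior I := mem_interior_iff_mem_nhds.2
      (mem_of_superset (Icc_mem_nhds hut (show t < b 0 + s / (v / s ^ 0) from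
        (hcon 0).trans_lt (lt_add_div s _ (h.crosses 0).pos)))
        (hτ.interval.out hu (h.crosses 0).right_mem))
    have hτ' : IsTrajectory s (1, m) (I ∩ Ici t) τ := by
      refine ⟨hτ.interval.inter ordConnected_Ici, ?_, hτ.continuous.mono inter_subset_left,
        fun w hw => hτ.regular w (interior_mono inter_subset_left hw),
        fun w hw => hτ.straight w (interior_mono inter_subset_left hw)⟩
      have h1 := (h.crosses 0).mid
      refine ⟨_, mem_interior_iff_mem_nhds.2 (mem_of_superset (Icc_mem_nhds h1.1 h1.2) ?_)⟩
      exact fun w hw => ⟨(h.crosses 0).subset hw, (hcon 0).trans hw.1⟩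
    have hch : BackwardChain s m (I ∩ Ici t) τ b v y :=
      ⟨h.mem, h.step, fun n => ⟨(h.crosses n).pos, fun w hw => ⟨(h.crosses n).subset hw,
        (hcon n).trans hw.1⟩, (h.crosses n).eqOn⟩, h.time⟩
    exact hch.not_isLeast hτ' t ⟨⟨ht, mem_Ici.2 le_rfl⟩, fun w hw => hw.2⟩
  exact h.not_isLeast hτ.toIsTrajectory t ⟨ht, fun u hu => not_lt.1 fun hut => key u hu hut⟩

/-- No open set meeting the rotated sheet is attracted: near each of its points pass trajectories
over a dense orbit, which stay in `R⁻` for ever. -/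
theorem basin_sheet (hA : IsCircleAttractor s (s * m) K) (hD : HasDenseOrbit s (s * m) K)
    (h0 : (0 : ℝ) ∈ K) : basin s (1, m) (sheet s m K \ singularSet s) =
      (rot '' (sheet s m K \ singularSet s) ∪ singularSet s)ᶜ := by
  have p0 := s_pos (s := s)
  have hZ : singularSet s ⊆ rot '' sheet s m K := by
    intro q hq
    rw [← image_rot_singularSet] at hq
    refine image_mono ?_ hq
    rw [singularSet_eq, singleton_subset_iff]
    have := left_mem_sheet (s := s) (m := m) h0
    rwa [mul_zero, cyl_eq ⟨le_rfl, p0.le⟩ ⟨le_rfl, zero_le_one⟩] at this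
  have hU : rot '' (sheet s m K \ singularSet s) ∪ singularSet s = rot '' sheet s m K := by
    rw [image_sdiff rot_injective, image_rot_singularSet, sdiff_union_of_subset hZ]
  rw [hU]
  refine Subset.antisymm ?_ (compl_subset_basin hA)
  rintro q ⟨U, ⟨hUo, -, hUa⟩, hqU⟩ ⟨q', hq', rfl⟩
  obtain ⟨y, hy, hyK, hstep, hdense⟩ := hD
  have hsub : sheet s m K ⊆ closure {p | ∃ x ∈ Ioo 0 s, ∃ n : ℤ, p = cyl s x (s * y n + m * x)} := by
    refine closure_subset_sheet m ((hdense 0).trans (closure_mono (image_subset_range y _))) ?_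
    rintro x hx _ ⟨n, rfl⟩
    exact ⟨x, hx, n, rfl⟩
  obtain ⟨_, hpU, x, hx, n, rfl⟩ :=
    mem_closure_iff.1 (hsub hq') _ (hUo.preimage continuous_rot) hqU
  obtain ⟨I, φ, hφ, h⟩ := exists_crosses (s := s) m (-x) (s * y n) one_pos
  have hx0 : (0 : ℝ) ∈ Icc (-x) (-x + s / 1) :=
    ⟨by linarith [hx.1], by rw [div_one]; linarith [hx.2]⟩
  have hφ0 : φ 0 = cyl s x (s * y n + m * x) := by
    rw [h.eqOn hx0, segment]; simp
  obtain ⟨b, -, hb⟩ := Crosses.exists_backwardChain (y := fun j : ℕ => y (n - j)) (a := -x) (v := 1)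
    (by simpa using h) hφ (fun j => hy _) (fun j => by
      obtain ⟨k, hk⟩ := hstep (n - (j + 1 : ℕ))
      exact ⟨k, by rw [hk]; congr 2; push_cast; ring⟩)
  -- This neighbourhood of the attractor omits the midpoints of all crossings of `R⁻`, which the
  -- chosen trajectory passes at arbitrarily late times.
  let V : Set (Surface s) := {q | bump (rot q) < s ^ 2 / 4}
  have hV : IsOpen V := isOpen_lt (continuous_bump.comp continuous_rot) continuous_const
  have hKV : closure (sheet s m K \ singularSet s) ⊆ V := by
    rw [closure_sheet_diff m hA.compact]
    intro p hp
    show bump (rot p) < s ^ 2 / 4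
    rw [bump_rot_of_mem_sheet hp]; positivity
  obtain ⟨t₀, ht₀, hev⟩ := hUa V hV hKV (-I) _ hφ.rotNeg (by simpa using h.subset hx0)
    (by simpa [hφ0] using hpU)
  obtain ⟨j, hj⟩ := hb.exists_lt hφ (show -t₀ ∈ I from ht₀)
  have hc := hb.crosses (j + 1)
  have ht := hb.time j
  have hm := hc.mid
  have := hev (-(b (j + 1) + s / (1 / s ^ (j + 1)) / 2))
    (by simpa using hc.subset ⟨hm.1.le, hm.2.le⟩) (by linarith [hm.2])
  simp only [neg_neg, V, mem_ofPred_eq, rot_rot, hc.bump_mid, lt_irrefl] at this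

end


/-! ### Saddle connections -/

section
variable {s : ℝ} [hs : Fact (s ∈ Ioo (0 : ℝ) 1)]
variable {m : ℝ} {I : Set ℝ} {τ : ℝ → Surface s} {a v z : ℝ} {K : Set ℝ}

lemma ForwardChain.sheet_subset_closure {y : ℕ → ℝ} (h : ForwardChain s m I τ a v y)
    (hK : ∀ κ ∈ K, MapClusterPt κ atTop fun n => y (n + 1)) (t : ℝ) :
    sheet s m K ⊆ closure (τ '' (I ∩ Ioi t)) := by
  obtain ⟨N, hN⟩ := exists_crossTime_gt (s := s) h.pos a t
  have hmono : Monotone (crossTime s a v) := monotone_nat_of_le_succ fun n =>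
    (lt_add_div s _ (h.crosses n).pos).le
  refine closure_subset_sheet (A := (fun n => y (n + 1)) '' Ici N) m ?_ ?_
  · intro κ hκ
    refine mem_closure_iff_nhds.2 fun U hU => ?_
    obtain ⟨n, hn, hn'⟩ := ((hK κ hκ).frequently hU).forall_exists_of_atTop N
    exact ⟨_, hn', n, hn, rfl⟩
  · rintro x hx _ ⟨n, hn, rfl⟩
    obtain ⟨t', ht', e⟩ := (h.crosses (n + 1)).exists_time ⟨hx.1.le, hx.2.le⟩
    refine ⟨t', ⟨(h.crosses (n + 1)).subset ht', ?_⟩, e⟩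
    have hn' : N ≤ n := hn
    exact hN.trans_le ((hmono (show N ≤ n + 1 by omega)).trans ht'.1)

/-- The finite orbit from the discontinuity to itself lifts to a trajectory from `Z` to `Z` that
fills the whole sheet. A non-critical trajectory cannot stay in `R⁻`, as that needs an infinite
regular backward orbit. So it crosses `R⁺` for ever and accumulates on all of the sheet. -/
theorem hasAsymptoticSaddleConnection (hA : IsCircleAttractor s (s * m) K)
    (hK : IsSingularCycle s (s * m) K) : HasAsymptoticSaddleConnection s m := by
  have p0 := s_pos (s := s)
  have hKc := hK
  obtain ⟨q, y, hy0, hy, hstep, ⟨k, hk⟩, rfl⟩ := hK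
  obtain ⟨J, σ, hσ, h⟩ := exists_crosses (s := s) m 0 (s * y 0) one_pos
  have hmem : ∀ {j}, j ≤ q → y j ∈ y '' Iic q := fun hj => mem_image_of_mem y hj
  have hch := h.chain hσ (y := y) rfl hy hstep
  have hsub := h.image_subset_sheet (hmem (Nat.zero_le q)) hσ hA
  have hl := h.isLeast hσ (by rcases hy0 with h | h <;> simp [h])
  have hg := (hch q le_rfl).isGreatest hσ (k := k) (by rw [← hk]; ring)
  set b := crossTime s 0 1 q + s / (s ^ q * 1)
  have hb : 0 < b := (h.right_mem |> hg.1.2).trans_lt' (lt_add_div s 0 one_pos)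
  have hJ : J = Icc 0 b := Subset.antisymm (fun t ht => ⟨hl.1.2 ht, hg.1.2 ht⟩)
    (hσ.interval.out hl.1.1 hg.1.1)
  have himage : σ '' J = sheet s m (y '' Iic q) := by
    refine Subset.antisymm (image_subset_iff.2 hsub) ?_
    rintro _ ⟨⟨x, _⟩, ⟨hx, j, hj, rfl⟩, rfl⟩
    obtain ⟨t, ht, e⟩ := (hch j hj).exists_time hx
    exact ⟨t, (hch j hj).subset ht, e⟩
  refine ⟨J, σ, ⟨hσ.toIsTrajectory, 0, b, hb, hJ, hl.2, hg.2⟩, ?_⟩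
  intro I τ hτ hcrit
  rw [himage]
  obtain ⟨t, ht⟩ := hτ.nondegenerate
  obtain ⟨a, v, w, hw⟩ : ∃ a v w, ForwardChain s m I τ a v w := by
    rcases hτ.future (interior_subset ht) with ⟨u, hu, hZ⟩ | h1 | ⟨b, v, w, h1, -⟩
    · exact absurd ⟨u, ⟨hu.1, fun hi => hτ.regular u hi hZ⟩, hZ⟩ hcrit
    · exact h1
    · exact (hKc.no_backward_orbit hs.out hA w h1.mem h1.step).elim
  refine ⟨fun V hV hKV => hw.eventuallyIn hA hV hKV, fun t₀ _ => ?_⟩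
  exact hw.sheet_subset_closure (hKc.accumulates hs.out hA (fun n => w (n + 1)) hw.mem
    (fun n => hw.step (n + 1))) t₀

/-- A two-sided regular orbit in `K` gives a trajectory with no first and no last time. -/
lemma exists_noncritical (hy : ∃ y : ℤ → ℝ, (∀ n, y n ∈ Ioo (0 : ℝ) 1) ∧ (∀ n, y n ∈ K) ∧
    ∀ n, ∃ k : ℤ, s * y n + s * m = y (n + 1) + k) (hA : IsCircleAttractor s (s * m) K) :
    ∃ I τ, IsMaxTrajectory s (1, m) I τ ∧ ¬ IsCritical s I τ ∧ ∀ t ∈ I, τ t ∈ sheet s m K := by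
  obtain ⟨y, hy, hyK, hstep⟩ := hy
  obtain ⟨I, τ, hτ, h⟩ := exists_crosses (s := s) m 0 (s * y 0) one_pos
  have hf : ForwardChain s m I τ 0 1 (fun n : ℕ => y n) :=
    ⟨fun n => hy _, fun n => by simpa using hstep n, fun n =>
      h.chain hτ (y := fun n : ℕ => y n) (by simp) (N := n) (fun j _ => hy _)
        (fun j _ => by simpa using hstep j) n le_rfl⟩
  obtain ⟨b, -, hb⟩ := Crosses.exists_backwardChain (y := fun j : ℕ => y (-j)) (a := 0) (v := 1)
    (by simpa using h) hτ (fun j => hy _) (fun j => by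
      obtain ⟨k, hk⟩ := hstep (-(j + 1 : ℕ))
      exact ⟨k, by rw [hk]; congr 2; push_cast; ring⟩)
  refine ⟨I, τ, hτ, ?_, h.image_subset_sheet (hyK 0) hτ hA⟩
  rintro ⟨t, ⟨ht, hti⟩, -⟩
  rcases hτ.mem_interior_or ht with h1 | h1 | h1
  exacts [hti h1, hf.not_isGreatest t h1, hb.not_isLeast hτ.toIsTrajectory t h1]

/-- Followed backwards inside the sheet, the trajectory must come from `Z` at one of the heights `s
* 0` or `s * 1`. By `hfree` it then crosses `R⁺` for ever and never ends. -/
lemma not_saddleConnection_in_sheet (hA : IsCircleAttractor s (s * m) K)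
    (hfree : ∀ e : ℝ, e = 0 ∨ e = 1 → ∃ y : ℕ → ℝ, y 0 = e ∧ (∀ n, y (n + 1) ∈ Ioo (0 : ℝ) 1) ∧
      ∀ n, ∃ k : ℤ, s * y n + s * m = y (n + 1) + k)
    (hσ : IsSaddleConnection s (1, m) I τ) (hsub : τ '' I ⊆ sheet s m K) : False := by
  have p0 := s_pos (s := s)
  obtain ⟨hτ, p, q, hpq, rfl, hp, hq⟩ := hσ
  obtain ⟨J, σ, hσ, hJ, he⟩ := hτ.exists_max (dir_ne_zero m)
  have hpI : p ∈ Icc p q := ⟨le_rfl, hpq.le⟩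
  have hqI : q ∈ Icc p q := ⟨hpq.le, le_rfl⟩
  have hl : IsLeast J p := hσ.isLeast_of_singular hpq (hJ hpI) (hJ hqI) (he hpI ▸ hp)
  have hg : IsGreatest J q := hσ.isGreatest_of_singular hpq (hJ hpI) (hJ hqI) (he hqI ▸ hq)
  have hS : ∀ t ∈ J, σ t ∈ sheet s m K := fun t ht => by
    have ht' : t ∈ Icc p q := ⟨hl.2 ht, hg.2 ht⟩
    rw [he ht']; exact hsub (mem_image_of_mem τ ht')
  obtain ⟨t, ht⟩ := hσ.nondegenerate
  have hti := interior_subset ht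
  obtain ⟨a, v, κ, -, h, -⟩ := hσ.crosses_of_mem_sheet hA hti (hσ.regular t ht) (hS t hti)
  rcases h.backward hσ with ⟨a', v', z', h1, h2, h3⟩ | ⟨a', v', z', hz, h1⟩ | ⟨b, y, -, h1⟩
  · have h4 := h1.fract
    rw [h1.apply_left, cyl_mem_singularSet ⟨le_rfl, p0.le⟩] at h3
    obtain ⟨e, he, hze⟩ : ∃ e : ℝ, (e = 0 ∨ e = 1) ∧ Int.fract z' = s * e := by
      rcases h3 with ⟨-, h3⟩ | ⟨-, h3⟩ | ⟨h3, -⟩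
      · exact ⟨0, Or.inl rfl, by simpa using h3⟩
      · exact ⟨1, Or.inr rfl, by simpa using h3⟩
      · exact absurd h3 p0.ne
    obtain ⟨y, hy0, hy, hstep⟩ := hfree e he
    have h5 : ForwardChain s m J σ a' v' y := ⟨hy, hstep, fun n =>
      h4.chain hσ (y := y) (by rw [hze, hy0]) (N := n) (fun j _ => hy j) (fun j _ => hstep j)
        n le_rfl⟩
    exact h5.not_isGreatest q hg
  · have := hS a' h1.left_mem
    rw [h1.apply_left] at this
    exact edge_notMem_sheet hA hz this
  · exact h1.not_isLeast hσ.toIsTrajectory p hl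

/-- A non-critical trajectory inside the closed sheet would have its limiting saddle connection
there too. -/
lemma not_hasAsymptoticSaddleConnection {ρ : ℝ} (hi : Irrational ρ)
    (hδ : s * m = plateauLo s ρ) : ¬ HasAsymptoticSaddleConnection s m := by
  rintro ⟨J, σ, hσ, h⟩
  have hA := isCircleAttractor hs.out (admissible_of_irrational hs.out hi hδ)
  obtain ⟨y, hy, hyK, hstep, -⟩ := hasDenseOrbit_irrational hs.out hi hδ
  obtain ⟨I, τ, hτ, hc, hS⟩ := exists_noncritical ⟨y, hy, hyK, hstep⟩ hA
  obtain ⟨t, ht⟩ := hτ.nondegenerate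
  refine not_saddleConnection_in_sheet hA ?_ hσ
    (((h I τ hτ hc).2 t (interior_subset ht)).trans
      ((isClosed_sheet m hA.compact).closure_subset_iff.2 ?_))
  · rintro e (rfl | rfl)
    · exact exists_free_orbit_zero hs.out hi hδ
    · exact exists_free_orbit_one hs.out hi hδ
  · rintro _ ⟨u, hu, rfl⟩
    exact hS u hu.1

/-- Only ends of rational intervals can occur among finite slopes. The vertical direction is
admitted without deciding whether it belongs to the set. -/
lemma countable_asymptotic : {x | x ∈ ((↑) '' lockedSlopes s : Set (OnePoint ℝ))ᶜ ∧
    HasAsymptoticSaddleConnection s x}.Countable := by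
  have p0 := s_pos (s := s)
  have hc : ({OnePoint.infty} ∪ ((range fun r : ℚ => ((plateauLo s r / s : ℝ) : OnePoint ℝ)) ∪
      range fun r : ℚ => ((plateauHi s r / s : ℝ) : OnePoint ℝ))).Countable :=
    (countable_singleton _).union ((countable_range _).union (countable_range _))
  refine hc.mono ?_
  rintro x ⟨hx, h⟩
  induction x using OnePoint.rec with
  | infty => exact Or.inl rfl
  | coe a =>
    right
    have ha : a ∉ lockedSlopes s := fun h => hx (mem_image_of_mem _ h)
    rcases singular_or_irrational hs.out ha with ⟨r, hr⟩ | ⟨ρ, hi, hδ⟩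
    · rcases hr with hr | hr
      · exact Or.inl ⟨r, by simp only; rw [← hr, mul_div_cancel_left₀ _ p0.ne']⟩
      · exact Or.inr ⟨r, by simp only; rw [← hr, mul_div_cancel_left₀ _ p0.ne']⟩
    · exact absurd h (not_hasAsymptoticSaddleConnection hi hδ)

end

end HomothetySurface


open HomothetySurface in
theorem theorem1 (s : ℝ) (hs : s ∈ Set.Ioo (0 : ℝ) 1) :
    ∃ U C C' : Set (OnePoint ℝ),
      -- (i)
      (IsOpen U ∧ FullMeasure U ∧
        ∀ m ∈ U, ∃ L₁ L₂ : Set (Surface s),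
          (IsCycle s (dirVec m) L₁ ∧ IsAttractor s (dirVec m) L₁) ∧
          (IsCycle s (dirVec m) L₂ ∧ IsAttractor s (-dirVec m) L₂) ∧
          Dense (basin s (dirVec m) L₁) ∧ Dense (basin s (-dirVec m) L₂)) ∧
      -- (ii)
      (C = Uᶜ ∧ IsCantorSet C ∧ dirDimH C = 0) ∧
      -- (iii)
      (C' = {m | m ∈ C ∧ HasAsymptoticSaddleConnection s m} ∧ C'.Countable) ∧
      -- (iv)
      (∀ m ∈ C \ C', m ≠ OnePoint.infty → ∃ L₁ L₂ : Set (Surface s),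
          (IsLamination s (dirVec m) L₁ ∧ IsAttractor s (dirVec m) L₁) ∧
          (IsLamination s (dirVec m) L₂ ∧ IsAttractor s (-dirVec m) L₂) ∧
          HasCantorCrossSection s (dirVec m) (sideA s) L₁ ∧
          HasCantorCrossSection s (dirVec m) (sideC s) L₂ ∧
          basin s (dirVec m) L₁ = (L₂ ∪ singularSet s)ᶜ) := by
  have := Fact.mk hs
  refine ⟨(↑) '' lockedSlopes s, ((↑) '' lockedSlopes s)ᶜ, _,
    ⟨OnePoint.isOpenEmbedding_coe.isOpenMap _ isOpen_lockedSlopes, fullMeasure_lockedSlopes hs, ?_⟩,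
    ⟨rfl, isCantorSet_compl hs, dirDimH_compl hs⟩, ⟨rfl, countable_asymptotic⟩, ?_⟩
  -- The repeller is the rotated attractor. For cycles and laminations rotation is combined with
  -- time reversal, so their direction is kept, while attraction changes to the opposite direction.
  · rintro _ ⟨m, ⟨r, h0, h1⟩, rfl⟩
    have hA := isCircleAttractor hs (admissible_of_lt hs h0.le h1)
    have hR := isRegularCycle_rat hs r h0 h1
    have hv := volume_eq_zero_of_dimH (dimH_circleAttractor hs (ρ := r) (δ := s * m))
    have hat := isAttractor_sheet hA hR.hasDenseOrbit
    have hcy := isCycle_sheet hA hR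
    exact ⟨_, _, ⟨hcy, hat⟩, ⟨hcy.rot, hat.rot⟩, dense_basin hA hv, dense_basin_rot hA hv⟩
  · rintro x ⟨hx, hx'⟩ hinf
    obtain ⟨m, rfl⟩ := OnePoint.ne_infty_iff_exists.1 hinf
    have hm : m ∉ lockedSlopes s := fun h => hx (mem_image_of_mem _ h)
    rcases singular_or_irrational hs hm with ⟨r, hr⟩ | ⟨ρ, hi, hδ⟩
    · obtain ⟨K, hA, hK⟩ := exists_singularCycle hs r hr
      exact absurd ⟨hx, hasAsymptoticSaddleConnection hA hK⟩ hx'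
    · have hA := isCircleAttractor hs (admissible_of_irrational hs hi hδ)
      have hD := hasDenseOrbit_irrational hs hi hδ
      have h0 := zero_mem_circleAttractor hs hi hδ
      have hd := dimH_circleAttractor hs (ρ := ρ) (δ := s * m)
      have hat := isAttractor_sheet hA hD
      have hla := isLamination_sheet hA (volume_eq_zero_of_dimH hd)
      have hcr := hasCantorCrossSection_sheet hA h0 (one_mem_circleAttractor hs hi hδ)
        (preperfect_circleAttractor hs hi hδ) hd
      exact ⟨_, _, ⟨hla, hat⟩, ⟨hla.rot, hat.rot⟩, hcr, hcr.rot, basin_sheet hA hD h0⟩
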